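/- **Setting.** Let $\delta>0$. The primal lattice is $\delta\mathbb Z\times\mathbb R$, the dual lattice $\delta(\mathbb Z+\frac12)\times\mathbb R$, the medial lattice is their union, and the mid-edge lattice is $\delta(\frac12\mathbb Z+\frac14)\times\mathbb R$. For a mid-edge lattice point $e$ write $e^\pm=e\pm\frac\delta2$, $p_e^\pm=e\pm\frac\delta4$, and let $u_e$ (resp. $w_e$) be the primal (resp. dual) point among $p_e^+,p_e^-$. For a medial point $p$ write $p^\pm=p\pm\frac\delta2$, $e_p^\pm=p\pm\frac\delta4$. A *semi-discrete Dobrushin domain* is a bounded simply connected plane domain $\Omega$ whose boundary is a simple closed curve, oriented counterclockwise, made of: the horizontal segment $[a^wa^b]$ of length $\delta/2$; a path of horizontal and vertical segments between primal points from $a^b$ to $b^b$ (the primal arc); the horizontal segment $[b^bb^w]$ of length $\delta/2$; and a path of horizontal and vertical segments between dual points from $b^w$ to $a^w$ (the dual arc). Let $a^\flat,b^\flat$ be the midpoints of $[a^wa^b]$ and $[b^bb^w]$. The mid-edge domain $\Omega^\flat$ consists of the mid-edge lattice points of $\Omega$ together with $a^\flat,b^\flat$. **Model.** A configuration consists of finitely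 many death points on the primal lines in $\Omega$ and bridges on the dual lines in $\Omega$. At each of these points the vertical line is cut, and the two mid-edge strands on its two sides are joined to each other just below and just above the point; a horizontal segment of the primal (resp. dual) arc acts as a bridge (resp. death point) on each dual (resp. primal) line ending on it. This yields a collection of loops on the mid-edge lattice and an interface $\gamma$ from $a^\flat$ to $b^\flat$, oriented with primal lines on its right. The *critical quantum FK-Ising model* with parameter $\rho$ (loop representation) is the probability measure proportional to $\sqrt2^{\,\#\mathrm{loops}}\,d\mathbb P_{\rho,\rho}$, where under $\mathbb P_{\rho,\rho}$ death points and bridges are independent Poisson point processes of intensity $\rho$ on the primal and on the dual lines in $\Omega$. Take $\rho=\frac1{\sqrt2\,\delta}$, let $\nu=e^{-i\pi/4}$, and define $$F(e)=\frac{\nu}{\sqrt\delta}\,\mathbb E\Big[e^{\frac i2W(e,b^\flat)}\mathbf 1_{e\in\gamma}\Big]\quad(e\in\Omega^\flat),\qquad F^\diamond(p)=F(e_p^-)+F(e_p^+),$$ where $W(e,b^\flat)$ is the winding (total rotation, positive counterclockwise) of $\gamma$ from $e$ to $b^\flat$, and where $F$ is extended by $0$ outside $\Omega^\flat$. **S-holomorphicity.**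 Put $\bar\partial f(z)=\frac12\Big[\frac{f(z+\delta/2)-f(z-\delta/2)}{\delta}-\frac{\partial_yf(z)}{i}\Big]$, $\tau(e)=[i(w_e-u_e)]^{-1/2}$ and $\mathrm{Proj}[X,\tau]=\frac12\big[X+\frac{\tau}{\bar\tau}\bar X\big]$. * $f$ is s-holomorphic on the mid-edge domain if $f(e)\in\tau(e)\mathbb R$ for all $e\in\Omega^\flat$, and if, for every mid-edge lattice point $e\in\Omega$ with $e^+,e^-\notin\partial\Omega$, $f$ is differentiable in $y$ at $e$ and $\bar\partial f(e)=0$. * $g$ is s-holomorphic on the medial domain if $\mathrm{Proj}[g(p_e^-),\tau(e)]=\mathrm{Proj}[g(p_e^+),\tau(e)]$ for all $e\in\Omega^\flat$, and if, for every medial point $p\in\Omega$ with $p\pm\frac{3\delta}4\notin\partial\Omega$, $g$ is differentiable in $y$ at $p$ and $\bar\partial g(p)=0$. **Proposition.** The measure of the model is a well-defined probability measure, and the random variable $e^{\frac i2W(e,b^\flat)}\mathbf 1_{e\in\gamma}$ is integrable for every $e\in\Omega^\flat$. If $b^w=b^b+\frac\delta2$ (the interface leaves the domain downwards), then 1. $F$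 is s-holomorphic on the mid-edge domain; 2. $F^\diamond$ is s-holomorphic on the medial domain. If instead $b^w=b^b-\frac\delta2$ (the interface leaves upwards), the same holds for $iF$ and $iF^\diamond$. -/

import Mathlib

open MeasureTheory

noncomputable section

namespace QuantumIsing

/-! ### The semi-discrete lattices

Horizontal coordinates are recorded by integers.  The pair `(k, y) : ℤ × ℝ`, read as a point of the
medial lattice, is the point with abscissa `k δ / 2`; it is primal when `k` is even and dual when
`k` is odd.  Read as a point of the mid-edge lattice, `(j, y)` is the point with abscissa
`j δ / 2 + δ / 4`; it lies between the medial points `(j, y)` and `(j + 1, y)`.  In both lattices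
the right and left neighbours (at distance `δ / 2`) are obtained by adding `± 1` to the integer. -/

/-- The position in the plane of a point of the medial lattice. -/
def medialPos (δ : ℝ) (p : ℤ × ℝ) : ℂ := ⟨(p.1 : ℝ) * (δ / 2), p.2⟩

/-- The position in the plane of a point of the mid-edge lattice. -/
def midEdgePos (δ : ℝ) (e : ℤ × ℝ) : ℂ := ⟨(2 * (e.1 : ℝ) + 1) * (δ / 4), e.2⟩

/-- The position of the primal extremity `u_e` of a mid-edge `e`. -/
def primalEnd (δ : ℝ) (e : ℤ × ℝ) : ℂ :=
  if Even e.1 then medialPos δ (e.1, e.2) else medialPos δ (e.1 + 1, e.2)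

/-- The position of the dual extremity `w_e` of a mid-edge `e`. -/
def dualEnd (δ : ℝ) (e : ℤ × ℝ) : ℂ :=
  if Even e.1 then medialPos δ (e.1 + 1, e.2) else medialPos δ (e.1, e.2)

/-! ### Dobrushin domains -/

/-- A semi-discrete Dobrushin domain of mesh size `δ`.

The vertices `vertex 0, …, vertex r` are those of the primal path from `a^b` to `b^b`, the vertices
`vertex (r + 1), …, vertex (r + s + 1)` those of the dual path from `b^w` to `a^w`, and
`vertex (r + s + 2)` is `vertex 0` again.  Consecutive vertices are joined by horizontal or vertical
segments, which form a simple closed curve.  The domain is the bounded connected component that this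
curve delimits; it lies to the left of the curve, that is, the curve is oriented
counterclockwise. -/
structure DobrushinDomain (δ : ℝ) where
  /-- The domain, as an open subset of the plane. -/
  carrier : Set ℂ
  /-- The number of segments of the primal path. -/
  r : ℕ
  /-- The number of segments of the dual path. -/
  s : ℕ
  /-- The successive vertices of the boundary. -/
  vertex : ℕ → ℤ × ℝ
  closed : vertex (r + s + 2) = vertex 0
  primal : ∀ i ≤ r, Even (vertex i).1
  dual : ∀ i, r < i → i ≤ r + s + 1 → Odd (vertex i).1
  axis : ∀ i < r + s + 2,
    ((vertex i).1 = (vertex (i + 1)).1 ∧ (vertex i).2 ≠ (vertex (i + 1)).2) ∨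
    ((vertex i).1 ≠ (vertex (i + 1)).1 ∧ (vertex i).2 = (vertex (i + 1)).2)
  /-- `[b^b b^w]` is a mid-edge. -/
  b_edge : |(vertex (r + 1)).1 - (vertex r).1| = 1
  /-- `[a^w a^b]` is a mid-edge. -/
  a_edge : |(vertex 0).1 - (vertex (r + s + 1)).1| = 1
  simple : ∀ i < r + s + 2, ∀ j < r + s + 2, i ≠ j →
    Disjoint
      (segment ℝ (medialPos δ (vertex i)) (medialPos δ (vertex (i + 1)))
        \ {medialPos δ (vertex (i + 1))})
      (segment ℝ (medialPos δ (vertex j)) (medialPos δ (vertex (j + 1)))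
        \ {medialPos δ (vertex (j + 1))})
  isOpen : IsOpen carrier
  isConnected : IsConnected carrier
  isBounded : Bornology.IsBounded carrier
  frontier_eq : frontier carrier =
    ⋃ i ∈ Set.Iio (r + s + 2),
      segment ℝ (medialPos δ (vertex i)) (medialPos δ (vertex (i + 1)))
  left : ∀ i < r + s + 2,
    ∀ z ∈ openSegment ℝ (medialPos δ (vertex i)) (medialPos δ (vertex (i + 1))),
      ∀ᶠ t : ℝ in nhdsWithin 0 (Set.Ioi 0),
        z + t * (Complex.I * (medialPos δ (vertex (i + 1)) - medialPos δ (vertex i))) ∈ carrier ∧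
        z - t * (Complex.I * (medialPos δ (vertex (i + 1)) - medialPos δ (vertex i))) ∉ carrier

namespace DobrushinDomain

variable {δ : ℝ} (D : DobrushinDomain δ)

/-- The `i`-th boundary segment. -/
def boundarySegment (i : ℕ) : Set ℂ :=
  segment ℝ (medialPos δ (D.vertex i)) (medialPos δ (D.vertex (i + 1)))

/-- The primal boundary arc, from `a^b` to `b^b`. -/
def primalArc : Set ℂ := ⋃ i ∈ Set.Iio D.r, D.boundarySegment i

/-- The dual boundary arc, from `b^w` to `a^w`. -/
def dualArc : Set ℂ := ⋃ i ∈ Set.Ioo D.r (D.r + D.s + 1), D.boundarySegment i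

/-- `b^b`, in medial coordinates. -/
def bBlack : ℤ × ℝ := D.vertex D.r

/-- `b^w`, in medial coordinates. -/
def bWhite : ℤ × ℝ := D.vertex (D.r + 1)

/-- The middle of the boundary mid-edge `[a^w a^b]`, where the interface starts (in mid-edge
coordinates). -/
def aMid : ℤ × ℝ := (min (D.vertex 0).1 (D.vertex (D.r + D.s + 1)).1, (D.vertex 0).2)

/-- The middle of the boundary mid-edge `[b^b b^w]`, where the interface ends (in mid-edge
coordinates). -/
def bMid : ℤ × ℝ := (min D.bBlack.1 D.bWhite.1, D.bBlack.2)

/-- The mid-edge domain: the points of the mid-edge lattice inside the domain, together with the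
two marked boundary mid-edges. -/
def midEdges : Set (ℤ × ℝ) := {e | midEdgePos δ e ∈ D.carrier} ∪ {D.aMid, D.bMid}

/-! ### Loop representation

Points of the configuration `C : Set (ℤ × ℝ)` are points of the medial lattice: death points on
primal lines, bridges on dual lines.  Each of them interrupts its vertical line.  The two mid-edge
strands on the two sides of that line are interrupted too, and reconnected to each other below the
point and above it.  A horizontal primal boundary segment connects all its primal points, so that
it acts as a bridge on each dual line ending on it; a horizontal dual boundary segment acts as a
death point on each primal line ending on it.

Curves are oriented so as to have primal lines to their right and dual lines to their left: they go
downwards in the mid-edge columns `j` with `j` even (primal line to the west), and upwards in those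
with `j` odd. -/

/-- The points where the boundary acts as a bridge or as a death point. -/
def boundaryCuts : Set (ℤ × ℝ) :=
  {p | (Odd p.1 ∧ medialPos δ p ∈ D.primalArc) ∨ (Even p.1 ∧ medialPos δ p ∈ D.dualArc)}

/-- All the points where a vertical line is interrupted. -/
def cuts (C : Set (ℤ × ℝ)) : Set (ℤ × ℝ) := C ∪ D.boundaryCuts

/-- The piece of the mid-edge column `j` between the heights `y` and `y'` (both excluded) stays in
the domain and meets no interruption of either of the two neighbouring vertical lines. -/
def Free (C : Set (ℤ × ℝ)) (j : ℤ) (y y' : ℝ) : Prop :=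
  ∀ t ∈ Set.Ioo (min y y') (max y y'),
    midEdgePos δ (j, t) ∈ D.carrier ∧ (j, t) ∉ D.cuts C ∧ (j + 1, t) ∉ D.cuts C

end DobrushinDomain

/-- In column `j`, the height `y'` comes strictly after `y` in the direction of travel. -/
def Forward (j : ℤ) (y y' : ℝ) : Prop := if Even j then y' < y else y < y'

/-- The variation of the argument of the tangent, in units of `π`, when a curve travelling in column
`j` makes a half-turn towards the column to its east: a left turn if the curve is going downwards, a
right turn if it is going upwards.  A half-turn towards the west gives the opposite value. -/
def eastTurn (j : ℤ) : ℤ := if Even j then 1 else -1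

namespace DobrushinDomain

variable {δ : ℝ} (D : DobrushinDomain δ)

/-- `D.Path C e e' w`: following from `e` the oriented curve of the loop representation of the
configuration `C`, one arrives at `e'` after a total rotation (winding) equal to `w π`,
counted positively counterclockwise. -/
inductive Path (C : Set (ℤ × ℝ)) : ℤ × ℝ → ℤ × ℝ → ℤ → Prop
  | straight {j : ℤ} {y y' : ℝ} :
      (y' = y ∨ Forward j y y') → D.Free C j y y' → Path C (j, y) (j, y') 0
  | east {j : ℤ} {y h : ℝ} {e' : ℤ × ℝ} {w : ℤ} :
      Forward j y h → D.Free C j y h → (j + 1, h) ∈ D.cuts C →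
      Path C (j + 1, h) e' w → Path C (j, y) e' (eastTurn j + w)
  | west {j : ℤ} {y h : ℝ} {e' : ℤ × ℝ} {w : ℤ} :
      Forward j y h → D.Free C j y h → (j, h) ∈ D.cuts C →
      Path C (j - 1, h) e' w → Path C (j, y) e' (-eastTurn j + w)

/-- The points of the mid-edge lattice inside the domain, off the heights at which the two
neighbouring vertical lines are interrupted. -/
def regular (C : Set (ℤ × ℝ)) : Set (ℤ × ℝ) :=
  {e | midEdgePos δ e ∈ D.carrier ∧ (e.1, e.2) ∉ D.cuts C ∧ (e.1 + 1, e.2) ∉ D.cuts C}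

/-- One can go from `e` to `e'` along the oriented curves of the configuration. -/
def Reach (C : Set (ℤ × ℝ)) (e e' : ℤ × ℝ) : Prop := ∃ w, D.Path C e e' w

/-- The loops of a configuration, each given by the set of its regular points. -/
def loops (C : Set (ℤ × ℝ)) : Set (Set (ℤ × ℝ)) :=
  {L | ∃ e ∈ D.regular C, ∃ e' ∈ D.regular C, e ≠ e' ∧ D.Reach C e e' ∧ D.Reach C e' e ∧
    L = {x ∈ D.regular C | D.Reach C e x ∧ D.Reach C x e}}

/-- The number of loops. -/
def numLoops (C : Set (ℤ × ℝ)) : ℕ := (D.loops C).ncard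

/-- The mid-edge points of the interface, which goes from `a` to `b`. -/
def interface (C : Set (ℤ × ℝ)) : Set (ℤ × ℝ) :=
  {e ∈ D.midEdges | D.Reach C D.aMid e ∧ D.Reach C e D.bMid}

open Classical in
/-- The winding `W(e, b)` of the interface from `e` to `b`. -/
def winding (C : Set (ℤ × ℝ)) (e : ℤ × ℝ) : ℝ :=
  if h : ∃ w, D.Path C e D.bMid w then Real.pi * (h.choose : ℝ) else 0

open Classical in
/-- The random variable `exp (i W(e, b) / 2) 1_{e ∈ γ}`. -/
def spin (C : Set (ℤ × ℝ)) (e : ℤ × ℝ) : ℂ :=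
  if e ∈ D.interface C then Complex.exp (Complex.I / 2 * (D.winding C e : ℂ)) else 0

end DobrushinDomain

/-! ### The probability measures -/

/-- Finite families of points. -/
abbrev Points (X : Type*) := Σ n : ℕ, Fin n → X

/-- The law of a Poisson point process with finite intensity measure `Λ`: with probability
`exp (-Λ(X)) Λ(X)^n / n!` there are `n` points, and these are then independent with law
`Λ / Λ(X)`. -/
def poissonLaw {X : Type*} [MeasurableSpace X] (Λ : Measure X) : Measure (Points X) :=
  Measure.sum fun n : ℕ =>
    (ENNReal.ofReal (Real.exp (-(Λ Set.univ).toReal) / (n.factorial : ℝ))) •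
      (Measure.pi fun _ : Fin n => Λ).map (Sigma.mk n)

/-- One-dimensional Lebesgue measure on the vertical lines of the medial lattice. -/
def lineMeasure : Measure (ℤ × ℝ) := Measure.count.prod volume

/-- A configuration: the death points and the bridges. -/
abbrev Config := Points (ℤ × ℝ) × Points (ℤ × ℝ)

/-- The set of all death points and bridges of a configuration. -/
def Config.points (ω : Config) : Set (ℤ × ℝ) := Set.range ω.1.2 ∪ Set.range ω.2.2

namespace DobrushinDomain

variable {δ : ℝ} (D : DobrushinDomain δ)

/-- The primal intervals of the domain. -/
def primalIntervals : Set (ℤ × ℝ) := {p | Even p.1 ∧ medialPos δ p ∈ D.carrier}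

/-- The dual intervals of the domain. -/
def dualIntervals : Set (ℤ × ℝ) := {p | Odd p.1 ∧ medialPos δ p ∈ D.carrier}

/-- The continuum Bernoulli percolation with parameters `lam` and `mu`: independent Poisson point
processes of death points, with intensity `lam` on the primal intervals, and of bridges, with
intensity `mu` on the dual intervals. -/
def percolationLaw (lam mu : ℝ) : Measure Config :=
  (poissonLaw (ENNReal.ofReal lam • lineMeasure.restrict D.primalIntervals)).prod
    (poissonLaw (ENNReal.ofReal mu • lineMeasure.restrict D.dualIntervals))

/-- The percolation measure with both parameters equal to `ρ`, weighted by `√2 ^ (number of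
loops)`. -/
def weightedLaw (ρ : ℝ) : Measure Config :=
  (D.percolationLaw ρ ρ).withDensity fun ω => ENNReal.ofReal (√2 ^ D.numLoops ω.points)

/-- The loop representation of the critical quantum Ising model with parameter `ρ`: the probability
measure proportional to `√2 ^ (number of loops)` times the percolation measure with both parameters
equal to `ρ`. -/
def quantumIsing (ρ : ℝ) : Measure Config :=
  (D.weightedLaw ρ Set.univ)⁻¹ • D.weightedLaw ρ

/-! ### The observables -/

end DobrushinDomain

/-- The constant `ν = exp (-i π / 4)`. -/
def nu : ℂ := Complex.exp (-(Complex.I * Real.pi / 4))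

namespace DobrushinDomain

variable {δ : ℝ} (D : DobrushinDomain δ)

open Classical in
/-- The parafermionic observable
`F(e) = (ν / √δ) E[exp (i W(e, b) / 2) 1_{e ∈ γ}]` on the mid-edge domain, extended by `0`. -/
def observable (ρ : ℝ) (e : ℤ × ℝ) : ℂ :=
  if e ∈ D.midEdges then
    nu / (√δ : ℝ) * ∫ ω, D.spin ω.points e ∂(D.quantumIsing ρ)
  else 0

/-- The medial observable: the sum of the values of the observable at the two neighbouring
mid-edges, an undefined term being `0`. -/
def medialObservable (ρ : ℝ) (p : ℤ × ℝ) : ℂ :=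
  D.observable ρ (p.1 - 1, p.2) + D.observable ρ (p.1, p.2)

end DobrushinDomain

/-! ### S-holomorphicity -/

/-- The anti-derivative `∂̄`, on the medial or on the mid-edge lattice. -/
def dbar (δ : ℝ) (f : ℤ × ℝ → ℂ) (p : ℤ × ℝ) : ℂ :=
  1 / 2 * ((f (p.1 + 1, p.2) - f (p.1 - 1, p.2)) / δ
    - deriv (fun t : ℝ => f (p.1, t)) p.2 / Complex.I)

/-- `f` is vertically differentiable at `p` and its anti-derivative vanishes there. -/
def HolomorphicAt (δ : ℝ) (f : ℤ × ℝ → ℂ) (p : ℤ × ℝ) : Prop :=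
  DifferentiableAt ℝ (fun t : ℝ => f (p.1, t)) p.2 ∧ dbar δ f p = 0

/-- The direction `τ(e) = [i (w_e - u_e)]^{-1/2}` of a mid-edge. -/
def tau (δ : ℝ) (e : ℤ × ℝ) : ℂ :=
  (Complex.I * (dualEnd δ e - primalEnd δ e)) ^ (-(1 / 2) : ℂ)

/-- The projection of `X` in the direction `t`. -/
def proj (X t : ℂ) : ℂ := 1 / 2 * (X + t / starRingEnd ℂ t * starRingEnd ℂ X)

namespace DobrushinDomain

variable {δ : ℝ} (D : DobrushinDomain δ)

/-- S-holomorphicity of a function on the mid-edge domain, extended by `0` to the whole mid-edge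
lattice.  Holomorphicity is asked at the points `e` of the domain none of whose neighbours
`e ± δ/2` is on the boundary curve (a neighbour outside the domain is allowed, `e` being then next
to a vertical part of the boundary). -/
def IsSHolomorphic (f : ℤ × ℝ → ℂ) : Prop :=
  (∀ e ∈ D.midEdges, ∃ c : ℝ, f e = c * tau δ e) ∧
  ∀ e : ℤ × ℝ, midEdgePos δ e ∈ D.carrier →
    midEdgePos δ (e.1 + 1, e.2) ∉ frontier D.carrier →
    midEdgePos δ (e.1 - 1, e.2) ∉ frontier D.carrier → HolomorphicAt δ f e

/-- S-holomorphicity of a function on the medial domain.  Holomorphicity is asked at the medial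
points `p` of the domain such that neither of the mid-edges `p ± 3δ/4`, on the outer sides of the
neighbours `p ± δ/2`, is on the boundary curve.  The neighbours are then in the domain or on
a vertical part of its boundary. -/
def IsMedialSHolomorphic (g : ℤ × ℝ → ℂ) : Prop :=
  (∀ e ∈ D.midEdges, proj (g (e.1, e.2)) (tau δ e) = proj (g (e.1 + 1, e.2)) (tau δ e)) ∧
  ∀ p : ℤ × ℝ, medialPos δ p ∈ D.carrier →
    midEdgePos δ (p.1 + 1, p.2) ∉ frontier D.carrier →
    midEdgePos δ (p.1 - 2, p.2) ∉ frontier D.carrier → HolomorphicAt δ g p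

end DobrushinDomain

end QuantumIsing

end

/-! Let `mean e` be the unnormalised observable: the Poisson expectation of √2^(number of loops)
times the spin exp(iW/2) 1_{e ∈ γ}. Everything rests on one local identity. Adding a point p on the
line between two columns cuts the two strands that pass on its sides, in opposite directions, and
reconnects them: the successor permutation of the strands has two of its images exchanged. In the
new configuration, the weighted spin in one column jumps across the height of p by ±i√2 times the
weighted spin of the old configuration, at that height, in the other column (`SwapAt.jump`,
`DobrushinDomain.jump`). This is checked on the ways in which the strands can be connected to each
other and to the end of the interface: either two cycles merge or one splits, which changes the
weight by √2. A closed loop contributes exp(iW/2) = -1, because a simple closed curve turns by 2π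
modulo 4π; this is Hopf's Umlaufsatz (`IsPolygon.sum_turnCross`, `Layers.negativeCycles`).

Along a vertical segment of the domain the spin is piecewise constant, so its variation is the sum
of its jumps, each expressed with the configuration deprived of one point. The Mecke formula
(`integral_removeSum`) turns the expectation of such a sum into an integral over the position of the
removed point, with density ρ. Hence `mean e` has vertical derivative i√2ρ (`mean e⁺` - `mean e⁻`)
(`mean_sub_eq`, `hasDerivAt_mean`), and for ρ = 1/(√2δ) this is ∂̄F = 0. Where a neighbouring column
is outside the domain the formula persists, the observable being 0 there.

The direction of F(e) comes from parity: every half-turn changes the column by one, so the winding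
in units of π has the parity of the column difference with b. Horizontally neighbouring mid-edges
have orthogonal directions, which gives the projection relation for F◇; its holomorphicity is the
sum of the relations at two mid-edges.

To read curves as permutations, a configuration without coincident heights is moved by an order
isomorphism of ℝ to half-integer heights, where it is a finite diagram (`Layers`). The end of the
interface is joined to its start, and the loops are all the cycles but one
(`System.Discrete.numCycles_eq`). Invariance under changes of heights also gives measurability,
since only countably many order patterns exist; integrability holds because a point adds at most one
loop (`numLoops_le`). -/

noncomputable section
namespace QuantumIsing

/-! ### Permutations composed with a transposition -/

section Permutation

open Equiv Equiv.Perm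

variable {α : Type*}

/-- The number of cycles of a permutation, fixed points included. -/
def numCycles (σ : Perm α) : ℕ := Nat.card (Quotient (SameCycle.setoid σ))

lemma sameCycle_iterate (σ : Perm α) (u : α) (k : ℕ) : SameCycle σ u (σ^[k] u) := by
  rw [iterate_eq_pow]; exact ⟨k, by simp⟩

lemma SameCycle.exists_iterate [Finite α] {σ : Perm α} {u v : α} (h : SameCycle σ u v) :
    ∃ k : ℕ, σ^[k] u = v := by
  obtain ⟨k, hk⟩ := h.exists_nat_pow_eq
  exact ⟨k, by rw [iterate_eq_pow]; exact hk⟩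

lemma exists_first (σ : α → α) (P : α → Prop) {u : α} (h : ∃ k : ℕ, P (σ^[k] u)) :
    ∃ k : ℕ, P (σ^[k] u) ∧ ∀ i < k, ¬P (σ^[i] u) := by
  classical
  exact ⟨Nat.find h, Nat.find_spec h, fun i hi => Nat.find_min h hi⟩

/-- Used for exchanged images: an arc of orbit that avoids the two modified points is common to both
permutations. -/
lemma iterate_eq_of_agree {σ σ' : α → α} {u : α} {k : ℕ}
    (h : ∀ i < k, σ' (σ^[i] u) = σ (σ^[i] u)) : ∀ i ≤ k, σ'^[i] u = σ^[i] u := by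
  intro i
  induction i with
  | zero => intro _; rfl
  | succ i ih =>
    intro hi
    rw [Function.iterate_succ_apply', Function.iterate_succ_apply', ih (by omega), h i (by omega)]

/-- `σ'` is obtained from `σ` by exchanging the images of `x` and `y`. -/
structure SwapAt (σ σ' : Perm α) (x y : α) : Prop where
  ne : x ≠ y
  left : σ' x = σ y
  right : σ' y = σ x
  other : ∀ z, z ≠ x → z ≠ y → σ' z = σ z

namespace SwapAt

variable {σ σ' : Perm α} {x y : α}

lemma symm (h : SwapAt σ σ' x y) : SwapAt σ' σ x y :=
  ⟨h.ne, h.right.symm, h.left.symm, fun z hx hy => (h.other z hx hy).symm⟩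

variable [Finite α]

/-- The `σ`-orbit of `σ y` comes back to `y` without meeting `x`, which is in another cycle; `σ'`
enters this arc from `x` and follows it up to `y`. -/
lemma sameCycle_of_not (h : SwapAt σ σ' x y) (hxy : ¬SameCycle σ x y) : SameCycle σ' x y := by
  obtain ⟨k, hk, hk'⟩ := exists_first σ (· = y) (u := σ y)
    (SameCycle.exists_iterate (sameCycle_apply_left.2 (SameCycle.refl σ y)))
  have h1 := iterate_eq_of_agree (σ := σ) (σ' := σ') (u := σ y) (k := k) (fun i hi =>
    h.other _ (fun he => hxy (by
      have := sameCycle_iterate σ (σ y) i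
      rw [he] at this
      exact (sameCycle_apply_left.1 this).symm)) (hk' i hi)) k le_rfl
  have h2 : SameCycle σ' (σ y) y := by
    have := sameCycle_iterate σ' (σ y) k
    rwa [h1, hk] at this
  rw [← h.left] at h2
  exact sameCycle_apply_left.1 h2

/-- Only the steps out of `x` and `y` differ, and these two points now share a cycle, so every
`σ`-step stays inside a `σ'`-cycle. -/
lemma sameCycle_le (h : SwapAt σ σ' x y) (hxy : ¬SameCycle σ x y) {u v : α}
    (huv : SameCycle σ u v) : SameCycle σ' u v := by
  have step : ∀ z, SameCycle σ' z (σ z) := by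
    intro z
    have hs := h.sameCycle_of_not hxy
    by_cases hzx : z = x
    · subst hzx; rw [← h.right]; exact sameCycle_apply_right.2 hs
    by_cases hzy : z = y
    · subst hzy; rw [← h.left]; exact sameCycle_apply_right.2 hs.symm
    · rw [← h.other z hzx hzy]; exact sameCycle_apply_right.2 (SameCycle.refl _ _)
  obtain ⟨k, rfl⟩ := SameCycle.exists_iterate huv
  clear huv
  induction k with
  | zero => exact SameCycle.refl _ _
  | succ k ih => rw [Function.iterate_succ_apply']; exact ih.trans (step _)

/-- A `σ'`-orbit leaves a `σ`-cycle only through `x` or `y`, and then lands in the cycle of the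
other one. -/
lemma sameCycle_cases (h : SwapAt σ σ' x y) {u v : α} (huv : SameCycle σ' u v) :
    SameCycle σ u v ∨ ((SameCycle σ x u ∨ SameCycle σ y u) ∧ (SameCycle σ x v ∨ SameCycle σ y v)) := by
  obtain ⟨k, rfl⟩ := SameCycle.exists_iterate huv
  clear huv
  induction k with
  | zero => exact Or.inl (SameCycle.refl _ _)
  | succ k ih =>
    rw [Function.iterate_succ_apply']
    set w := σ'^[k] u
    by_cases hwx : w = x
    · rw [hwx, h.left, sameCycle_apply_right (f := σ) (x := y), sameCycle_apply_right (f := σ) (x := x)]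
      right
      refine ⟨?_, Or.inr (SameCycle.refl _ _)⟩
      rcases ih with ih | ih
      · rw [hwx] at ih; exact Or.inl ih.symm
      · exact ih.1
    by_cases hwy : w = y
    · rw [hwy, h.right, sameCycle_apply_right (f := σ) (x := y), sameCycle_apply_right (f := σ) (x := x)]
      right
      refine ⟨?_, Or.inl (SameCycle.refl _ _)⟩
      rcases ih with ih | ih
      · rw [hwy] at ih; exact Or.inr ih.symm
      · exact ih.1
    rw [h.other w hwx hwy, sameCycle_apply_right, sameCycle_apply_right, sameCycle_apply_right]
    exact ih

/-- Exchanging the images of two points in different cycles merges these cycles. -/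
lemma numCycles_of_not (h : SwapAt σ σ' x y) (hxy : ¬SameCycle σ x y) :
    numCycles σ = numCycles σ' + 1 := by
  classical
  let a : Quotient (SameCycle.setoid σ) := Quotient.mk _ y
  let φ : Quotient (SameCycle.setoid σ) → Quotient (SameCycle.setoid σ') :=
    Quotient.map' id fun u v huv => h.sameCycle_le hxy huv
  -- Only the cycles of `x` and `y` are identified; discarding the second one makes the quotient map
  -- bijective.
  have hb : Function.Bijective fun q : {q // q ≠ a} => φ q.1 := by
    constructor
    · rintro ⟨⟨u⟩, hu⟩ ⟨⟨v⟩, hv⟩ huv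
      have hu' : ¬SameCycle σ u y := fun hh => hu (Quotient.sound hh)
      have hv' : ¬SameCycle σ v y := fun hh => hv (Quotient.sound hh)
      have huv' : SameCycle σ' u v := Quotient.exact huv
      refine Subtype.ext (Quotient.sound (?_ : SameCycle σ u v))
      rcases h.sameCycle_cases huv' with h1 | ⟨h1 | h1, h2 | h2⟩
      · exact h1
      · exact h1.symm.trans h2
      · exact (hv' h2.symm).elim
      · exact (hu' h1.symm).elim
      · exact (hu' h1.symm).elim
    · rintro ⟨u⟩
      by_cases hu : SameCycle σ u y
      · refine ⟨⟨Quotient.mk _ x, fun hh => hxy (Quotient.exact hh)⟩, Quotient.sound ?_⟩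
        exact (h.sameCycle_of_not hxy).trans (h.sameCycle_le hxy hu.symm)
      · exact ⟨⟨Quotient.mk _ u, fun hh => hu (Quotient.exact hh)⟩, rfl⟩
  rw [numCycles, numCycles, ← Nat.card_congr (Equiv.optionSubtypeNe a), Finite.card_option,
    Nat.card_congr (Equiv.ofBijective _ hb)]

/-- The `σ`-orbit of `σ y` meets `x` before `y`, otherwise it would close up without `x`. Since `σ'
x = σ y`, the map `σ'` closes this arc at `x`, and the arc does not contain `y`. -/
lemma not_sameCycle (h : SwapAt σ σ' x y) (hxy : SameCycle σ x y) : ¬SameCycle σ' x y := by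
  obtain ⟨k, hk, hk'⟩ := exists_first σ (fun z => z = x ∨ z = y) (u := σ y)
    ((SameCycle.exists_iterate (sameCycle_apply_left.2 (SameCycle.refl σ y))).imp
      fun _ h => Or.inr h)
  have hkx : σ^[k] (σ y) = x := by
    rcases hk with hk | hk
    · exact hk
    · exfalso
      obtain ⟨m, hm⟩ := SameCycle.exists_iterate (sameCycle_apply_left.2 hxy.symm : SameCycle σ (σ y) x)
      have hper : Function.IsPeriodicPt σ (k + 1) (σ y) := by
        change σ^[k + 1] (σ y) = σ y
        rw [Function.iterate_succ_apply', hk]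
      have h1 := hper.iterate_mod_apply m
      have h2 : m % (k + 1) < k + 1 := Nat.mod_lt _ (by omega)
      rw [hm] at h1
      rcases Nat.lt_succ_iff_lt_or_eq.1 h2 with h3 | h3
      · exact hk' _ h3 (Or.inl h1)
      · rw [h3, hk] at h1; exact h.ne h1.symm
  intro hs
  obtain ⟨m, hm⟩ := SameCycle.exists_iterate hs
  have key : ∀ m, ∃ i ≤ k, σ'^[m] x = σ^[i] (σ y) := by
    intro m
    induction m with
    | zero => exact ⟨k, le_rfl, hkx.symm⟩
    | succ m ih =>
      obtain ⟨i, hi, he⟩ := ih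
      rw [Function.iterate_succ_apply', he]
      rcases hi.eq_or_lt with rfl | hi
      · exact ⟨0, by omega, by rw [hkx, h.left]; rfl⟩
      · refine ⟨i + 1, by omega, ?_⟩
        rw [Function.iterate_succ_apply']
        have := hk' i hi
        push Not at this
        exact h.other _ this.1 this.2
  obtain ⟨i, hi, he⟩ := key m
  rw [hm] at he
  rcases hi.eq_or_lt with rfl | hi
  · rw [hkx] at he; exact h.ne he.symm
  · exact hk' i hi (Or.inr he.symm)

/-- Exchanging the images of two points of a cycle splits this cycle. -/
lemma numCycles_of_sameCycle (h : SwapAt σ σ' x y) (hxy : SameCycle σ x y) :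
    numCycles σ' = numCycles σ + 1 :=
  h.symm.numCycles_of_not (h.not_sameCycle hxy)

end SwapAt

/-- The cycles of `σ` that avoid `b` have total weight `-1`. -/
def NegativeCycles (σ : Perm α) (θ : α → ℂ) (b : α) : Prop :=
  ∀ (u : α) (k : ℕ), σ^[k + 1] u = u → (∀ i, 0 < i → i ≤ k → σ^[i] u ≠ u) →
    (∀ i ≤ k, σ^[i] u ≠ b) → ∏ i ∈ Finset.range (k + 1), θ (σ^[i] u) = -1

/-- `f` is transported along the cycles of `σ` with weights `θ`, and is normalized at `b`. -/
structure Transported (σ : Perm α) (θ : α → ℂ) (b : α) (f : α → ℂ) : Prop where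
  base : f b = 1
  step : ∀ z, z ≠ b → f z = θ z * f (σ z)

lemma Transported.iterate {σ : Perm α} {θ : α → ℂ} {b : α} {f : α → ℂ} (h : Transported σ θ b f)
    (u : α) (k : ℕ) (hk : ∀ i < k, σ^[i] u ≠ b) :
    f u = (∏ i ∈ Finset.range k, θ (σ^[i] u)) * f (σ^[k] u) := by
  induction k with
  | zero => simp
  | succ k ih =>
    rw [ih fun i hi => hk i (by omega), h.step _ (hk k (by omega)), Finset.prod_range_succ,
      Function.iterate_succ_apply', mul_assoc]

/-- The variation of a transported function when the images of two points are exchanged. -/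
theorem SwapAt.jump [Finite α] {σ σ' : Perm α} {x y b : α} (h : SwapAt σ σ' x y)
    {θ θ' f f' : α → ℂ} {ι : ℂ} (hι : ι ^ 2 = -1) (hxb : x ≠ b) (hyb : y ≠ b)
    (hf : Transported σ θ b f) (hf' : Transported σ' θ' b f')
    (hθ : ∀ z, z ≠ x → z ≠ y → θ' z = θ z) (hθx : θ x = 1) (hθy : θ y = 1)
    (hθx' : θ' x = ι) (hθy' : θ' y = ι)
    (hn : NegativeCycles σ θ b) (hn' : NegativeCycles σ' θ' b) :
    ((√2 : ℝ) : ℂ) ^ numCycles σ' * (f' x - f' (σ x)) =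
      √2 * ι * ((√2 : ℝ) : ℂ) ^ numCycles σ * f y := by
  have hsq : ((√2 : ℝ) : ℂ) * ((√2 : ℝ) : ℂ) = 2 := by
    rw [← Complex.ofReal_mul, Real.mul_self_sqrt (by norm_num)]; norm_num
  -- The arcs starting at `σ x` and `σ y` are followed up to their first point in `{x, y, b}`. Their
  -- interiors, hence their weights `A` and `B`, are the same for `σ` and `σ'`.
  let T : α → Prop := fun z => z = x ∨ z = y ∨ z = b
  have ret : ∀ z, T z → ∃ k : ℕ, T (σ^[k] (σ z)) ∧ ∀ i < k, ¬T (σ^[i] (σ z)) := fun z hz =>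
    exists_first σ T ((SameCycle.exists_iterate (sameCycle_apply_left.2 (SameCycle.refl σ z))).imp
      fun _ h => by rw [h]; exact hz)
  obtain ⟨k, hk, hk'⟩ := ret x (Or.inl rfl)
  obtain ⟨l, hl, hl'⟩ := ret y (Or.inr (Or.inl rfl))
  simp only [T, not_or] at hk hk' hl hl'
  set A := ∏ i ∈ Finset.range k, θ (σ^[i] (σ x)) with hA
  set B := ∏ i ∈ Finset.range l, θ (σ^[i] (σ y)) with hB
  have agree : ∀ (u : α) (k : ℕ), (∀ i < k, σ^[i] u ≠ x ∧ σ^[i] u ≠ y ∧ σ^[i] u ≠ b) →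
      (∀ i ≤ k, σ'^[i] u = σ^[i] u) ∧
      ∏ i ∈ Finset.range k, θ' (σ'^[i] u) = ∏ i ∈ Finset.range k, θ (σ^[i] u) := by
    intro u k hk
    have := iterate_eq_of_agree (σ := σ) (σ' := σ') (u := u) (k := k)
      fun i hi => h.other _ (hk i hi).1 (hk i hi).2.1
    refine ⟨this, Finset.prod_congr rfl fun i hi => ?_⟩
    have hi := Finset.mem_range.1 hi
    rw [this i hi.le, hθ _ (hk i hi).1 (hk i hi).2.1]
  obtain ⟨agx, agx'⟩ := agree _ _ hk'
  obtain ⟨agy, agy'⟩ := agree _ _ hl'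
  have fp : f (σ x) = A * f (σ^[k] (σ x)) := hf.iterate _ _ fun i hi => (hk' i hi).2.2
  have fq : f (σ y) = B * f (σ^[l] (σ y)) := hf.iterate _ _ fun i hi => (hl' i hi).2.2
  have fp' : f' (σ x) = A * f' (σ^[k] (σ x)) := by
    have := hf'.iterate (σ x) k fun i hi => by rw [agx i hi.le]; exact (hk' i hi).2.2
    rwa [agx k le_rfl, agx'] at this
  have fq' : f' (σ y) = B * f' (σ^[l] (σ y)) := by
    have := hf'.iterate (σ y) l fun i hi => by rw [agy i hi.le]; exact (hl' i hi).2.2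
    rwa [agy l le_rfl, agy'] at this
  have fx : f x = f (σ x) := by rw [hf.step x hxb, hθx, one_mul]
  have fy : f y = f (σ y) := by rw [hf.step y hyb, hθy, one_mul]
  have fx' : f' x = ι * f' (σ y) := by rw [hf'.step x hxb, hθx', h.left]
  have fy' : f' y = ι * f' (σ x) := by rw [hf'.step y hyb, hθy', h.right]
  -- An arc that the permutation closes up without meeting `b` is a full cycle, of weight -1. This
  -- determines `A` or `B` when the arc closes up for `σ` (`Ax`, `By`) or for `σ'` (`Ay`, `Bx`).
  have loop : ∀ (τ : Perm α) (η : α → ℂ), NegativeCycles τ η b → ∀ (u z : α) (k : ℕ),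
      τ^[k] u = z → τ z = u → z ≠ b → (∀ i < k, τ^[i] u ≠ z ∧ τ^[i] u ≠ b) →
      (∏ i ∈ Finset.range k, η (τ^[i] u)) * η z = -1 := by
    intro τ η hτ u z k h1 h2 h3 h4
    have := hτ u k (by rw [Function.iterate_succ_apply', h1, h2]) (fun i hi hik he => ?_)
      (fun i hi => ?_)
    · rwa [Finset.prod_range_succ, h1] at this
    · obtain ⟨i, rfl⟩ := Nat.exists_eq_succ_of_ne_zero hi.ne'
      rw [Nat.succ_eq_add_one, Function.iterate_succ_apply'] at he
      exact (h4 i (by omega)).1 (τ.injective (he.trans h2.symm))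
    · rcases hi.eq_or_lt with rfl | hi
      · rw [h1]; exact h3
      · exact (h4 i hi).2
  have Ax : σ^[k] (σ x) = x → A = -1 := fun he => by
    have := loop σ θ hn (σ x) x k he rfl hxb fun i hi => ⟨(hk' i hi).1, (hk' i hi).2.2⟩
    rwa [hθx, mul_one] at this
  have By : σ^[l] (σ y) = y → B = -1 := fun he => by
    have := loop σ θ hn (σ y) y l he rfl hyb fun i hi => ⟨(hl' i hi).2.1, (hl' i hi).2.2⟩
    rwa [hθy, mul_one] at this
  have Ay : σ^[k] (σ x) = y → A * ι = -1 := fun he => by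
    have := loop σ' θ' hn' (σ x) y k (by rw [agx k le_rfl, he]) h.right hyb fun i hi => by
      rw [agx i hi.le]; exact ⟨(hk' i hi).2.1, (hk' i hi).2.2⟩
    rwa [hθy', agx'] at this
  have Bx : σ^[l] (σ y) = x → B * ι = -1 := fun he => by
    have := loop σ' θ' hn' (σ y) x l (by rw [agy l le_rfl, he]) h.left hxb fun i hi => by
      rw [agy i hi.le]; exact ⟨(hl' i hi).1, (hl' i hi).2.2⟩
    rwa [hθx', agy'] at this
  have scx : SameCycle σ x (σ^[k] (σ x)) :=
    (sameCycle_apply_right.2 (SameCycle.refl σ x)).trans (sameCycle_iterate _ _ _)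
  have scy : SameCycle σ y (σ^[l] (σ y)) :=
    (sameCycle_apply_right.2 (SameCycle.refl σ y)).trans (sameCycle_iterate _ _ _)
  -- Two arcs with the same end would be nested, by injectivity; the longer one would pass through
  -- the point preceding the shorter one, which is `x` or `y`.
  have distinct : σ^[k] (σ x) ≠ σ^[l] (σ y) := by
    intro he
    rcases le_total k l with hkl | hkl
    · obtain ⟨d, rfl⟩ := Nat.exists_eq_add_of_le hkl
      rw [Function.iterate_add_apply] at he
      have h1 := (σ.injective.iterate k) he
      rcases d with _ | d
      · exact h.ne (σ.injective h1)
      · rw [Function.iterate_succ_apply'] at h1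
        exact (hl' d (by omega)).1 (σ.injective h1).symm
    · obtain ⟨d, rfl⟩ := Nat.exists_eq_add_of_le hkl
      rw [Function.iterate_add_apply] at he
      have h1 := (σ.injective.iterate l) he
      rcases d with _ | d
      · exact h.ne (σ.injective h1)
      · rw [Function.iterate_succ_apply'] at h1
        exact (hk' d (by omega)).2.1 (σ.injective h1)
  -- A merger removes a cycle and a split creates one. Since √2 · √2 = 2, the jump of `f'` has to be
  -- `2 * ι * f y` in the first case and `ι * f y` in the second.
  have merge : ¬SameCycle σ x y → f' x - f' (σ x) = 2 * ι * f y →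
      ((√2 : ℝ) : ℂ) ^ numCycles σ' * (f' x - f' (σ x)) =
      √2 * ι * ((√2 : ℝ) : ℂ) ^ numCycles σ * f y := fun hs he => by
    rw [he, h.numCycles_of_not hs, pow_succ]
    linear_combination (-(((√2 : ℝ) : ℂ) ^ numCycles σ' * ι * f y)) * hsq
  have split : SameCycle σ x y → f' x - f' (σ x) = ι * f y →
      ((√2 : ℝ) : ℂ) ^ numCycles σ' * (f' x - f' (σ x)) =
      √2 * ι * ((√2 : ℝ) : ℂ) ^ numCycles σ * f y := fun hs he => by
    rw [he, h.numCycles_of_sameCycle hs, pow_succ]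
    ring
  -- A value transported around a cycle of weight -1 equals its opposite: `f` and `f'` vanish off
  -- the interface.
  have half : ∀ z : ℂ, z = -z → z = 0 := fun z hz => by linear_combination (1 / 2 : ℂ) * hz
  have nsc : ∀ (z : α) (m : ℕ), σ^[m] (σ z) = z → (∀ i < m, σ^[i] (σ z) ≠ z) → ∀ v, SameCycle σ z v →
      v ≠ z → ∃ i < m, σ^[i] (σ z) = v := by
    intro z m hm _ v hv hvz
    obtain ⟨r, hr⟩ := SameCycle.exists_iterate (sameCycle_apply_left.2 hv : SameCycle σ (σ z) v)
    have hper : Function.IsPeriodicPt σ (m + 1) (σ z) := by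
      change σ^[m + 1] (σ z) = σ z
      rw [Function.iterate_succ_apply', hm]
    have h1 := hper.iterate_mod_apply r
    rw [hr] at h1
    rcases Nat.lt_succ_iff_lt_or_eq.1 (Nat.mod_lt r (Nat.succ_pos m)) with h3 | h3
    · exact ⟨_, h3, h1⟩
    · rw [h3, hm] at h1; exact (hvz h1.symm).elim
  -- Six cases by the ends of the arcs from `σ x` and `σ y`. Ends (x, y): two loops merge; (y, x): a
  -- loop splits; (x, b) or (b, y): a loop merges with the interface; (y, b) or (b, x): the
  -- interface sheds a loop.
  rcases hk with hkx | hky | hkb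
  · have hns : ¬SameCycle σ x y := fun hs => by
      obtain ⟨i, hi, he⟩ := nsc x k hkx (fun i hi => (hk' i hi).1) y hs h.ne.symm
      exact (hk' i hi).2.1 he
    have hA1 := Ax hkx
    rw [hA1, hkx] at fp fp'
    refine merge hns ?_
    rcases hl with hlx | hly | hlb
    · exact (distinct (hkx.trans hlx.symm)).elim
    · have hB1 := By hly
      rw [hB1, hly] at fq fq'
      have e1 : f y = 0 := half _ (by rw [← neg_one_mul, ← fq, fy])
      have e2 : f' x = 0 := half _ (by
        rw [fp'] at fy'; rw [fy'] at fq'; rw [fq'] at fx'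
        linear_combination fx' + f' x * hι)
      rw [fp', e2, e1]; ring
    · rw [hlb, hf.base] at fq
      rw [hlb, hf'.base] at fq'
      rw [fp', fx', fy, fq, fq']; ring
  · have hs : SameCycle σ x y := by rw [hky] at scx; exact scx
    have hA1 := Ay hky
    rw [hky] at fp fp'
    have e0 : f' (σ x) = 0 := half _ (by
      rw [fy'] at fp'; linear_combination fp' + f' (σ x) * hA1)
    refine split hs ?_
    rcases hl with hlx | hly | hlb
    · have hB1 := Bx hlx
      rw [hlx] at fq fq'
      have hAB : A * B = -1 := by
        linear_combination (-B * ι) * hA1 + hB1 + A * B * hι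
      have e1 : f y = 0 := half _ (by
        rw [fx, fp] at fq; linear_combination fy + fq + f y * hAB)
      have e2 : f' (σ y) = 0 := half _ (by
        rw [fx'] at fq'; linear_combination fq' + f' (σ y) * hB1)
      rw [fx', e0, e1, e2]; ring
    · exact (distinct (hky.trans hly.symm)).elim
    · rw [hlb, hf.base] at fq
      rw [hlb, hf'.base] at fq'
      rw [fx', e0, fy, fq, fq']; ring
  · rw [hkb, hf.base] at fp
    rw [hkb, hf'.base] at fp'
    rcases hl with hlx | hly | hlb
    · have hB1 := Bx hlx
      rw [hlx] at fq fq' scy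
      refine split scy.symm ?_
      have e2 : f' (σ y) = 0 := half _ (by
        rw [fx'] at fq'; linear_combination fq' + f' (σ y) * hB1)
      rw [fx', e2, fp', fy, fq, fx, fp]
      linear_combination (-A) * hB1
    · have hns : ¬SameCycle σ x y := fun hs => by
        obtain ⟨i, hi, he⟩ := nsc y l hly (fun i hi => (hl' i hi).2.1) x hs.symm h.ne
        exact (hl' i hi).1 he
      have hB1 := By hly
      rw [hB1, hly] at fq fq'
      have e1 : f y = 0 := half _ (by rw [← neg_one_mul, ← fq, fy])
      refine merge hns ?_
      rw [e1, fx', fq', fy', fp']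
      linear_combination (-A) * hι
    · exact (distinct (hkb.trans hlb.symm)).elim

end Permutation

end QuantumIsing
end

noncomputable section
namespace QuantumIsing

/-! ### Rotation of self-avoiding lattice polygons, modulo two turns -/

section Polygon

/-- The parity of the number of crossings of the half-line `{x < 0, -1 < y < 0}` by a unit step. -/
def rayCross (v w : ℤ × ℤ) : ZMod 2 :=
  (if v.1 < 0 then 1 else 0) * ((if 0 ≤ v.2 then 1 else 0) + (if 0 ≤ w.2 then 1 else 0))

/-- Nearest neighbours of the square lattice. -/
def UnitStep (u v : ℤ × ℤ) : Prop :=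
  (v.1 = u.1 ∧ (v.2 = u.2 + 1 ∨ v.2 = u.2 - 1)) ∨ (v.2 = u.2 ∧ (v.1 = u.1 + 1 ∨ v.1 = u.1 - 1))

/-- The crossed edges are the vertical ones between the rows -1 and 0 at negative abscissae. The
only unit square bordered by an odd number of them is [-1, 0]², which has 0 and (-1, -1) as opposite
corners; the four conditions exclude it. -/
lemma rayCross_square {v s t : ℤ × ℤ} (hs : UnitStep 0 s) (ht : UnitStep 0 t)
    (h : (v = 0 → v + t - s ≠ (-1, -1)) ∧ (v + t = 0 → v - s ≠ (-1, -1)) ∧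
      (v - s = 0 → v + t ≠ (-1, -1)) ∧ (v + t - s = 0 → v ≠ (-1, -1))) :
    rayCross v (v + t) + rayCross (v + t) (v + t - s) =
      rayCross v (v - s) + rayCross (v - s) (v + t - s) := by
  obtain ⟨a, b⟩ := v
  obtain ⟨p, q⟩ := s
  obtain ⟨c, d⟩ := t
  simp only [UnitStep, Prod.fst_zero, Prod.snd_zero, zero_add, zero_sub] at hs ht
  simp only [Prod.mk_add_mk, Prod.mk_sub_mk, ne_eq, Prod.mk_eq_zero, Prod.mk.injEq] at h
  obtain ⟨h1, h2, h3, h4⟩ := h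
  simp only [rayCross, Prod.mk_add_mk, Prod.mk_sub_mk]
  have e2 : (1 : ZMod 2) + 1 = 0 := by decide
  rcases hs with ⟨rfl, hq⟩ | ⟨rfl, hp⟩ <;> rcases ht with ⟨rfl, hd⟩ | ⟨rfl, hc⟩ <;>
    simp only [add_zero, sub_zero, CharTwo.add_self_eq_zero, mul_zero] at h1 h2 h3 h4 ⊢
  · rw [← mul_add, ← mul_add]; congr 1; ring_nf
    simp [show (2 : ZMod 2) = 0 from rfl]
  · have hb : (0 ≤ b ↔ 0 ≤ b - q) ∨ (a < 0 ↔ a + c < 0) := by omega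
    rcases hb with hb | hb
    · simp only [hb, CharTwo.add_self_eq_zero, mul_zero]
    · simp only [hb, zero_add]
  · have hb : (0 ≤ b ↔ 0 ≤ b + d) ∨ (a < 0 ↔ a - p < 0) := by omega
    rcases hb with hb | hb
    · simp only [hb, CharTwo.add_self_eq_zero, mul_zero]
    · simp only [hb, zero_add]

/-- A self-avoiding closed polygon of length `N` on the square lattice. -/
structure IsPolygon (z : ℕ → ℤ × ℤ) (N : ℕ) : Prop where
  three_le : 3 ≤ N
  periodic : ∀ i, z (i + N) = z i
  ne : ∀ i j, i < j → j < i + N → z i ≠ z j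
  step : ∀ i, UnitStep (z i) (z (i + 1))

/-- The crossings of the half-line when the direction of the `i`-th step turns into that of the
next one. -/
def turnCross (z : ℕ → ℤ × ℤ) (i : ℕ) : ZMod 2 :=
  rayCross (z (i + 1) - z i) (z (i + 2) - z i) + rayCross (z (i + 2) - z i) (z (i + 2) - z (i + 1))

lemma sum_range_shift {M : Type*} [AddCommGroup M] {g : ℕ → M} {N : ℕ} (hg : ∀ i, g (i + N) = g i)
    (k : ℕ) : ∑ i ∈ Finset.range N, g (i + k) = ∑ i ∈ Finset.range N, g i := by
  induction k with
  | zero => rfl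
  | succ k ih =>
    rw [← ih]
    have h1 := Finset.sum_range_succ' (fun i => g (i + k)) N
    have h2 := Finset.sum_range_succ (fun i => g (i + k)) N
    rw [h1, show g (N + k) = g (0 + k) by rw [add_comm N k, hg, zero_add]] at h2
    simpa [add_assoc, add_comm 1 k] using h2

namespace IsPolygon

variable {z : ℕ → ℤ × ℤ} {N : ℕ}

lemma shift (h : IsPolygon z N) (k : ℕ) : IsPolygon (fun i => z (i + k)) N where
  three_le := h.three_le
  periodic i := by rw [show i + N + k = i + k + N by omega, h.periodic]
  ne i j hij hj := h.ne _ _ (by omega) (by omega)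
  step i := by simpa [show i + 1 + k = i + k + 1 by omega] using h.step (i + k)

lemma unitStep_sub {u v : ℤ × ℤ} (h : UnitStep u v) : UnitStep 0 (v - u) := by
  simp only [UnitStep, Prod.fst_sub, Prod.snd_sub, Prod.fst_zero, Prod.snd_zero] at h ⊢
  omega

/-- The crossings along two sides of the triangle of chords, starting from the first step. -/
def sideCross (z : ℕ → ℤ × ℤ) (k : ℕ) : ZMod 2 :=
  ∑ j ∈ Finset.range k, rayCross (z (j + 1) - z 0) (z (j + 2) - z 0) +
    ∑ i ∈ Finset.range k, rayCross (z (k + 1) - z i) (z (k + 1) - z (i + 1))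

/-- Hopf's homotopy. The pair i < j stands for the chord `z j - z i`; `sideCross z k` goes along
(0,1) → (0,k+1) → (k,k+1), whereas the `turnCross` follow the staircase near the diagonal. One path
is pushed to the other across unit squares of chords, whose corners are nonzero because the polygon
is self-avoiding. -/
lemma sideCross_succ (h : IsPolygon z N) (h0 : z (N - 1) - z 0 = (0, 1) ∧ z 1 - z 0 = (1, 0) ∨
    z (N - 1) - z 0 = (1, 0) ∧ z 1 - z 0 = (0, 1)) {k : ℕ} (hk : k + 1 < N) :
    sideCross z (k + 1) = sideCross z k + turnCross z k := by
  -- The side at level k+1 is pushed to level k+2, one square at a time; `m` counts the squares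
  -- already crossed.
  have key : ∀ m ≤ k, rayCross (z (k + 1) - z 0) (z (k + 2) - z 0) +
      ∑ i ∈ Finset.range m, rayCross (z (k + 2) - z i) (z (k + 2) - z (i + 1)) =
      ∑ i ∈ Finset.range m, rayCross (z (k + 1) - z i) (z (k + 1) - z (i + 1)) +
      rayCross (z (k + 1) - z m) (z (k + 2) - z m) := by
    intro m
    induction m with
    | zero => intro _; simp
    | succ m ih =>
      intro hm
      have hsq := rayCross_square (v := z (k + 1) - z m) (unitStep_sub (h.step m))
        (unitStep_sub (h.step (k + 1))) (by
          have e1 : z (k + 1) - z m + (z (k + 1 + 1) - z (k + 1)) = z (k + 2) - z m := by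
            rw [show k + 1 + 1 = k + 2 from rfl]; abel
          have e2 : z (k + 1) - z m - (z (m + 1) - z m) = z (k + 1) - z (m + 1) := by abel
          have e3 : z (k + 2) - z m - (z (m + 1) - z m) = z (k + 2) - z (m + 1) := by abel
          rw [e1, e2, e3]
          -- The only square with a vanishing corner, the chord from `z 0` to `z N`. Its opposite
          -- corner is `z (N - 1) - z 1`, equal to (-1, 1) or (1, -1) by `h0`, so it is not the
          -- forbidden square.
          by_cases hc : m = 0 ∧ k + 2 = N
          · obtain ⟨rfl, hc⟩ := hc
            have hz : z (k + 2) = z 0 := by rw [hc]; simpa using h.periodic 0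
            rw [show N - 1 = k + 1 by omega] at h0
            rw [hz]
            have e4 : z 0 - z (0 + 1) = -(z 1 - z 0) := by abel
            have e5 : z (k + 1) - z (0 + 1) = (z (k + 1) - z 0) - (z 1 - z 0) := by abel
            rw [e4, e5]
            rcases h0 with ⟨h1, h2⟩ | ⟨h1, h2⟩ <;> rw [h1, h2, sub_self] <;> decide
          · refine ⟨fun h' => (h.ne _ _ ?_ ?_ (sub_eq_zero.1 h').symm).elim,
              fun h' => (h.ne _ _ ?_ ?_ (sub_eq_zero.1 h').symm).elim,
              fun h' => (h.ne _ _ ?_ ?_ (sub_eq_zero.1 h').symm).elim,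
              fun h' => (h.ne _ _ ?_ ?_ (sub_eq_zero.1 h').symm).elim⟩ <;> omega)
      have e1 : z (k + 1) - z m + (z (k + 1 + 1) - z (k + 1)) = z (k + 2) - z m := by
        rw [show k + 1 + 1 = k + 2 from rfl]; abel
      have e2 : z (k + 1) - z m - (z (m + 1) - z m) = z (k + 1) - z (m + 1) := by abel
      have e3 : z (k + 2) - z m - (z (m + 1) - z m) = z (k + 2) - z (m + 1) := by abel
      rw [e1, e2, e3] at hsq
      rw [Finset.sum_range_succ, Finset.sum_range_succ, ← add_assoc, ih (by omega), add_assoc, hsq]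
      ring
  have hk := key k le_rfl
  rw [sideCross, sideCross, Finset.sum_range_succ, Finset.sum_range_succ, turnCross]
  linear_combination hk

/-- Hopf's Umlaufsatz modulo two, from the lowest point. -/
lemma sum_turnCross_aux (h : IsPolygon z N)
    (hmin : ∀ j, 0 < j → j < N → (z 0).2 < (z j).2 ∨ ((z 0).2 = (z j).2 ∧ (z 0).1 < (z j).1)) :
    ∑ i ∈ Finset.range N, turnCross z i = 1 := by
  have hN := h.three_le
  obtain ⟨n, rfl⟩ : ∃ n, N = n + 3 := ⟨N - 3, by omega⟩
  have hzN : z (n + 3) = z 0 := by simpa using h.periodic 0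
  -- The two neighbours of the lowest, leftmost vertex can only be its upper and right neighbours.
  have h0 : z (n + 2) - z 0 = (0, 1) ∧ z 1 - z 0 = (1, 0) ∨
      z (n + 2) - z 0 = (1, 0) ∧ z 1 - z 0 = (0, 1) := by
    have h1 := hmin 1 (by omega) (by omega)
    have h2 := hmin (n + 2) (by omega) (by omega)
    have h3 := h.step 0
    have h4 := h.step (n + 2)
    have h5 := h.ne 1 (n + 2) (by omega) (by omega)
    rw [show n + 2 + 1 = n + 3 from rfl, hzN] at h4
    simp only [UnitStep, zero_add] at h3 h4
    simp only [Prod.ext_iff, Prod.fst_sub, Prod.snd_sub, ne_eq] at h5 ⊢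
    omega
  have hs : ∀ k ≤ n + 2, sideCross z k = ∑ i ∈ Finset.range k, turnCross z i := by
    intro k
    induction k with
    | zero => intro _; simp [sideCross]
    | succ k ih =>
      intro hk
      rw [h.sideCross_succ (by simpa using h0) (by omega), ih (by omega), Finset.sum_range_succ]
  have hlast : turnCross z (n + 2) = 0 := by
    have hz1 : z (n + 4) = z 1 := by
      have := h.periodic 1
      rwa [show 1 + (n + 3) = n + 4 by omega] at this
    rw [turnCross, show n + 2 + 1 = n + 3 from rfl, show n + 2 + 2 = n + 4 from rfl, hzN, hz1]
    have e1 : z 0 - z (n + 2) = -(z (n + 2) - z 0) := by abel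
    have e2 : z 1 - z (n + 2) = (z 1 - z 0) - (z (n + 2) - z 0) := by abel
    rw [e1, e2]
    rcases h0 with ⟨h1, h2⟩ | ⟨h1, h2⟩ <;> rw [h1, h2] <;> decide
  -- All chords issued from the lowest vertex point to the closed upper half-plane, so they never
  -- cross the half-line.
  have hbot : ∑ j ∈ Finset.range (n + 2), rayCross (z (j + 1) - z 0) (z (j + 2) - z 0) = 0 := by
    refine Finset.sum_eq_zero fun j hj => ?_
    have hj := Finset.mem_range.1 hj
    have h1 : 0 ≤ (z (j + 1) - z 0).2 := by
      have := hmin (j + 1) (by omega) (by omega)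
      rw [Prod.snd_sub]; omega
    have h2 : 0 ≤ (z (j + 2) - z 0).2 := by
      rw [Prod.snd_sub]
      rcases (show j + 2 ≤ n + 3 by omega).eq_or_lt with he | he
      · rw [he, hzN]; simp
      · have := hmin (j + 2) (by omega) (by omega)
        omega
    rw [rayCross, if_pos h1, if_pos h2, show (1 : ZMod 2) + 1 = 0 by decide, mul_zero]
  -- Chords ending at `z 0` point downwards, or strictly to the left if horizontal. The factor
  -- requiring a negative abscissa can thus be dropped in the steps between the rows -1 and 0, and
  -- the sum telescopes.
  have hside : ∀ m ≤ n + 1, ∑ i ∈ Finset.range (m + 1), rayCross (z 0 - z i) (z 0 - z (i + 1)) =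
      (if 0 ≤ (z 0 - z 1).2 then 1 else 0) + (if 0 ≤ (z 0 - z (m + 1)).2 then 1 else 0) := by
    intro m
    induction m with
    | zero =>
      intro _
      simp only [zero_add, Finset.sum_range_one, sub_self]
      split_ifs <;> simp [rayCross, show (1 : ZMod 2) + 1 = 0 by decide]
    | succ m ih =>
      intro hm
      rw [Finset.sum_range_succ, ih (by omega)]
      have h1 := hmin (m + 1) (by omega) (by omega)
      have h2 := hmin (m + 2) (by omega) (by omega)
      have h3 := h.step (m + 1)
      rw [show m + 1 + 1 = m + 2 from rfl] at *
      simp only [UnitStep] at h3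
      simp only [rayCross, Prod.snd_sub, Prod.fst_sub]
      have h2' : (1 : ZMod 2) + 1 = 0 := by decide
      split_ifs <;> first | omega | simp [h2']
  have hfin := hs (n + 2) le_rfl
  rw [sideCross, hbot, zero_add, show n + 2 + 1 = n + 3 from rfl, hzN, hside (n + 1) le_rfl] at hfin
  rw [Finset.sum_range_succ, hlast, add_zero, ← hfin]
  have e1 : z 0 - z 1 = -(z 1 - z 0) := by abel
  have e2 : z 0 - z (n + 1 + 1) = -(z (n + 2) - z 0) := by rw [show n + 1 + 1 = n + 2 from rfl]; abel
  rw [e1, e2]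
  rcases h0 with ⟨h1, h2⟩ | ⟨h1, h2⟩ <;> rw [h1, h2] <;> decide

/-- Hopf's Umlaufsatz modulo two. -/
theorem sum_turnCross (h : IsPolygon z N) : ∑ i ∈ Finset.range N, turnCross z i = 1 := by
  have hN := h.three_le
  -- The lexicographic minimum of (height, abscissa) is the lowest vertex, the leftmost one in case
  -- of ties.
  obtain ⟨k, -, hk⟩ := Finset.exists_min_image (Finset.range N)
    (fun i => toLex ((z i).2, (z i).1)) ⟨0, Finset.mem_range.2 (by omega)⟩
  have hall : ∀ j, toLex ((z k).2, (z k).1) ≤ toLex ((z j).2, (z j).1) := by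
    intro j
    have hper : ∀ m i, z (i + m * N) = z i := by
      intro m
      induction m with
      | zero => simp
      | succ m ih => intro i; rw [show i + (m + 1) * N = i + m * N + N by ring, h.periodic, ih]
    have := hk (j % N) (Finset.mem_range.2 (Nat.mod_lt _ (by omega)))
    rwa [← hper (j / N) (j % N), mul_comm, Nat.mod_add_div] at this
  have hT : ∀ i, turnCross z (i + N) = turnCross z i := fun i => by
    rw [turnCross, turnCross, show i + N + 1 = i + 1 + N by omega,
      show i + N + 2 = i + 2 + N by omega, h.periodic, h.periodic, h.periodic]
  rw [← sum_range_shift hT k]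
  have := (h.shift k).sum_turnCross_aux (fun j hj hjN => by
    have h1 := hall (j + k)
    have h2 := h.ne k (j + k) (by omega) (by omega)
    rw [Prod.Lex.toLex_le_toLex] at h1
    simp only [zero_add]
    simp only [ne_eq, Prod.ext_iff] at h2
    rcases h1 with h1 | ⟨h1, h3⟩
    · exact Or.inl h1
    · refine Or.inr ⟨h1, lt_of_le_of_ne h3 fun h4 => h2 ⟨h4, h1⟩⟩)
  rw [← this]
  refine Finset.sum_congr rfl fun i _ => ?_
  simp only [turnCross, show i + 1 + k = i + k + 1 by omega, show i + 2 + k = i + k + 2 by omega]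

/-- The total rotation of a self-avoiding polygon which goes down in even columns, up in odd
columns, and never makes two successive horizontal steps. -/
theorem sum_turn (h : IsPolygon z N) (t : ℕ → ℤ)
    (hdown : ∀ i, Even (z i).1 → (z (i + 1)).2 ≤ (z i).2)
    (hup : ∀ i, Odd (z i).1 → (z i).2 ≤ (z (i + 1)).2)
    (hiso : ∀ i, (z (i + 1)).1 ≠ (z i).1 → (z (i + 2)).1 = (z (i + 1)).1)
    (ht : ∀ i, Even (z i).1 → t i = (z (i + 1)).1 - (z i).1)
    (ht' : ∀ i, Odd (z i).1 → t i = (z i).1 - (z (i + 1)).1) :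
    ∃ m : ℤ, ∑ i ∈ Finset.range N, t i = 4 * m + 2 := by
  have sumdiff : ∀ g : ℕ → ℤ, (∀ i, g (i + N) = g i) →
      ∑ i ∈ Finset.range N, (g (i + 1) - g i) = 0 := fun g hg => by
    rw [Finset.sum_sub_distrib, sum_range_shift hg, sub_self]
  let west : ℕ → ℤ := fun i => if (z (i + 1)).1 < (z i).1 then 1 else 0
  let we : ℕ → ℤ := fun i => if (z (i + 1)).1 < (z i).1 ∧ Even (z i).1 then 1 else 0
  let wo : ℕ → ℤ := fun i => if (z (i + 1)).1 < (z i).1 ∧ Odd (z i).1 then 1 else 0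
  let od : ℕ → ℤ := fun i => if (z (i + 1)).1 ≠ (z i).1 ∧ Odd (z i).1 then 1 else 0
  let par : ℕ → ℤ := fun i => if Odd (z i).1 then 1 else 0
  have hper1 : ∀ i, z (i + N + 1) = z (i + 1) := fun i => by
    rw [show i + N + 1 = i + 1 + N by omega, h.periodic]
  -- With the allowed directions, the half-line is crossed exactly when the curve turns between west
  -- and down: just before a west step from an even column, just after one from an odd column. So
  -- each west step accounts for one crossing, and their number is odd.
  have hcross : ∀ i, turnCross z i = ((we (i + 1) + wo i : ℤ) : ZMod 2) := by
    intro i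
    have s1 := h.step i
    have s2 := h.step (i + 1)
    have d1 := hdown i
    have d2 := hdown (i + 1)
    have u1 := hup i
    have u2 := hup (i + 1)
    have i1 := hiso i
    have n1 := h.ne i (i + 2) (by omega) (by have := h.three_le; omega)
    simp only [turnCross, we, wo]
    rw [show i + 1 + 1 = i + 2 from rfl] at *
    generalize z i = p at *
    generalize z (i + 1) = q at *
    generalize z (i + 2) = r at *
    obtain ⟨a, b⟩ := p
    obtain ⟨c, d⟩ := q
    obtain ⟨e, f⟩ := r
    simp only [UnitStep, rayCross, Prod.mk_sub_mk, ne_eq, Prod.mk.injEq] at *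
    have h2' : (1 : ZMod 2) + 1 = 0 := by decide
    simp only [Int.even_iff, Int.odd_iff] at *
    rcases s1 with ⟨rfl, rfl | rfl⟩ | ⟨rfl, rfl | rfl⟩ <;>
    rcases s2 with ⟨rfl, rfl | rfl⟩ | ⟨rfl, rfl | rfl⟩ <;>
    split_ifs <;> first | omega | simp [h2']
  have hW : Odd (∑ i ∈ Finset.range N, west i) := by
    have h1 := h.sum_turnCross
    rw [Finset.sum_congr rfl fun i _ => hcross i] at h1
    have h2 : ∑ i ∈ Finset.range N, (we (i + 1) + wo i) = ∑ i ∈ Finset.range N, west i := by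
      rw [Finset.sum_add_distrib, sum_range_shift (g := we) fun i => by
        simp only [we, hper1, h.periodic], ← Finset.sum_add_distrib]
      refine Finset.sum_congr rfl fun i _ => ?_
      simp only [we, wo, west]
      rcases Int.even_or_odd (z i).1 with he | he
      · have := Int.not_odd_iff_even.2 he; simp [he, this]
      · have := Int.not_even_iff_odd.2 he; simp [he, this]
    rw [← Int.cast_sum, h2] at h1
    rw [← Int.not_even_iff_odd, even_iff_two_dvd]
    intro hd
    have := (ZMod.intCast_zmod_eq_zero_iff_dvd _ 2).2 (by exact_mod_cast hd)
    rw [this] at h1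
    exact absurd h1 (by decide)
  -- Horizontal steps alternate, by parity of column, between odd and even starting points up to a
  -- telescoping term. Half of them start from odd columns, and their total exceeds twice the west
  -- steps by a telescoping term.
  have hod : ∀ i, 2 * od i = (z (i + 1)).1 - (z i).1 + 2 * west i - (par (i + 1) - par i) := by
    intro i
    have s1 := h.step i
    simp only [od, west, par, UnitStep, Int.odd_iff] at *
    split_ifs <;> omega
  -- Summed over a period, this gives 4 `Σ wo` - 2 `Σ od` with `Σ od` equal to the odd number of
  -- west steps, hence 2 modulo 4.
  have htt : ∀ i, t i = (z (i + 1)).1 - (z i).1 - 2 * od i + 4 * wo i := by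
    intro i
    have s1 := h.step i
    have t1 := ht i
    have t2 := ht' i
    simp only [od, wo, UnitStep, Int.odd_iff, Int.even_iff] at *
    split_ifs <;> omega
  have sx := sumdiff (fun i => (z i).1) fun i => by rw [h.periodic]
  have sp := sumdiff par fun i => by simp only [par, h.periodic]
  have e1 := Finset.sum_congr (s₁ := Finset.range N) rfl fun i _ => hod i
  have e2 := Finset.sum_congr (s₁ := Finset.range N) rfl fun i _ => htt i
  rw [Finset.sum_sub_distrib, Finset.sum_add_distrib, sx, sp, ← Finset.mul_sum,
    ← Finset.mul_sum] at e1
  rw [Finset.sum_add_distrib, Finset.sum_sub_distrib, sx, ← Finset.mul_sum,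
    ← Finset.mul_sum] at e2
  obtain ⟨m, hm⟩ := hW
  exact ⟨∑ i ∈ Finset.range N, wo i - m - 1, by rw [e2]; linarith⟩

end IsPolygon

end Polygon

end QuantumIsing
end

noncomputable section
namespace QuantumIsing

/-! ### Order isomorphisms of the line -/

section Order

/-- The order isomorphism fixing `(-∞, c]` and dilating `[c, ∞)` by the factor `k`. -/
lemma exists_orderIso_stretch (c : ℝ) {k : ℝ} (hk : 0 < k) :
    ∃ ψ : ℝ ≃o ℝ, (∀ x ≤ c, ψ x = x) ∧ ∀ x, c < x → ψ x = c + k * (x - c) := by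
  let g : ℝ → ℝ := fun x => if x ≤ c then x else c + k * (x - c)
  have hmono : StrictMono g := by
    intro x y hxy
    simp only [g]
    split_ifs with h1 h2 h2
    · exact hxy
    · have := mul_pos hk (sub_pos.2 (not_le.1 h2)); linarith
    · linarith
    · have := mul_lt_mul_of_pos_left hxy hk; linarith
  have hsurj : Function.Surjective g := by
    intro y
    by_cases hy : y ≤ c
    · exact ⟨y, by simp [g, hy]⟩
    · have h1 : 0 < (y - c) / k := div_pos (by linarith) hk
      refine ⟨c + (y - c) / k, ?_⟩
      simp only [g]
      rw [if_neg (by linarith)]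
      field_simp
      ring
  refine ⟨hmono.orderIsoOfSurjective g hsurj, fun x hx => ?_, fun x hx => ?_⟩
  · change g x = x
    simp [g, hx]
  · change g x = _
    simp [g, hx]

/-- Finitely many order constraints are realized by an order isomorphism. -/
lemma exists_orderIso_extend {ι : Type*} (h h' : ι → ℝ) (hh : ∀ i k, h i < h k ↔ h' i < h' k)
    (s : Finset ι) : ∃ ψ : ℝ ≃o ℝ, ∀ i ∈ s, ψ (h i) = h' i := by
  classical
  -- The heights are added in increasing order: a new maximum is put in place by dilating the
  -- half-line above the previous one, which leaves the earlier values alone.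
  induction s using Finset.induction_on_max_value h with
  | empty => exact ⟨OrderIso.refl ℝ, by simp⟩
  | insert a s ha hmax ih =>
    obtain ⟨ψ, hψ⟩ := ih
    rcases s.eq_empty_or_nonempty with rfl | hs
    · refine ⟨OrderIso.addRight (h' a - h a), ?_⟩
      simp
    · obtain ⟨m, hm, hm'⟩ := s.exists_max_image h hs
      rcases (hmax m hm).eq_or_lt with he | hlt
      · refine ⟨ψ, fun i hi => ?_⟩
        rcases Finset.mem_insert.1 hi with rfl | hi
        · rw [← he, hψ m hm]
          refine le_antisymm (not_lt.1 fun hl => ?_) (not_lt.1 fun hl => ?_)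
          · exact absurd ((hh _ _).2 hl) (by rw [he]; exact lt_irrefl _)
          · exact absurd ((hh _ _).2 hl) (by rw [he]; exact lt_irrefl _)
        · exact hψ i hi
      · have h1 : h' m < h' a := (hh _ _).1 hlt
        have h2 : h' m < ψ (h a) := by rw [← hψ m hm]; exact ψ.strictMono hlt
        obtain ⟨φ, hφ, hφ'⟩ := exists_orderIso_stretch (h' m)
          (div_pos (sub_pos.2 h1) (sub_pos.2 h2))
        refine ⟨ψ.trans φ, fun i hi => ?_⟩
        rw [OrderIso.trans_apply]
        rcases Finset.mem_insert.1 hi with rfl | hi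
        · rw [hφ' _ h2, div_mul_cancel₀ _ (sub_pos.2 h2).ne']; ring
        · rw [hφ, hψ i hi]
          rw [hψ i hi]
          exact not_lt.1 fun hl => absurd ((hh _ _).2 hl) (not_lt.2 (hm' i hi))

/-- Finitely many heights can be moved to half-integers following an even integer. -/
lemma exists_orderIso_normalize (E : Finset ℝ) :
    ∃ ψ : ℝ ≃o ℝ, ∀ e ∈ E, ∃ r : ℤ, Even r ∧ ψ e = r + 1 / 2 := by
  classical
  -- The target is 2·rank + 1/2. The factor 2 leaves an empty level between two successive events.
  let rk : E → ℕ := fun e => (E.filter (· < e.1)).card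
  have hrk : ∀ e f : E, e.1 < f.1 → rk e < rk f := fun e f hef =>
    Finset.card_lt_card ⟨Finset.monotone_filter_right E fun _ _ h => h.trans hef, fun hc =>
      absurd (Finset.mem_filter.1 (hc (Finset.mem_filter.2 ⟨e.2, hef⟩))).2 (lt_irrefl _)⟩
  obtain ⟨ψ, hψ⟩ := exists_orderIso_extend (fun e : E => e.1)
    (fun e : E => (((2 * rk e : ℕ) : ℤ) : ℝ) + 1 / 2) (fun e f => by
      constructor
      · intro hef
        have := hrk e f hef
        simp only [add_lt_add_iff_right]
        exact_mod_cast (by omega : 2 * rk e < 2 * rk f)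
      · intro hef
        simp only [add_lt_add_iff_right] at hef
        have hef : 2 * rk e < 2 * rk f := by exact_mod_cast hef
        by_contra hle
        rcases (not_lt.1 hle).eq_or_lt with he | hlt
        · rw [Subtype.ext he] at hef; omega
        · have := hrk f e hlt; omega) Finset.univ
  exact ⟨ψ, fun e he => ⟨_, by exact_mod_cast even_two_mul (rk ⟨e, he⟩), hψ ⟨e, he⟩ (Finset.mem_univ _)⟩⟩

/-- Moving the heights of points by a map of the line. -/
def lift (ψ : ℝ → ℝ) (p : ℤ × ℝ) : ℤ × ℝ := (p.1, ψ p.2)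

@[simp] lemma lift_fst (ψ : ℝ → ℝ) (p : ℤ × ℝ) : (lift ψ p).1 = p.1 := rfl

@[simp] lemma lift_snd (ψ : ℝ → ℝ) (p : ℤ × ℝ) : (lift ψ p).2 = ψ p.2 := rfl

/-- A function of finitely many points that depends only on their columns and on the relative
order of their heights and of finitely many fixed heights is measurable. -/
theorem measurable_of_lift_invariant {I Y : Type*} [Finite I] [MeasurableSpace Y] (H : Finset ℝ)
    (F : (I → ℤ × ℝ) → Y)
    (hF : ∀ ψ : ℝ ≃o ℝ, (∀ h ∈ H, ψ h = h) → ∀ x, F (fun i => lift ψ (x i)) = F x) :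
    Measurable F := by
  classical
  cases nonempty_fintype I
  let ht : (I → ℤ × ℝ) → I ⊕ H → ℝ := fun x => Sum.elim (fun i => (x i).2) (fun h => h.1)
  -- The columns and the order relation of the heights form a countable set of values; the pattern
  -- is measurable and the function factors through it by `exists_orderIso_extend`.
  let pattern : (I → ℤ × ℝ) → (I → ℤ) × (I ⊕ H → I ⊕ H → Prop) :=
    fun x => (fun i => (x i).1, fun a b => ht x a < ht x b)
  have hht : ∀ a, Measurable fun x => ht x a := by
    rintro (i | h)
    · exact (measurable_pi_apply i).snd
    · exact measurable_const
  have hpat : Measurable pattern := by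
    refine Measurable.prodMk (measurable_pi_lambda _ fun i => (measurable_pi_apply i).fst) ?_
    refine measurable_pi_lambda _ fun a => measurable_pi_lambda _ fun b => ?_
    exact measurableSet_setOfPred.1 (measurableSet_lt (hht a) (hht b))
  have hfac : ∀ x x', pattern x = pattern x' → F x = F x' := by
    intro x x' hxx
    obtain ⟨h1, h2⟩ := Prod.ext_iff.1 hxx
    obtain ⟨ψ, hψ⟩ := exists_orderIso_extend (ht x) (ht x')
      (fun a b => by simpa using congrFun (congrFun h2 a) b) Finset.univ
    rw [← hF ψ (fun h hh => hψ (Sum.inr ⟨h, hh⟩) (Finset.mem_univ _)) x]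
    congr 1
    funext i
    exact Prod.ext (congrFun h1 i) (hψ (Sum.inl i) (Finset.mem_univ _))
  intro B _
  have : F ⁻¹' B = pattern ⁻¹' (pattern '' (F ⁻¹' B)) := by
    refine Set.Subset.antisymm (Set.subset_preimage_image _ _) ?_
    rintro x ⟨x', hx', he⟩
    change F x ∈ B
    rw [← hfac _ _ he]
    exact hx'
  rw [this]
  exact hpat (Set.to_countable _).measurableSet

end Order

end QuantumIsing
end

noncomputable section
namespace QuantumIsing

/-! ### Discrete strand diagrams -/

section LayersSection

/-- A discrete strand diagram. Sites are given by their column and their row; a cut `(c, r)`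
lies between the columns `c - 1` and `c`, and between the rows `r` and `r + 1`.  Strands go
downwards in even columns and upwards in odd columns; one of them starts at `a` and ends at `b`. -/
structure Layers where
  site : Set (ℤ × ℤ)
  cut : Set (ℤ × ℤ)
  a : ℤ × ℤ
  b : ℤ × ℤ
  finite : site.Finite
  isolated : ∀ c c' r, (c, r) ∈ cut → (c', r + 1) ∉ cut
  nonadj : ∀ c r, (c, r) ∈ cut → (c + 1, r) ∉ cut
  below : ∀ c r, (c, r) ∈ cut → ((c - 1, r) ∈ site ↔ (c, r) ∈ site)
  above : ∀ c r, (c, r) ∈ cut → ((c - 1, r + 1) ∈ site ↔ (c, r + 1) ∈ site)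
  pass : ∀ j r, (j, r) ∉ cut → (j + 1, r) ∉ cut → (j, r) ≠ a → (j, r) ≠ b →
    ((j, r) ∈ site ↔ (j, r + 1) ∈ site)
  a_cut : (a.1, a.2) ∉ cut ∧ (a.1 + 1, a.2) ∉ cut
  b_cut : (b.1, b.2) ∉ cut ∧ (b.1 + 1, b.2) ∉ cut
  a_even : Even a.1 → (a.1, a.2) ∈ site ∧ (a.1, a.2 + 1) ∉ site
  a_odd : Odd a.1 → (a.1, a.2 + 1) ∈ site ∧ (a.1, a.2) ∉ site
  b_even : Even b.1 → (b.1, b.2 + 1) ∈ site ∧ (b.1, b.2) ∉ site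
  b_odd : Odd b.1 → (b.1, b.2) ∈ site ∧ (b.1, b.2 + 1) ∉ site

/-- The level met first when leaving a site forwards. -/
def fwdLevel (x : ℤ × ℤ) : ℤ := if Even x.1 then x.2 - 1 else x.2

/-- The level met first when leaving a site backwards. -/
def bwdLevel (x : ℤ × ℤ) : ℤ := if Even x.1 then x.2 else x.2 - 1

/-- The next row in the direction of travel. -/
def fwdRow (x : ℤ × ℤ) : ℤ := if Even x.1 then x.2 - 1 else x.2 + 1

/-- The previous row in the direction of travel. -/
def bwdRow (x : ℤ × ℤ) : ℤ := if Even x.1 then x.2 + 1 else x.2 - 1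

namespace Layers

variable (L : Layers)

/-- The first site of the interface. -/
def aSite : ℤ × ℤ := (L.a.1, if Even L.a.1 then L.a.2 else L.a.2 + 1)

/-- The last site of the interface. -/
def bSite : ℤ × ℤ := (L.b.1, if Even L.b.1 then L.b.2 + 1 else L.b.2)

open Classical in
/-- The next site along the strands, the end of the interface being joined to its start. -/
def next (x : ℤ × ℤ) : ℤ × ℤ :=
  if (x.1 + 1, fwdLevel x) ∈ L.cut then (x.1 + 1, x.2)
  else if (x.1, fwdLevel x) ∈ L.cut then (x.1 - 1, x.2)
  else if (x.1, fwdLevel x) = L.b then L.aSite else (x.1, fwdRow x)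

open Classical in
/-- The previous site along the strands. -/
def prev (x : ℤ × ℤ) : ℤ × ℤ :=
  if (x.1 + 1, bwdLevel x) ∈ L.cut then (x.1 + 1, x.2)
  else if (x.1, bwdLevel x) ∈ L.cut then (x.1 - 1, x.2)
  else if (x.1, bwdLevel x) = L.a then L.bSite else (x.1, bwdRow x)

lemma aSite_mem : L.aSite ∈ L.site := by
  rcases Int.even_or_odd L.a.1 with h | h
  · simpa [aSite, h] using (L.a_even h).1
  · simpa [aSite, Int.not_even_iff_odd.2 h] using (L.a_odd h).1

lemma bSite_mem : L.bSite ∈ L.site := by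
  rcases Int.even_or_odd L.b.1 with h | h
  · simpa [bSite, h] using (L.b_even h).1
  · simpa [bSite, Int.not_even_iff_odd.2 h] using (L.b_odd h).1

/-- A site whose forward level has no obstacle continues vertically. -/
lemma fwd_ne_a {x : ℤ × ℤ} (hx : x ∈ L.site) : (x.1, fwdLevel x) ≠ L.a := by
  obtain ⟨j, r⟩ := x
  intro he
  rcases Int.even_or_odd j with h | h
  · have := (L.a_even (by rw [← he]; exact h)).2
    rw [← he] at this
    simp [fwdLevel, h] at this
    exact this hx
  · have h' := Int.not_even_iff_odd.2 h
    have := (L.a_odd (by rw [← he]; exact h)).2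
    rw [← he] at this
    simp [fwdLevel, h'] at this
    exact this hx

lemma bwd_ne_b {x : ℤ × ℤ} (hx : x ∈ L.site) : (x.1, bwdLevel x) ≠ L.b := by
  obtain ⟨j, r⟩ := x
  intro he
  rcases Int.even_or_odd j with h | h
  · have := (L.b_even (by rw [← he]; exact h)).2
    rw [← he] at this
    simp [bwdLevel, h] at this
    exact this hx
  · have h' := Int.not_even_iff_odd.2 h
    have := (L.b_odd (by rw [← he]; exact h)).2
    rw [← he] at this
    simp [bwdLevel, h'] at this
    exact this hx

lemma next_mem {x : ℤ × ℤ} (hx : x ∈ L.site) : L.next x ∈ L.site := by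
  have hna := L.fwd_ne_a hx
  obtain ⟨j, r⟩ := x
  by_cases h1 : (j + 1, fwdLevel (j, r)) ∈ L.cut
  · simp only [next, h1, if_true]
    by_cases h : Even j
    · simpa [fwdLevel, h] using (L.above _ _ h1).1 (by simpa [fwdLevel, h] using hx)
    · simpa [fwdLevel, h] using (L.below _ _ h1).1 (by simpa [fwdLevel, h] using hx)
  by_cases h2 : (j, fwdLevel (j, r)) ∈ L.cut
  · simp only [next, h1, h2, if_true, if_false]
    by_cases h : Even j
    · simpa [fwdLevel, h] using (L.above _ _ h2).2 (by simpa [fwdLevel, h] using hx)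
    · simpa [fwdLevel, h] using (L.below _ _ h2).2 (by simpa [fwdLevel, h] using hx)
  by_cases h3 : (j, fwdLevel (j, r)) = L.b
  · rw [next, if_neg h1, if_neg h2, if_pos h3]
    exact L.aSite_mem
  · simp only [next, h1, h2, h3, if_false]
    have := L.pass _ _ h2 h1 hna h3
    by_cases h : Even j
    · simp only [fwdLevel, fwdRow, h, if_true] at this ⊢
      exact this.2 (by simpa using hx)
    · simp only [fwdLevel, fwdRow, h, if_false] at this ⊢
      exact this.1 (by simpa using hx)

lemma prev_mem {x : ℤ × ℤ} (hx : x ∈ L.site) : L.prev x ∈ L.site := by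
  have hna := L.bwd_ne_b hx
  obtain ⟨j, r⟩ := x
  by_cases h1 : (j + 1, bwdLevel (j, r)) ∈ L.cut
  · simp only [prev, h1, if_true]
    by_cases h : Even j
    · simpa [bwdLevel, h] using (L.below _ _ h1).1 (by simpa [bwdLevel, h] using hx)
    · simpa [bwdLevel, h] using (L.above _ _ h1).1 (by simpa [bwdLevel, h] using hx)
  by_cases h2 : (j, bwdLevel (j, r)) ∈ L.cut
  · simp only [prev, h1, h2, if_true, if_false]
    by_cases h : Even j
    · simpa [bwdLevel, h] using (L.below _ _ h2).2 (by simpa [bwdLevel, h] using hx)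
    · simpa [bwdLevel, h] using (L.above _ _ h2).2 (by simpa [bwdLevel, h] using hx)
  by_cases h3 : (j, bwdLevel (j, r)) = L.a
  · rw [prev, if_neg h1, if_neg h2, if_pos h3]
    exact L.bSite_mem
  · simp only [prev, h1, h2, h3, if_false]
    have := L.pass _ _ h2 h1 h3 hna
    by_cases h : Even j
    · simp only [bwdLevel, bwdRow, h, if_true] at this ⊢
      exact this.1 (by simpa using hx)
    · simp only [bwdLevel, bwdRow, h, if_false] at this ⊢
      exact this.2 (by simpa using hx)

lemma prev_aSite : L.prev L.aSite = L.bSite := by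
  have hl : bwdLevel L.aSite = L.a.2 := by
    rcases Int.even_or_odd L.a.1 with h | h
    · simp [bwdLevel, aSite, h]
    · simp [bwdLevel, aSite, Int.not_even_iff_odd.2 h]
  have h1 : L.aSite.1 = L.a.1 := rfl
  rw [prev, hl, h1, if_neg L.a_cut.2, if_neg L.a_cut.1, if_pos rfl]

lemma next_bSite : L.next L.bSite = L.aSite := by
  have hl : fwdLevel L.bSite = L.b.2 := by
    rcases Int.even_or_odd L.b.1 with h | h
    · simp [fwdLevel, bSite, h]
    · simp [fwdLevel, bSite, Int.not_even_iff_odd.2 h]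
  have h1 : L.bSite.1 = L.b.1 := rfl
  rw [next, hl, h1, if_neg L.b_cut.2, if_neg L.b_cut.1, if_pos rfl]

lemma eq_bSite {x : ℤ × ℤ} (h : (x.1, fwdLevel x) = L.b) : x = L.bSite := by
  obtain ⟨j, r⟩ := x
  rcases Int.even_or_odd j with hj | hj
  · simp [fwdLevel, hj] at h
    simp [bSite, ← h, hj]
  · have hj' := Int.not_even_iff_odd.2 hj
    simp [fwdLevel, hj'] at h
    simp [bSite, ← h, hj']

lemma eq_aSite {x : ℤ × ℤ} (h : (x.1, bwdLevel x) = L.a) : x = L.aSite := by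
  obtain ⟨j, r⟩ := x
  rcases Int.even_or_odd j with hj | hj
  · simp [bwdLevel, hj] at h
    simp [aSite, ← h, hj]
  · have hj' := Int.not_even_iff_odd.2 hj
    simp [bwdLevel, hj'] at h
    simp [aSite, ← h, hj']

/-- Directions of travel alternate between neighbouring columns, so that forward and backward levels
are exchanged by a horizontal move. -/
lemma level_horizontal {j r d : ℤ} (hd : d = 1 ∨ d = -1) :
    bwdLevel (j + d, r) = fwdLevel (j, r) ∧ fwdLevel (j + d, r) = bwdLevel (j, r) := by
  have : Even (j + d) ↔ ¬Even j := by
    rcases hd with rfl | rfl <;> simp [Int.even_add]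
  simp only [bwdLevel, fwdLevel, this]
  by_cases h : Even j <;> simp [h]

lemma level_vertical (j r : ℤ) : bwdLevel (j, fwdRow (j, r)) = fwdLevel (j, r) ∧
    fwdLevel (j, bwdRow (j, r)) = bwdLevel (j, r) ∧ fwdRow (j, bwdRow (j, r)) = r ∧
    bwdRow (j, fwdRow (j, r)) = r := by
  simp only [bwdLevel, fwdLevel, fwdRow, bwdRow]
  by_cases h : Even j <;> simp [h]

lemma prev_next {x : ℤ × ℤ} (hx : x ∈ L.site) : L.prev (L.next x) = x := by
  have hna := L.fwd_ne_a hx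
  obtain ⟨j, r⟩ := x
  by_cases h1 : (j + 1, fwdLevel (j, r)) ∈ L.cut
  · have h2 := (level_horizontal (j := j) (r := r) (Or.inl rfl)).1
    -- `prev` examines the eastern line first; `nonadj` ensures that it does not find another cut
    -- there.
    have h3 : (j + 1 + 1, fwdLevel (j, r)) ∉ L.cut := L.nonadj _ _ h1
    simp [next, h1, prev, h2, h3]
  by_cases h2 : (j, fwdLevel (j, r)) ∈ L.cut
  · have h3 := (level_horizontal (j := j) (r := r) (Or.inr rfl)).1
    rw [← sub_eq_add_neg] at h3
    simp [next, h1, h2, prev, h3]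
  by_cases h3 : (j, fwdLevel (j, r)) = L.b
  · rw [L.eq_bSite (x := (j, r)) h3, next_bSite, prev_aSite]
  · have h4 := level_vertical j r
    simp [next, h1, h2, h3, prev, h4, hna]

lemma next_prev {x : ℤ × ℤ} (hx : x ∈ L.site) : L.next (L.prev x) = x := by
  have hna := L.bwd_ne_b hx
  obtain ⟨j, r⟩ := x
  by_cases h1 : (j + 1, bwdLevel (j, r)) ∈ L.cut
  · have h2 := (level_horizontal (j := j) (r := r) (Or.inl rfl)).2
    have h3 : (j + 1 + 1, bwdLevel (j, r)) ∉ L.cut := L.nonadj _ _ h1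
    simp [next, h1, prev, h2, h3]
  by_cases h2 : (j, bwdLevel (j, r)) ∈ L.cut
  · have h3 := (level_horizontal (j := j) (r := r) (Or.inr rfl)).2
    rw [← sub_eq_add_neg] at h3
    simp [next, h1, h2, prev, h3]
  by_cases h3 : (j, bwdLevel (j, r)) = L.a
  · rw [L.eq_aSite (x := (j, r)) h3, prev_aSite, next_bSite]
  · have h4 := level_vertical j r
    simp [next, h1, h2, h3, prev, h4, hna]

/-- The permutation of the sites along the strands. -/
def perm : Equiv.Perm L.site where
  toFun x := ⟨L.next x.1, L.next_mem x.2⟩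
  invFun x := ⟨L.prev x.1, L.prev_mem x.2⟩
  left_inv x := Subtype.ext (L.prev_next x.2)
  right_inv x := Subtype.ext (L.next_prev x.2)

instance : Finite L.site := L.finite

@[simp] lemma coe_perm (x : L.site) : (L.perm x : ℤ × ℤ) = L.next x := rfl

/-- The last site of the interface. -/
def last : L.site := ⟨L.bSite, L.bSite_mem⟩

/-- The first site of the interface. -/
def first : L.site := ⟨L.aSite, L.aSite_mem⟩

lemma perm_last : L.perm L.last = L.first := Subtype.ext L.next_bSite

open Classical in
/-- The rotation, in half-turns, between a site and the next one. -/
def turn (x : ℤ × ℤ) : ℤ :=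
  if (x.1 + 1, fwdLevel x) ∈ L.cut then eastTurn x.1
  else if (x.1, fwdLevel x) ∈ L.cut then -eastTurn x.1 else 0

/-- The three possible steps. -/
lemma next_cases {x : ℤ × ℤ} (hx : x ≠ L.bSite) :
    ((x.1 + 1, fwdLevel x) ∈ L.cut ∧ L.next x = (x.1 + 1, x.2) ∧ L.turn x = eastTurn x.1) ∨
    ((x.1, fwdLevel x) ∈ L.cut ∧ L.next x = (x.1 - 1, x.2) ∧ L.turn x = -eastTurn x.1) ∨
    ((x.1 + 1, fwdLevel x) ∉ L.cut ∧ (x.1, fwdLevel x) ∉ L.cut ∧ (x.1, fwdLevel x) ≠ L.b ∧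
      L.next x = (x.1, fwdRow x) ∧ L.turn x = 0) := by
  by_cases h1 : (x.1 + 1, fwdLevel x) ∈ L.cut
  · simp [next, turn, h1]
  by_cases h2 : (x.1, fwdLevel x) ∈ L.cut
  · simp [next, turn, h1, h2]
  have h3 : (x.1, fwdLevel x) ≠ L.b := fun h => hx (L.eq_bSite h)
  simp [next, turn, h1, h2, h3]

/-- After a half-turn at a level the strand moves away from it and next meets the adjacent level,
which `isolated` keeps free of cuts. Hence there are never two successive horizontal steps. -/
lemma not_cut_of_horizontal {x y : ℤ × ℤ} (h : y.2 = x.2) (hd : y.1 = x.1 + 1 ∨ y.1 = x.1 - 1)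
    {c : ℤ} (hc : (c, fwdLevel x) ∈ L.cut) (c' : ℤ) : (c', fwdLevel y) ∉ L.cut := by
  obtain ⟨j, r⟩ := x
  obtain ⟨j', r'⟩ := y
  simp only at h hd
  subst h
  have hp : Even j' ↔ ¬Even j := by
    rcases hd with rfl | rfl
    · exact Int.even_add_one
    · exact Int.even_sub_one
  by_cases he : Even j
  · simp only [fwdLevel, hp, he, if_true, not_true, if_false] at hc ⊢
    simpa using L.isolated c c' _ hc
  · simp only [fwdLevel, hp, he, if_false, not_false_iff, if_true] at hc ⊢
    intro hc'
    exact L.isolated c' c _ hc' (by simpa using hc)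

/-- The closed strands turn by an odd number of full turns. -/
theorem negativeCycles : NegativeCycles L.perm (fun x => Complex.I ^ L.turn x) L.last := by
  intro u k hk hmin hb
  let z : ℕ → ℤ × ℤ := fun i => (L.perm^[i] u : L.site)
  have hperiod : ∀ i, L.perm^[i + (k + 1)] u = L.perm^[i] u := fun i => by
    rw [Function.iterate_add_apply, hk]
  have hmod : ∀ i, L.perm^[i] u = L.perm^[i % (k + 1)] u := fun i =>
    (Function.IsPeriodicPt.iterate_mod_apply (hk : Function.IsPeriodicPt L.perm (k + 1) u) i).symm
  -- A cycle that avoids the last site never uses the artificial junction from `bSite` to `aSite`,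
  -- so all its steps are unit steps.
  have hnb : ∀ i, z i ≠ L.bSite := fun i he => by
    have := hb (i % (k + 1)) (Nat.lt_succ_iff.1 (Nat.mod_lt _ (by omega)))
    rw [← hmod] at this
    exact this (Subtype.ext he)
  have hnext : ∀ i, z (i + 1) = L.next (z i) := fun i => by
    simp only [z, Function.iterate_succ_apply', coe_perm]
  have hiso : ∀ i, (z (i + 1)).1 ≠ (z i).1 → (z (i + 2)).1 = (z (i + 1)).1 := by
    intro i hi
    have h2 := hnext (i + 1)
    rw [show i + 1 + 1 = i + 2 from rfl] at h2
    have hcut : ∀ c, (c, fwdLevel (z (i + 1))) ∉ L.cut := by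
      rcases L.next_cases (hnb i) with ⟨h, h', -⟩ | ⟨h, h', -⟩ | ⟨-, -, -, h', -⟩
      · exact L.not_cut_of_horizontal (by rw [hnext, h']) (by rw [hnext, h']; simp) h
      · exact L.not_cut_of_horizontal (by rw [hnext, h']) (by rw [hnext, h']; simp) h
      · rw [hnext, h'] at hi; exact (hi rfl).elim
    rcases L.next_cases (hnb (i + 1)) with ⟨h, -⟩ | ⟨h, -⟩ | ⟨-, -, -, h', -⟩
    · exact (hcut _ h).elim
    · exact (hcut _ h).elim
    · rw [h2, h']
  have hvert : ∀ i, (z (i + 1)).1 = (z i).1 → (z (i + 1)).2 = fwdRow (z i) := by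
    intro i hi
    rcases L.next_cases (hnb i) with ⟨-, h', -⟩ | ⟨-, h', -⟩ | ⟨-, -, -, h', -⟩
    · rw [hnext, h'] at hi; simp at hi
    · rw [hnext, h'] at hi; simp at hi
    · rw [hnext, h']
  have hhor : ∀ i, (z (i + 1)).1 ≠ (z i).1 → (z (i + 1)).2 = (z i).2 ∧
      ((z (i + 1)).1 = (z i).1 + 1 ∨ (z (i + 1)).1 = (z i).1 - 1) := by
    intro i hi
    rcases L.next_cases (hnb i) with ⟨-, h', -⟩ | ⟨-, h', -⟩ | ⟨-, -, -, h', -⟩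
    · rw [hnext, h']; simp
    · rw [hnext, h']; simp
    · rw [hnext, h'] at hi; exact (hi rfl).elim
  have hturn : ∀ i, L.turn (z i) = eastTurn (z i).1 * ((z (i + 1)).1 - (z i).1) := by
    intro i
    rcases L.next_cases (hnb i) with ⟨-, h', h⟩ | ⟨-, h', h⟩ | ⟨-, -, -, h', h⟩
    · rw [hnext, h', h]; simp
    · rw [hnext, h', h]; simp
    · rw [hnext, h', h]; simp
  have hstep : ∀ i, UnitStep (z i) (z (i + 1)) := by
    intro i
    by_cases hi : (z (i + 1)).1 = (z i).1
    · refine Or.inl ⟨hi, ?_⟩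
      rw [hvert i hi, fwdRow]
      split_ifs <;> simp
    · exact Or.inr (hhor i hi)
  -- Excludes cycles of length 2: a column is travelled in one direction only, and horizontal steps
  -- are isolated.
  have hz2 : z 2 ≠ z 0 := by
    intro he
    by_cases h0 : (z 1).1 = (z 0).1
    · have h1 : (z 2).1 = (z 1).1 := by rw [he, h0]
      have e1 := hvert 0 h0
      have e2 := hvert 1 h1
      rw [zero_add] at e1
      rw [show 1 + 1 = 2 from rfl, he] at e2
      simp only [fwdRow, h0] at e1 e2
      split_ifs at e1 e2 <;> omega
    · exact h0 (by rw [← he]; exact (hiso 0 h0).symm)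
  have hpoly : IsPolygon z (k + 1) := by
    refine ⟨?_, fun i => by simp only [z, hperiod], ?_, hstep⟩
    · by_contra hlt
      have hz0 : z (k + 1) = z 0 := by simp only [z, hk]; rfl
      rcases (show k = 0 ∨ k = 1 by omega) with rfl | rfl
      · have h0 := hstep 0
        simp only [zero_add] at hz0 h0
        rw [hz0, UnitStep] at h0
        omega
      · exact hz2 hz0
    · intro i j hij hj he
      have he' : L.perm^[i] u = L.perm^[j] u := Subtype.ext he
      obtain ⟨d, rfl⟩ := Nat.exists_eq_add_of_lt hij
      rw [add_assoc, Function.iterate_add_apply] at he'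
      exact hmin (d + 1) (by omega) (by omega) ((L.perm.injective.iterate i) he').symm
  -- The cycle makes 4m + 2 half-turns, and `I ^ (4 * m + 2) = -1`.
  obtain ⟨m, hm⟩ := hpoly.sum_turn (fun i => L.turn (z i))
    (fun i hi => by
      by_cases h : (z (i + 1)).1 = (z i).1
      · rw [hvert i h, fwdRow, if_pos hi]; omega
      · exact (hhor i h).1.le)
    (fun i hi => by
      by_cases h : (z (i + 1)).1 = (z i).1
      · rw [hvert i h, fwdRow, if_neg (Int.not_even_iff_odd.2 hi)]; omega
      · exact (hhor i h).1.ge)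
    hiso
    (fun i hi => by simp only [hturn, eastTurn, if_pos hi, one_mul])
    (fun i hi => by simp only [hturn, eastTurn, if_neg (Int.not_even_iff_odd.2 hi)]; ring)
  have hprod : ∀ n, ∏ i ∈ Finset.range n, Complex.I ^ L.turn (z i) =
      Complex.I ^ ∑ i ∈ Finset.range n, L.turn (z i) := by
    intro n
    induction n with
    | zero => simp
    | succ n ih => rw [Finset.prod_range_succ, Finset.sum_range_succ, ih, zpow_add₀ Complex.I_ne_zero]
  change ∏ i ∈ Finset.range (k + 1), Complex.I ^ L.turn (z i) = -1
  rw [hprod, hm, zpow_add₀ Complex.I_ne_zero, zpow_mul]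
  have h4 : Complex.I ^ (4 : ℤ) = 1 := by exact_mod_cast Complex.I_pow_four
  have h2 : Complex.I ^ (2 : ℤ) = -1 := by exact_mod_cast Complex.I_sq
  rw [h4, h2, one_zpow, one_mul]

end Layers

end LayersSection

end QuantumIsing
end

noncomputable section
namespace QuantumIsing

/-! ### Strand systems -/

section Systems

/-- The data that determine the loop representation of a configuration: the available mid-edges,
the points where the vertical lines are interrupted, and the two ends of the interface. -/
structure System where
  strip : Set (ℤ × ℝ)
  cuts : Set (ℤ × ℝ)
  a : ℤ × ℝ
  b : ℤ × ℝ

namespace System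

variable (S : System)

/-- The system seen through a change of heights. -/
def map (ψ : ℝ → ℝ) : System :=
  ⟨lift ψ '' S.strip, lift ψ '' S.cuts, lift ψ S.a, lift ψ S.b⟩

/-- See `DobrushinDomain.Free`. -/
def Free (j : ℤ) (y y' : ℝ) : Prop :=
  ∀ t ∈ Set.Ioo (min y y') (max y y'), (j, t) ∈ S.strip ∧ (j, t) ∉ S.cuts ∧ (j + 1, t) ∉ S.cuts

/-- See `DobrushinDomain.Path`. -/
inductive Strand : ℤ × ℝ → ℤ × ℝ → ℤ → Prop
  | straight {j : ℤ} {y y' : ℝ} :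
      (y' = y ∨ Forward j y y') → S.Free j y y' → Strand (j, y) (j, y') 0
  | east {j : ℤ} {y h : ℝ} {e' : ℤ × ℝ} {w : ℤ} :
      Forward j y h → S.Free j y h → (j + 1, h) ∈ S.cuts →
      Strand (j + 1, h) e' w → Strand (j, y) e' (eastTurn j + w)
  | west {j : ℤ} {y h : ℝ} {e' : ℤ × ℝ} {w : ℤ} :
      Forward j y h → S.Free j y h → (j, h) ∈ S.cuts →
      Strand (j - 1, h) e' w → Strand (j, y) e' (-eastTurn j + w)

/-- See `DobrushinDomain.regular`. -/
def regular : Set (ℤ × ℝ) := {e | e ∈ S.strip ∧ (e.1, e.2) ∉ S.cuts ∧ (e.1 + 1, e.2) ∉ S.cuts}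

/-- See `DobrushinDomain.Reach`. -/
def Reach (e e' : ℤ × ℝ) : Prop := ∃ w, S.Strand e e' w

/-- See `DobrushinDomain.loops`. -/
def loops : Set (Set (ℤ × ℝ)) :=
  {L | ∃ e ∈ S.regular, ∃ e' ∈ S.regular, e ≠ e' ∧ S.Reach e e' ∧ S.Reach e' e ∧
    L = {x ∈ S.regular | S.Reach e x ∧ S.Reach x e}}

/-- See `DobrushinDomain.numLoops`. -/
def numLoops : ℕ := S.loops.ncard

/-- See `DobrushinDomain.interface`. -/
def interface : Set (ℤ × ℝ) := {e ∈ S.strip ∪ {S.a, S.b} | S.Reach S.a e ∧ S.Reach e S.b}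

open Classical in
/-- See `DobrushinDomain.spin`. -/
def spin (e : ℤ × ℝ) : ℂ :=
  if h : e ∈ S.interface then Complex.I ^ h.2.2.choose else 0

section Transport

lemma lift_injective (ψ : ℝ ≃o ℝ) : Function.Injective (lift ψ) := fun p q h => by
  obtain ⟨h1, h2⟩ := Prod.ext_iff.1 h
  exact Prod.ext h1 (ψ.injective h2)

lemma lift_mem_image (ψ : ℝ ≃o ℝ) {A : Set (ℤ × ℝ)} {p : ℤ × ℝ} :
    lift ψ p ∈ lift ψ '' A ↔ p ∈ A := (lift_injective ψ).mem_set_image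

lemma lift_symm_lift (ψ : ℝ ≃o ℝ) (p : ℤ × ℝ) : lift ψ.symm (lift ψ p) = p :=
  Prod.ext rfl (ψ.symm_apply_apply _)

lemma lift_lift_symm (ψ : ℝ ≃o ℝ) (p : ℤ × ℝ) : lift ψ (lift ψ.symm p) = p :=
  Prod.ext rfl (ψ.apply_symm_apply _)

lemma map_symm_map (ψ : ℝ ≃o ℝ) : (S.map ψ).map ψ.symm = S := by
  cases S
  simp [map, ← Set.image_comp, lift_symm_lift]

variable {S}

lemma forward_map (ψ : ℝ ≃o ℝ) {j : ℤ} {y y' : ℝ} :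
    Forward j (ψ y) (ψ y') ↔ Forward j y y' := by simp [Forward]

lemma Free.map (ψ : ℝ ≃o ℝ) {j : ℤ} {y y' : ℝ} (h : S.Free j y y') :
    (S.map ψ).Free j (ψ y) (ψ y') := by
  intro t ht
  obtain ⟨t, rfl⟩ := ψ.surjective t
  rw [← ψ.map_inf, ← ψ.map_sup] at ht
  obtain ⟨h1, h2, h3⟩ := h t ⟨ψ.lt_iff_lt.1 ht.1, ψ.lt_iff_lt.1 ht.2⟩
  exact ⟨(lift_mem_image ψ (p := (j, t))).2 h1, fun h => h2 ((lift_mem_image ψ (p := (j, t))).1 h),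
    fun h => h3 ((lift_mem_image ψ (p := (j + 1, t))).1 h)⟩

lemma Strand.map (ψ : ℝ ≃o ℝ) {e e' : ℤ × ℝ} {w : ℤ} (h : S.Strand e e' w) :
    (S.map ψ).Strand (lift ψ e) (lift ψ e') w := by
  induction h with
  | straight h1 h2 =>
    exact Strand.straight (h1.imp (fun h => by rw [h]) (forward_map ψ).2) (h2.map ψ)
  | east h1 h2 h3 _ ih =>
    exact Strand.east ((forward_map ψ).2 h1) (h2.map ψ) ((lift_mem_image ψ).2 h3) ih
  | west h1 h2 h3 _ ih =>
    exact Strand.west ((forward_map ψ).2 h1) (h2.map ψ) ((lift_mem_image ψ).2 h3) ih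

lemma strand_map_iff (ψ : ℝ ≃o ℝ) {e e' : ℤ × ℝ} {w : ℤ} :
    (S.map ψ).Strand (lift ψ e) (lift ψ e') w ↔ S.Strand e e' w := by
  refine ⟨fun h => ?_, Strand.map ψ⟩
  have := h.map ψ.symm
  rwa [map_symm_map, lift_symm_lift, lift_symm_lift] at this

lemma reach_map_iff (ψ : ℝ ≃o ℝ) {e e' : ℤ × ℝ} :
    (S.map ψ).Reach (lift ψ e) (lift ψ e') ↔ S.Reach e e' :=
  exists_congr fun _ => strand_map_iff ψ

lemma regular_map_iff (ψ : ℝ ≃o ℝ) {e : ℤ × ℝ} : lift ψ e ∈ (S.map ψ).regular ↔ e ∈ S.regular := by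
  have h1 : lift ψ e ∈ (S.map ψ).strip ↔ e ∈ S.strip := lift_mem_image ψ
  have h2 : ∀ c, (c, ψ e.2) ∈ (S.map ψ).cuts ↔ (c, e.2) ∈ S.cuts := fun c =>
    lift_mem_image ψ (p := (c, e.2))
  simp only [regular, Set.mem_ofPred_eq, h1, lift_fst, lift_snd, h2]

lemma loops_map (ψ : ℝ ≃o ℝ) : (S.map ψ).loops = (Set.image (lift ψ)) '' S.loops := by
  have hsurj : Function.Surjective (lift ψ) := fun p => ⟨_, lift_lift_symm ψ p⟩
  have key : ∀ e : ℤ × ℝ,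
      {x ∈ (S.map ψ).regular | (S.map ψ).Reach (lift ψ e) x ∧ (S.map ψ).Reach x (lift ψ e)} =
      lift ψ '' {x ∈ S.regular | S.Reach e x ∧ S.Reach x e} := by
    intro e
    ext x
    obtain ⟨x, rfl⟩ := hsurj x
    simp only [lift_mem_image, Set.mem_ofPred_eq, regular_map_iff, reach_map_iff]
  ext L
  constructor
  · rintro ⟨e, he, e', he', hne, h1, h2, rfl⟩
    obtain ⟨e, rfl⟩ := hsurj e
    obtain ⟨e', rfl⟩ := hsurj e'
    exact ⟨_, ⟨e, (regular_map_iff ψ).1 he, e', (regular_map_iff ψ).1 he', fun h => hne (by rw [h]),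
      (reach_map_iff ψ).1 h1, (reach_map_iff ψ).1 h2, rfl⟩, (key e).symm⟩
  · rintro ⟨_, ⟨e, he, e', he', hne, h1, h2, rfl⟩, rfl⟩
    exact ⟨lift ψ e, (regular_map_iff ψ).2 he, lift ψ e', (regular_map_iff ψ).2 he',
      fun h => hne (lift_injective ψ h), (reach_map_iff ψ).2 h1, (reach_map_iff ψ).2 h2,
      (key e).symm⟩

lemma numLoops_map (ψ : ℝ ≃o ℝ) : (S.map ψ).numLoops = S.numLoops := by
  rw [numLoops, loops_map, Set.ncard_image_of_injective _ (lift_injective ψ).image_injective, numLoops]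

lemma interface_map_iff (ψ : ℝ ≃o ℝ) {e : ℤ × ℝ} :
    lift ψ e ∈ (S.map ψ).interface ↔ e ∈ S.interface := by
  have h1 : lift ψ e ∈ (S.map ψ).strip ↔ e ∈ S.strip := lift_mem_image ψ
  have h2 : ∀ e', lift ψ e = lift ψ e' ↔ e = e' := fun e' => (lift_injective ψ).eq_iff
  have h3 : (S.map ψ).a = lift ψ S.a := rfl
  have h4 : (S.map ψ).b = lift ψ S.b := rfl
  simp only [interface, Set.mem_ofPred_eq, Set.mem_union, Set.mem_insert_iff,
    Set.mem_singleton_iff, h1, h3, h4, h2, reach_map_iff]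

lemma spin_map (ψ : ℝ ≃o ℝ) (e : ℤ × ℝ) : (S.map ψ).spin (lift ψ e) = S.spin e := by
  by_cases h : e ∈ S.interface
  · have h' := (interface_map_iff ψ).2 h
    rw [spin, spin, dif_pos h, dif_pos h']
    have : (fun w => (S.map ψ).Strand (lift ψ e) (S.map ψ).b w) = fun w => S.Strand e S.b w :=
      funext fun w => propext (strand_map_iff ψ)
    congr 1
    simp only [this]
  · rw [spin, spin, dif_neg h, dif_neg fun h' => h ((interface_map_iff ψ).1 h')]

end Transport

end System

end Systems

end QuantumIsing
end

/-! ### Discretization: rows, sites, and runs along the diagram. -/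

noncomputable section
namespace QuantumIsing

section Discretization

/-- The vertical direction of travel in a column. -/
def dir (j : ℤ) : ℤ := if Even j then -1 else 1

lemma dir_cases (j : ℤ) : (Even j ∧ dir j = -1) ∨ (¬Even j ∧ dir j = 1) := by
  by_cases h : Even j <;> simp [dir, h]

lemma dir_add_one (j : ℤ) : dir (j + 1) = -dir j := by
  by_cases h : Even j <;> simp [dir, h]

lemma dir_sub_one (j : ℤ) : dir (j - 1) = -dir j := by
  by_cases h : Even j <;> simp [dir, h]

lemma dir_mul_dir (j : ℤ) : dir j * dir j = 1 := by
  rcases dir_cases j with ⟨-, h⟩ | ⟨-, h⟩ <;> rw [h] <;> norm_num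

lemma forward_iff {j : ℤ} {y y' : ℝ} : Forward j y y' ↔ dir j * y < dir j * y' := by
  by_cases h : Even j <;> simp [dir, h, Forward]

lemma fwdRow_eq (j r : ℤ) : fwdRow (j, r) = r + dir j := by
  by_cases h : Even j <;> simp [dir, h, fwdRow, sub_eq_add_neg]

lemma fwdLevel_eq (j r : ℤ) : (fwdLevel (j, r) : ℝ) + 1 / 2 = r + dir j / 2 := by
  by_cases h : Even j
  · simp [dir, h, fwdLevel]; ring
  · simp [dir, h, fwdLevel]

/-- The row nearest to a height, the midpoints being rounded in the direction of travel. -/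
def row (j : ℤ) (y : ℝ) : ℤ := dir j * ⌊(dir j : ℝ) * y + 1 / 2⌋

lemma row_iff {j r : ℤ} {y : ℝ} :
    row j y = r ↔ dir j * (r : ℝ) - 1 / 2 ≤ dir j * y ∧ dir j * y < dir j * r + 1 / 2 := by
  have h : row j y = r ↔ ⌊(dir j : ℝ) * y + 1 / 2⌋ = dir j * r := by
    have := dir_mul_dir j
    constructor
    · intro h; rw [← h, row, ← mul_assoc, this, one_mul]
    · intro h; rw [row, h, ← mul_assoc, this, one_mul]
  rw [h, Int.floor_eq_iff]
  push_cast
  constructor <;> rintro ⟨h1, h2⟩ <;> constructor <;> linarith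

lemma row_spec (j : ℤ) (y : ℝ) :
    dir j * (row j y : ℝ) - 1 / 2 ≤ dir j * y ∧ dir j * y < dir j * row j y + 1 / 2 :=
  row_iff.1 rfl

lemma row_intCast (j r : ℤ) : row j r = r := row_iff.2 ⟨by linarith, by linarith⟩

/-- The point of the mid-edge lattice at a site. -/
def toPoint (x : ℤ × ℤ) : ℤ × ℝ := (x.1, x.2)

/-- The site nearest to a point, see `row`. -/
def toSite (e : ℤ × ℝ) : ℤ × ℤ := (e.1, row e.1 e.2)

@[simp] lemma toSite_toPoint (x : ℤ × ℤ) : toSite (toPoint x) = x :=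
  Prod.ext rfl (row_intCast _ _)

namespace System

variable (S : System) (L : Layers)

/-- The strand system `S` has all its events at half-integer heights, and is described by the
diagram `L`. -/
structure Discrete : Prop where
  strip_iff : ∀ (j r : ℤ) (t : ℝ), |t - r| < 1 / 2 → ((j, t) ∈ S.strip ↔ (j, r) ∈ L.site)
  cut_iff : ∀ (c : ℤ) (t : ℝ), (c, t) ∈ S.cuts ↔ ∃ r : ℤ, t = r + 1 / 2 ∧ (c, r) ∈ L.cut
  through : ∀ j r : ℤ, (j, r) ∉ L.cut → (j + 1, r) ∉ L.cut → (j, r) ≠ L.a → (j, r) ≠ L.b →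
    (j, r) ∈ L.site → (j, (r : ℝ) + 1 / 2) ∈ S.strip
  near : ∀ j r : ℤ, (j, (r : ℝ) + 1 / 2) ∈ S.strip → (j, r) ∈ L.site ∧ (j, r + 1) ∈ L.site
  a_eq : S.a = (L.a.1, (L.a.2 : ℝ) + 1 / 2)
  b_eq : S.b = (L.b.1, (L.b.2 : ℝ) + 1 / 2)
  a_not_mem : S.a ∉ S.strip
  b_not_mem : S.b ∉ S.strip

/-- A point is inside the domain and away from the cuts. -/
def Clear (j : ℤ) (t : ℝ) : Prop := (j, t) ∈ S.strip ∧ (j, t) ∉ S.cuts ∧ (j + 1, t) ∉ S.cuts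

lemma regular_iff {S : System} {e : ℤ × ℝ} : e ∈ S.regular ↔ S.Clear e.1 e.2 := Iff.rfl

lemma free_iff {S : System} {j : ℤ} {y y' : ℝ} (h : Forward j y y') :
    S.Free j y y' ↔ ∀ t : ℝ, dir j * y < dir j * t → dir j * t < dir j * y' → S.Clear j t := by
  rw [forward_iff] at h
  rw [Free]
  rcases dir_cases j with ⟨-, hd⟩ | ⟨-, hd⟩
  · simp only [hd, Int.cast_neg, Int.cast_one, neg_mul, one_mul, neg_lt_neg_iff] at h ⊢
    rw [min_eq_right h.le, max_eq_left h.le]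
    exact ⟨fun H t h1 h2 => H t ⟨h2, h1⟩, fun H t ht => H t ht.2 ht.1⟩
  · simp only [hd, Int.cast_one, one_mul] at h ⊢
    rw [min_eq_left h.le, max_eq_right h.le]
    exact ⟨fun H t h1 h2 => H t ⟨h1, h2⟩, fun H t ht => H t ht.1 ht.2⟩

/-- Strands can be concatenated away from the cuts. -/
lemma Strand.trans {S : System} {e e' e'' : ℤ × ℝ} {w w' : ℤ} (h : S.Strand e e' w)
    (hr : e' ∈ S.regular) (h' : S.Strand e' e'' w') : S.Strand e e'' (w + w') := by
  induction h with
  | @east j y h e' w h1 h2 h3 _ ih => rw [add_assoc]; exact Strand.east h1 h2 h3 (ih hr h')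
  | @west j y h e' w h1 h2 h3 _ ih => rw [add_assoc]; exact Strand.west h1 h2 h3 (ih hr h')
  | @straight j y y' h1 h2 =>
    rw [zero_add]
    rcases h1 with rfl | h1
    · exact h'
    -- The two free pieces share only the point `(j, y')`, which is clear because it is regular.
    have glue : ∀ y'', Forward j y' y'' → S.Free j y' y'' → Forward j y y'' ∧ S.Free j y y'' := by
      intro y'' h3 h4
      have h5 : Forward j y y'' := by rw [forward_iff] at *; linarith
      refine ⟨h5, (free_iff h5).2 fun t ht ht' => ?_⟩
      rcases lt_trichotomy ((dir j : ℝ) * t) (dir j * y') with hlt | heq | hlt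
      · exact (free_iff h1).1 h2 t ht hlt
      · have hd : (dir j : ℝ) ≠ 0 := by
          rcases dir_cases j with ⟨-, hd⟩ | ⟨-, hd⟩ <;> rw [hd] <;> norm_num
        rw [mul_left_cancel₀ hd heq]; exact hr
      · exact (free_iff h3).1 h4 t hlt ht'
    cases h' with
    | straight h3 h4 =>
      rcases h3 with rfl | h3
      · exact Strand.straight (Or.inr h1) h2
      · exact Strand.straight (Or.inr (glue _ h3 h4).1) (glue _ h3 h4).2
    | east h3 h4 h5 h6 => exact Strand.east (glue _ h3 h4).1 (glue _ h3 h4).2 h5 h6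
    | west h3 h4 h5 h6 => exact Strand.west (glue _ h3 h4).1 (glue _ h3 h4).2 h5 h6

end System

namespace Layers

variable (L : Layers)

/-- One goes from a site to another one along the strands, without using the junction between the
two ends of the interface, with a given rotation. -/
inductive Run : L.site → L.site → ℤ → Prop
  | refl (x : L.site) : Run x x 0
  | step {x y : L.site} {w : ℤ} : x ≠ L.last → Run (L.perm x) y w → Run x y (L.turn x + w)

variable {L}

lemma Run.trans {x y z : L.site} {w w' : ℤ} (h : L.Run x y w) (h' : L.Run y z w') :
    L.Run x z (w + w') := by
  induction h with
  | refl => rwa [zero_add]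
  | step h1 _ ih => rw [add_assoc]; exact Run.step h1 (ih h')

lemma Run.sameCycle {x y : L.site} {w : ℤ} (h : L.Run x y w) : L.perm.SameCycle x y := by
  induction h with
  | refl => exact Equiv.Perm.SameCycle.refl _ _
  | step _ _ ih => exact Equiv.Perm.sameCycle_apply_left.1 ih

/-- A run is deterministic and cannot continue past the last site. This makes the winding up to the
end of the interface independent of the chosen strand. -/
lemma Run.unique {x : L.site} {w w' : ℤ} (h : L.Run x L.last w) (h' : L.Run x L.last w') :
    w = w' := by
  generalize hy : L.last = y at h
  induction h generalizing w' with
  | refl =>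
    subst hy
    cases h' with
    | refl => rfl
    | step h1 _ => exact (h1 rfl).elim
  | step h1 _ ih =>
    subst hy
    cases h' with
    | refl => exact (h1 rfl).elim
    | step _ h2 => rw [ih h2 rfl]

lemma run_of_iterate (x : L.site) (n : ℕ) (h : ∀ i < n, L.perm^[i] x ≠ L.last) :
    ∃ w, L.Run x (L.perm^[n] x) w := by
  induction n generalizing x with
  | zero => exact ⟨0, Run.refl x⟩
  | succ n ih =>
    obtain ⟨w, hw⟩ := ih (L.perm x) fun i hi => h (i + 1) (by omega)
    exact ⟨_, Run.step (h 0 (by omega)) hw⟩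

lemma exists_run_of_not {x y : L.site} (h : L.perm.SameCycle x y)
    (hx : ¬L.perm.SameCycle x L.last) : ∃ w, L.Run x y w := by
  obtain ⟨n, rfl⟩ := SameCycle.exists_iterate h
  exact run_of_iterate x n fun i _ hi => hx (hi ▸ sameCycle_iterate L.perm x i)

lemma exists_run_last {x : L.site} (h : L.perm.SameCycle x L.last) : ∃ w, L.Run x L.last w := by
  obtain ⟨k, hk, hk'⟩ := exists_first L.perm (· = L.last) (SameCycle.exists_iterate h)
  have := run_of_iterate x k hk'
  rwa [hk] at this

/-- The first site is the successor of the last one. If the orbit of the first site met the last one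
before its first visit to `x`, it would already be periodic and would have visited `x` earlier. -/
lemma exists_run_first {x : L.site} (h : L.perm.SameCycle x L.last) : ∃ w, L.Run L.first x w := by
  have h1 : L.perm.SameCycle L.first x := by
    rw [← perm_last, Equiv.Perm.sameCycle_apply_left]; exact h.symm
  obtain ⟨k, hk, hk'⟩ := exists_first L.perm (· = x) (SameCycle.exists_iterate h1)
  have := run_of_iterate L.first k fun i hi he => ?_
  · rwa [hk] at this
  · have hper : Function.IsPeriodicPt L.perm (i + 1) L.first := by
      change L.perm^[i + 1] L.first = L.first
      rw [Function.iterate_succ_apply', he, perm_last]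
    have h2 := hper.iterate_mod_apply k
    have h3 : k % (i + 1) < i + 1 := Nat.mod_lt _ (by omega)
    exact hk' (k % (i + 1)) (by omega) (h2.trans hk)

end Layers

namespace System

variable {S : System} {L : Layers}

namespace Discrete

lemma cut_level_iff (D : S.Discrete L) {c l : ℤ} : (c, (l : ℝ) + 1 / 2) ∈ S.cuts ↔ (c, l) ∈ L.cut := by
  rw [D.cut_iff]
  constructor
  · rintro ⟨r, hr, h⟩
    have : l = r := by exact_mod_cast (add_right_cancel hr : (l : ℝ) = r)
    rwa [this]
  · exact fun h => ⟨l, rfl, h⟩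

lemma not_cut (D : S.Discrete L) {c r : ℤ} {t : ℝ} (h : |t - r| < 1 / 2) : (c, t) ∉ S.cuts := by
  rw [D.cut_iff]
  rintro ⟨l, rfl, -⟩
  rw [abs_lt] at h
  have h1 : (l : ℝ) < r := by linarith
  have h2 : (r : ℝ) < l + 1 := by linarith
  have h1' : l < r := by exact_mod_cast h1
  have h2' : r < l + 1 := by exact_mod_cast h2
  omega

lemma clear_of_site (D : S.Discrete L) {j r : ℤ} {t : ℝ} (h : |t - r| < 1 / 2) (hs : (j, r) ∈ L.site) :
    S.Clear j t := ⟨(D.strip_iff j r t h).2 hs, D.not_cut h, D.not_cut h⟩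

lemma regular_toPoint (D : S.Discrete L) (x : L.site) : toPoint x ∈ S.regular :=
  D.clear_of_site (r := x.1.2) (by simp) x.2

lemma abs_lt_of_dir {j r : ℤ} {t : ℝ} (h : dir j * (r : ℝ) - 1 / 2 < dir j * t)
    (h' : dir j * t < dir j * r + 1 / 2) : |t - r| < 1 / 2 := by
  rw [abs_lt]
  rcases dir_cases j with ⟨-, hd⟩ | ⟨-, hd⟩ <;> rw [hd] at h h' <;> push_cast at h h' <;>
    constructor <;> linarith

/-- A clear event is crossed vertically. -/
lemma next_of_clear (D : S.Discrete L) {x : L.site} (h : S.Clear x.1.1 (x.1.2 + dir x.1.1 / 2)) :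
    x ≠ L.last ∧ L.next x = (x.1.1, x.1.2 + dir x.1.1) ∧ L.turn x = 0 := by
  obtain ⟨⟨j, r⟩, hx⟩ := x
  simp only at h ⊢
  rw [← fwdLevel_eq] at h
  obtain ⟨h1, h2, h3⟩ := h
  have hb : ((j, r) : ℤ × ℤ) ≠ L.bSite := by
    intro he
    have hl : fwdLevel (j, r) = L.b.2 ∧ j = L.b.1 := by
      rw [he]
      refine ⟨?_, by rw [Prod.ext_iff] at he; exact he.1⟩
      by_cases hb : Even L.b.1 <;> simp [fwdLevel, Layers.bSite, hb]
    rw [hl.1, hl.2, ← D.b_eq] at h1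
    exact D.b_not_mem h1
  refine ⟨fun he => hb (congrArg Subtype.val he), ?_⟩
  rcases L.next_cases hb with ⟨h, -⟩ | ⟨h, -⟩ | ⟨-, -, -, h4, h5⟩
  · exact (h3 (D.cut_level_iff.2 h)).elim
  · exact (h2 (D.cut_level_iff.2 h)).elim
  · rw [h4, ← fwdRow_eq]; exact ⟨rfl, h5⟩

/-- A vertical run through clear events. -/
lemma run_of_clear (D : S.Discrete L) {j r r' : ℤ} (hs : (j, r) ∈ L.site) (hr : dir j * r ≤ dir j * r')
    (h : ∀ t : ℝ, dir j * (r : ℝ) < dir j * t → dir j * t ≤ dir j * r' - 1 / 2 → S.Clear j t) :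
    ∃ hs' : (j, r') ∈ L.site, L.Run ⟨(j, r), hs⟩ ⟨(j, r'), hs'⟩ 0 := by
  obtain ⟨n, hn⟩ := Int.eq_ofNat_of_zero_le (sub_nonneg.2 hr)
  have hr' : r' = r + dir j * n := by
    have := dir_mul_dir j
    linear_combination dir j * hn - (r' - r) * this
  clear hn hr
  subst hr'
  induction n generalizing r with
  | zero => exact ⟨by simpa using hs, by simpa using Layers.Run.refl _⟩
  | succ n ih =>
    have hdd : (dir j : ℝ) * dir j = 1 := by exact_mod_cast dir_mul_dir j
    have hn0 : (0 : ℝ) ≤ n := n.cast_nonneg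
    obtain ⟨h1, h2, h3⟩ := D.next_of_clear (x := ⟨(j, r), hs⟩) (h _ (by
      simp only [mul_add, ← mul_div_assoc, hdd]; linarith) (by
      push_cast
      simp only [mul_add, ← mul_div_assoc, ← mul_assoc, hdd]; linarith))
    simp only at h2 h3
    have hs1 : (j, r + dir j) ∈ L.site := h2 ▸ L.next_mem hs
    have he : r + dir j * (n + 1 : ℕ) = r + dir j + dir j * n := by push_cast; ring
    obtain ⟨hs', hrun⟩ := ih hs1 (fun t ht ht' => h t (by
      push_cast at ht
      simp only [mul_add, hdd] at ht; linarith) (by rw [he]; exact ht'))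
    have hp : L.perm ⟨(j, r), hs⟩ = ⟨(j, r + dir j), hs1⟩ := Subtype.ext h2
    rw [← hp] at hrun
    have := Layers.Run.step h1 hrun
    simp only [h3, add_zero] at this
    refine ⟨he ▸ hs', ?_⟩
    simp only [he]
    exact this

/-- Midpoints are rounded forwards, so a point slightly after `y` has the same row as `y` and lies
in the free piece, hence in the strip. -/
lemma toSite_mem_of_free (D : S.Discrete L) {j : ℤ} {y h : ℝ} (hf : Forward j y h) (hfree : S.Free j y h) :
    toSite (j, y) ∈ L.site := by
  have hfree' := (free_iff hf).1 hfree
  rw [forward_iff] at hf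
  obtain ⟨h1, h2⟩ := row_spec j y
  obtain ⟨u, hu1, hu2⟩ := exists_between (lt_min hf h2)
  obtain ⟨hu2, hu3⟩ := lt_min_iff.1 hu2
  have hdd : (dir j : ℝ) * dir j = 1 := by exact_mod_cast dir_mul_dir j
  have hu : (dir j : ℝ) * (dir j * u) = u := by rw [← mul_assoc, hdd, one_mul]
  have := hfree' (dir j * u) (by rwa [hu]) (by rwa [hu])
  exact (D.strip_iff j _ _ (abs_lt_of_dir (by rw [hu]; linarith) (by rwa [hu]))).1 this.1

lemma toSite_mem_of_regular (D : S.Discrete L) {e : ℤ × ℝ} (he : e ∈ S.regular) : toSite e ∈ L.site := by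
  obtain ⟨j, y⟩ := e
  obtain ⟨h1, h2⟩ := row_spec j y
  rcases h1.eq_or_lt with h1 | h1
  · have hd := dir_cases j
    have hs := he.1
    rcases hd with ⟨-, hd⟩ | ⟨-, hd⟩
    · rw [hd] at h1; push_cast at h1
      rw [show y = row j y + 1 / 2 by linarith] at hs
      exact (D.near _ _ hs).1
    · rw [hd] at h1; push_cast at h1
      rw [show y = ((row j y - 1 : ℤ) : ℝ) + 1 / 2 by push_cast; linarith] at hs
      simpa [toSite] using (D.near _ _ hs).2
  · exact (D.strip_iff j _ _ (abs_lt_of_dir h1 h2)).1 he.1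

/-- The site of a regular point. -/
def siteOf (D : S.Discrete L) (e : S.regular) : L.site :=
  ⟨toSite e, D.toSite_mem_of_regular e.2⟩

end Discrete

end System

end Discretization

end QuantumIsing
end

/-! ### From strands to runs of the diagram. -/

noncomputable section
namespace QuantumIsing

section Discretization

namespace System

variable {S : System} {L : Layers}

namespace Discrete

lemma cut_half (D : S.Discrete L) {c : ℤ} {t : ℝ} (h : (c, t) ∈ S.cuts) (j : ℤ) :
    ∃ r : ℤ, t = r + dir j / 2 ∧ (c, fwdLevel (j, r)) ∈ L.cut := by
  obtain ⟨l, rfl, hl⟩ := (D.cut_iff _ _).1 h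
  rcases dir_cases j with ⟨he, hd⟩ | ⟨he, hd⟩
  · refine ⟨l + 1, by rw [hd]; push_cast; ring, by simpa [fwdLevel, he] using hl⟩
  · exact ⟨l, by rw [hd]; simp, by simpa [fwdLevel, he] using hl⟩

/-- The run along a strand up to its first cut. -/
lemma run_to_cut (D : S.Discrete L) {j c : ℤ} {y h : ℝ} (hf : Forward j y h)
    (hfree : S.Free j y h) (hc : (c, h) ∈ S.cuts) : ∃ (r : ℤ) (hs : toSite (j, y) ∈ L.site)
      (hs' : (j, r) ∈ L.site), L.Run ⟨toSite (j, y), hs⟩ ⟨(j, r), hs'⟩ 0 ∧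
      (c, fwdLevel (j, r)) ∈ L.cut ∧ h = r + dir j / 2 := by
  obtain ⟨r, rfl, hr⟩ := D.cut_half hc j
  have hs := D.toSite_mem_of_free hf hfree
  have hfree' := (free_iff hf).1 hfree
  rw [forward_iff] at hf
  obtain ⟨h1, h2⟩ := row_spec j y
  have hdd : (dir j : ℝ) * dir j = 1 := by exact_mod_cast dir_mul_dir j
  have hh : (dir j : ℝ) * (r + dir j / 2) = dir j * r + 1 / 2 := by
    rw [mul_add, ← mul_div_assoc, hdd]
  rw [hh] at hf
  have hle : dir j * row j y ≤ dir j * r := by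
    have : ((dir j * row j y : ℤ) : ℝ) < (dir j * r : ℤ) + 1 := by push_cast; linarith
    have : dir j * row j y < dir j * r + 1 := by exact_mod_cast this
    omega
  obtain ⟨hs', hrun⟩ := D.run_of_clear (r' := r) hs hle fun t (ht : (dir j : ℝ) * row j y < dir j * t) ht' =>
    if hy : (dir j : ℝ) * y < dir j * t then hfree' t hy (by rw [hh]; linarith)
    else D.clear_of_site (j := j) (r := row j y) (abs_lt_of_dir (j := j) (by linarith) (by linarith)) hs
  exact ⟨r, hs, hs', hrun, hr, rfl⟩

lemma ne_b_of_cut (D : S.Discrete L) {j c : ℤ} {h : ℝ} (hc : (c, h) ∈ S.cuts)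
    (hj : j = c ∨ j = c - 1) : (j, h) ≠ S.b := by
  intro he
  rw [D.b_eq, Prod.mk.injEq] at he
  rw [he.2, D.cut_level_iff] at hc
  rcases hj with rfl | rfl
  · exact L.b_cut.1 (by rw [← he.1]; exact hc)
  · exact L.b_cut.2 (by rw [← he.1]; simpa using hc)

/-- The half-turn at a cut. -/
lemma step_of_cut {j r d : ℤ} {h : ℝ} (hs : (j, r) ∈ L.site)
    (hd : (d = 1 ∧ (j + 1, fwdLevel (j, r)) ∈ L.cut) ∨ (d = -1 ∧ (j, fwdLevel (j, r)) ∈ L.cut))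
    (hh : h = r + dir j / 2) : ∃ hs' : toSite (j + d, h) ∈ L.site,
      (⟨(j, r), hs⟩ : L.site) ≠ L.last ∧ L.perm ⟨(j, r), hs⟩ = ⟨toSite (j + d, h), hs'⟩ ∧
      L.turn (j, r) = d * eastTurn j := by
  have hdir : dir (j + d) = -dir j := by
    rcases hd with ⟨rfl, -⟩ | ⟨rfl, -⟩
    · exact dir_add_one j
    · exact dir_sub_one j
  have hdd : (dir j : ℝ) * dir j = 1 := by exact_mod_cast dir_mul_dir j
  -- The height `h` is the midpoint ahead of row `r` in column `j`. The neighbouring column is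
  -- travelled in the opposite direction, so there `h` is rounded back to `r`.
  have hrow : row (j + d) h = r := by
    rw [row_iff, hdir, hh]
    push_cast
    constructor <;> nlinarith
  have hsite : toSite (j + d, h) = (j + d, r) := Prod.ext rfl hrow
  have hb : ((j, r) : ℤ × ℤ) ≠ L.bSite := by
    intro he
    have hcut : (j + 1, fwdLevel (j, r)) ∈ L.cut ∨ (j, fwdLevel (j, r)) ∈ L.cut :=
      hd.imp And.right And.right
    have hl : fwdLevel (j, r) = L.b.2 ∧ j = L.b.1 := by
      rw [he]
      refine ⟨?_, by rw [Prod.ext_iff] at he; exact he.1⟩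
      by_cases hb : Even L.b.1 <;> simp [fwdLevel, Layers.bSite, hb]
    rw [hl.1, hl.2] at hcut
    exact hcut.elim L.b_cut.2 L.b_cut.1
  have hnext : L.next (j, r) = (j + d, r) ∧ L.turn (j, r) = d * eastTurn j := by
    rcases hd with ⟨rfl, hc⟩ | ⟨rfl, hc⟩
    · simp [Layers.next, Layers.turn, hc]
    · have hc' : (j + 1, fwdLevel (j, r)) ∉ L.cut := L.nonadj _ _ hc
      simp [Layers.next, Layers.turn, hc, hc', sub_eq_add_neg]
  refine ⟨by rw [hsite, ← hnext.1]; exact L.next_mem hs, fun he => hb (congrArg Subtype.val he),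
    Subtype.ext ?_, hnext.2⟩
  exact hnext.1.trans hsite.symm

/-- A strand between regular points is a nonempty run between their sites, unless it is a vertical
segment without event. -/
lemma run_of_strand (D : S.Discrete L) {e e' : ℤ × ℝ} {w : ℤ} (h : S.Strand e e' w)
    (he' : e' ∈ S.regular) : ∃ hs : toSite e ∈ L.site,
      (∃ w', (⟨toSite e, hs⟩ : L.site) ≠ L.last ∧ w = L.turn (toSite e) + w' ∧
        L.Run (L.perm ⟨toSite e, hs⟩) (D.siteOf ⟨e', he'⟩) w') ∨
      (w = 0 ∧ toSite e = toSite e' ∧ (e' = e ∨ Forward e.1 e.2 e'.2)) := by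
  -- A run that is known to continue after its end has a first step, at its own starting point.
  have pos : ∀ {x y z : L.site} {w w' : ℤ}, L.Run x y w → y ≠ L.last → L.Run (L.perm y) z w' →
      ∃ w'', x ≠ L.last ∧ w + (L.turn y + w') = L.turn x + w'' ∧ L.Run (L.perm x) z w'' := by
    intro x y z w w' h1 h2 h3
    cases h1 with
    | refl => exact ⟨w', h2, by ring, h3⟩
    | step h4 h5 => exact ⟨_, h4, by ring, h5.trans (Layers.Run.step h2 h3)⟩
  have turnCase : ∀ {j d : ℤ} {y h : ℝ} {e' : ℤ × ℝ} {w : ℤ} (he' : e' ∈ S.regular),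
      (d = 1 ∧ (j + 1, h) ∈ S.cuts) ∨ (d = -1 ∧ (j, h) ∈ S.cuts) →
      Forward j y h → S.Free j y h →
      (∃ hs : toSite (j + d, h) ∈ L.site,
      (∃ w', (⟨toSite (j + d, h), hs⟩ : L.site) ≠ L.last ∧ w = L.turn (toSite (j + d, h)) + w' ∧
        L.Run (L.perm ⟨toSite (j + d, h), hs⟩) (D.siteOf ⟨e', he'⟩) w') ∨
      (w = 0 ∧ toSite (j + d, h) = toSite e' ∧
        (e' = (j + d, h) ∨ Forward (j + d) h e'.2))) →
      ∃ hs : toSite (j, y) ∈ L.site,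
      (∃ w', (⟨toSite (j, y), hs⟩ : L.site) ≠ L.last ∧ d * eastTurn j + w = L.turn (toSite (j, y)) + w' ∧
        L.Run (L.perm ⟨toSite (j, y), hs⟩) (D.siteOf ⟨e', he'⟩) w') := by
    intro j d y h e' w he' hd h1 h2 ih
    obtain ⟨r, hs, hs', hrun, hcut, hh⟩ : ∃ (r : ℤ) (hs : toSite (j, y) ∈ L.site)
      (hs' : (j, r) ∈ L.site), L.Run ⟨toSite (j, y), hs⟩ ⟨(j, r), hs'⟩ 0 ∧
      ((d = 1 ∧ (j + 1, fwdLevel (j, r)) ∈ L.cut) ∨ (d = -1 ∧ (j, fwdLevel (j, r)) ∈ L.cut)) ∧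
      h = r + dir j / 2 := by
      rcases hd with ⟨rfl, hc⟩ | ⟨rfl, hc⟩
      · obtain ⟨r, hs, hs', hrun, hcut, hh⟩ := D.run_to_cut h1 h2 hc
        exact ⟨r, hs, hs', hrun, Or.inl ⟨rfl, hcut⟩, hh⟩
      · obtain ⟨r, hs, hs', hrun, hcut, hh⟩ := D.run_to_cut h1 h2 hc
        exact ⟨r, hs, hs', hrun, Or.inr ⟨rfl, hcut⟩, hh⟩
    obtain ⟨hs'', hne, hperm, hturn⟩ := step_of_cut hs' hcut hh
    have hR : L.Run (L.perm ⟨(j, r), hs'⟩) (D.siteOf ⟨e', he'⟩) w := by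
      rw [hperm]
      obtain ⟨hs3, ⟨w', h3, rfl, h4⟩ | ⟨rfl, h3, -⟩⟩ := ih
      · exact Layers.Run.step h3 h4
      · have : (⟨toSite (j + d, h), hs''⟩ : L.site) = D.siteOf ⟨e', he'⟩ := Subtype.ext h3
        rw [this]
        exact Layers.Run.refl _
    obtain ⟨w'', h3, h4, h5⟩ := pos hrun hne hR
    refine ⟨hs, w'', h3, ?_, h5⟩
    rw [← h4, ← hturn]
    ring
  induction h with
  | @straight j y y' h1 h2 =>
    rcases h1 with rfl | h1
    · exact ⟨D.toSite_mem_of_regular he', Or.inr ⟨rfl, rfl, Or.inl rfl⟩⟩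
    have hs := D.toSite_mem_of_free h1 h2
    refine ⟨hs, ?_⟩
    have hfree' := (free_iff h1).1 h2
    have h1' := forward_iff.1 h1
    obtain ⟨a1, a2⟩ := row_spec j y
    obtain ⟨b1, b2⟩ := row_spec j y'
    have hle : dir j * row j y ≤ dir j * row j y' := by
      have : ((dir j * row j y : ℤ) : ℝ) < (dir j * row j y' : ℤ) + 1 := by push_cast; linarith
      have : dir j * row j y < dir j * row j y' + 1 := by exact_mod_cast this
      omega
    have hd0 : (dir j : ℝ) ≠ 0 := by
      rcases dir_cases j with ⟨-, hd⟩ | ⟨-, hd⟩ <;> rw [hd] <;> norm_num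
    obtain ⟨hs', hrun⟩ := D.run_of_clear (r' := row j y') hs hle fun t (ht : (dir j : ℝ) * row j y < dir j * t) ht' =>
      if hy : (dir j : ℝ) * y < dir j * t then
        if hy' : (dir j : ℝ) * t < dir j * y' then hfree' t hy hy'
        else by
          have : t = y' := mul_left_cancel₀ hd0 (by linarith)
          rw [this]; exact he'
      else D.clear_of_site (j := j) (r := row j y) (abs_lt_of_dir (j := j) (by linarith) (by linarith)) hs
    rcases hle.eq_or_lt with heq | hlt
    · right
      have hd0' : dir j ≠ 0 := by exact_mod_cast hd0
      exact ⟨rfl, Prod.ext rfl (mul_left_cancel₀ hd0' heq), Or.inr h1⟩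
    · left
      have hne : (⟨toSite (j, y), hs⟩ : L.site) ≠ ⟨(j, row j y'), hs'⟩ := by
        intro he
        have := (Prod.ext_iff.1 (congrArg Subtype.val he)).2
        simp only [toSite] at this
        rw [this] at hlt
        exact lt_irrefl _ hlt
      generalize hx : (⟨(j, row j y), hs⟩ : L.site) = x at hrun
      generalize hy : (⟨(j, row j y'), hs'⟩ : L.site) = y0 at hrun
      generalize hw : (0 : ℤ) = w0 at hrun
      cases hrun with
      | refl => exact (hne (hx.trans hy.symm)).elim
      | @step _ _ w' h3 h4 =>
        subst hx
        subst hy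
        exact ⟨w', h3, rfl, h4⟩
  | east h1 h2 h3 _ ih =>
    obtain ⟨hs, h⟩ := turnCase he' (Or.inl ⟨rfl, h3⟩) h1 h2 (ih he')
    exact ⟨hs, Or.inl (by simpa using h)⟩
  | west h1 h2 h3 _ ih =>
    obtain ⟨hs, h⟩ := turnCase he' (Or.inr ⟨rfl, h3⟩) h1 h2 (by simpa [sub_eq_add_neg] using ih he')
    exact ⟨hs, Or.inl (by simpa using h)⟩

/-- A strand up to the end of the interface is a run up to its last site. -/
lemma run_last_of_strand (D : S.Discrete L) {e : ℤ × ℝ} {w : ℤ} (h : S.Strand e S.b w)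
    (he : e ≠ S.b) : ∃ hs : toSite e ∈ L.site, L.Run ⟨toSite e, hs⟩ L.last w := by
  generalize hb : S.b = b at h
  have turnCase : ∀ {j d : ℤ} {y h : ℝ} {w : ℤ},
      (d = 1 ∧ (j + 1, h) ∈ S.cuts) ∨ (d = -1 ∧ (j, h) ∈ S.cuts) →
      Forward j y h → S.Free j y h →
      ((j + d, h) ≠ S.b → ∃ hs : toSite (j + d, h) ∈ L.site,
        L.Run ⟨toSite (j + d, h), hs⟩ L.last w) →
      ∃ hs : toSite (j, y) ∈ L.site, L.Run ⟨toSite (j, y), hs⟩ L.last (d * eastTurn j + w) := by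
    intro j d y h w hd h1 h2 ih
    obtain ⟨r, hs, hs', hrun, hcut, hh, hb'⟩ : ∃ (r : ℤ) (hs : toSite (j, y) ∈ L.site)
      (hs' : (j, r) ∈ L.site), L.Run ⟨toSite (j, y), hs⟩ ⟨(j, r), hs'⟩ 0 ∧
      ((d = 1 ∧ (j + 1, fwdLevel (j, r)) ∈ L.cut) ∨ (d = -1 ∧ (j, fwdLevel (j, r)) ∈ L.cut)) ∧
      h = r + dir j / 2 ∧ (j + d, h) ≠ S.b := by
      rcases hd with ⟨rfl, hc⟩ | ⟨rfl, hc⟩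
      · obtain ⟨r, hs, hs', hrun, hcut, hh⟩ := D.run_to_cut h1 h2 hc
        exact ⟨r, hs, hs', hrun, Or.inl ⟨rfl, hcut⟩, hh, D.ne_b_of_cut hc (Or.inl rfl)⟩
      · obtain ⟨r, hs, hs', hrun, hcut, hh⟩ := D.run_to_cut h1 h2 hc
        exact ⟨r, hs, hs', hrun, Or.inr ⟨rfl, hcut⟩, hh, D.ne_b_of_cut hc (Or.inr rfl)⟩
    obtain ⟨hs'', hne, hperm, hturn⟩ := step_of_cut hs' hcut hh
    obtain ⟨_, hR⟩ := ih hb'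
    rw [← hperm] at hR
    have := hrun.trans (Layers.Run.step hne hR)
    rw [zero_add] at this
    refine ⟨hs, ?_⟩
    rw [← hturn]
    exact this
  induction h with
  | @straight j y y' h1 h2 =>
    rcases h1 with rfl | h1
    · exact (he hb.symm).elim
    have hs := D.toSite_mem_of_free h1 h2
    refine ⟨hs, ?_⟩
    have hfree' := (free_iff h1).1 h2
    have h1' := forward_iff.1 h1
    obtain ⟨a1, a2⟩ := row_spec j y
    rw [D.b_eq, Prod.mk.injEq] at hb
    obtain ⟨rfl, rfl⟩ := hb
    set j := L.b.1
    have hh : (dir j : ℝ) * (L.b.2 + 1 / 2) = dir j * (L.bSite.2 : ℝ) + 1 / 2 := by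
      rcases dir_cases j with ⟨hj, hd⟩ | ⟨hj, hd⟩
      · rw [hd, Layers.bSite, if_pos hj]; push_cast; ring
      · rw [hd, Layers.bSite, if_neg hj]; push_cast; ring
    have hle : dir j * row j y ≤ dir j * L.bSite.2 := by
      have : ((dir j * row j y : ℤ) : ℝ) < (dir j * L.bSite.2 : ℤ) + 1 := by push_cast; linarith
      have : dir j * row j y < dir j * L.bSite.2 + 1 := by exact_mod_cast this
      omega
    obtain ⟨hs', hrun⟩ := D.run_of_clear (r' := L.bSite.2) hs hle fun t (ht : (dir j : ℝ) * row j y < dir j * t) ht' =>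
      if hy : (dir j : ℝ) * y < dir j * t then hfree' t hy (by linarith)
      else D.clear_of_site (j := j) (r := row j y) (abs_lt_of_dir (j := j) (by linarith) (by linarith)) hs
    exact hrun
  | @east j y h e' w h1 h2 h3 _ ih =>
    obtain ⟨hs, h⟩ := turnCase (Or.inl ⟨rfl, h3⟩) h1 h2 fun hne => ih hne hb
    exact ⟨hs, by simpa using h⟩
  | @west j y h e' w h1 h2 h3 _ ih =>
    obtain ⟨hs, h⟩ := turnCase (Or.inr ⟨rfl, h3⟩) h1 h2 fun hne => by
      simpa [sub_eq_add_neg] using ih hne hb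
    exact ⟨hs, by simpa using h⟩

end Discrete

end System

end Discretization

end QuantumIsing
end

/-! ### From runs to strands; spins and loops read on the diagram. -/

noncomputable section
namespace QuantumIsing

section Discretization

namespace System

variable {S : System} {L : Layers}

namespace Discrete

lemma ne_bSite_of_ne_last {x : L.site} (hx : x ≠ L.last) : (x : ℤ × ℤ) ≠ L.bSite :=
  fun h => hx (Subtype.ext h)

/-- The strand from a regular point up to a regular point of the next site. -/
lemma strand_step (D : S.Discrete L) {e e' : ℤ × ℝ} (he : e ∈ S.regular) (he' : e' ∈ S.regular)
    (hl : D.siteOf ⟨e, he⟩ ≠ L.last) (h : L.perm (D.siteOf ⟨e, he⟩) = D.siteOf ⟨e', he'⟩) :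
    S.Strand e e' (L.turn (toSite e)) := by
  obtain ⟨j, y⟩ := e
  obtain ⟨j', y'⟩ := e'
  have hs : (j, row j y) ∈ L.site := (D.siteOf ⟨(j, y), he⟩).2
  have hnext : L.next (j, row j y) = (j', row j' y') := congrArg Subtype.val h
  obtain ⟨a1, a2⟩ := row_spec j y
  obtain ⟨b1, b2⟩ := row_spec j' y'
  set r := row j y
  have hdd : (dir j : ℝ) * dir j = 1 := by exact_mod_cast dir_mul_dir j
  have hd0 : (dir j : ℝ) ≠ 0 := fun h0 => by rw [h0] at hdd; norm_num at hdd
  have hclear : ∀ t : ℝ, dir j * y < dir j * t → dir j * t < dir j * r + 1 / 2 → S.Clear j t :=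
    fun t h1 h2 => D.clear_of_site (abs_lt_of_dir (j := j) (by linarith) h2) hs
  have hh : (dir j : ℝ) * (r + dir j / 2) = dir j * r + 1 / 2 := by
    rw [mul_add, ← mul_div_assoc, hdd]
  have hfw : Forward j y (r + dir j / 2) := forward_iff.2 (by rw [hh]; exact a2)
  have hfree : S.Free j y (r + dir j / 2) := (free_iff hfw).2 fun t h1 h2 =>
    hclear t h1 (by rw [← hh]; exact h2)
  rw [toSite]
  rcases L.next_cases (x := (j, r)) (ne_bSite_of_ne_last hl) with ⟨hc, h1, h2⟩ | ⟨hc, h1, h2⟩ | ⟨hc, hc', hb, h1, h2⟩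
  all_goals
    change L.next (j, r) = _ at h1
    change L.turn (j, r) = _ at h2
  · change (j + 1, fwdLevel (j, r)) ∈ L.cut at hc
    rw [← D.cut_level_iff, fwdLevel_eq] at hc
    rw [h1, Prod.mk.injEq] at hnext
    obtain ⟨rfl, hr⟩ := hnext
    change S.Strand _ _ (L.turn (j, r))
    rw [h2, ← add_zero (eastTurn _)]
    refine Strand.east hfw hfree hc ?_
    rw [← hr, dir_add_one] at b1 b2
    push_cast at b1 b2
    have hne : y' ≠ r + dir j / 2 := fun he => he'.2.1 (by simpa [he] using hc)
    have hlt : (dir j : ℝ) * y' < dir j * r + 1 / 2 := lt_of_le_of_ne (by linarith) fun h =>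
      hne (mul_left_cancel₀ hd0 (h.trans hh.symm))
    have hfw' : Forward (j + 1) (r + dir j / 2) y' := forward_iff.2 (by
      rw [dir_add_one]; push_cast; linarith)
    refine Strand.straight (Or.inr hfw') ((free_iff hfw').2 fun t h3 h4 => ?_)
    rw [dir_add_one] at h3 h4
    push_cast at h3 h4
    have hs' : (j + 1, r) ∈ L.site := by
      have := (D.siteOf ⟨(j + 1, y'), he'⟩).2
      simp only [siteOf, toSite] at this
      rwa [← hr] at this
    exact D.clear_of_site (abs_lt_of_dir (j := j) (by linarith) (by linarith)) hs'
  · change (j, fwdLevel (j, r)) ∈ L.cut at hc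
    rw [← D.cut_level_iff, fwdLevel_eq] at hc
    rw [h1, Prod.mk.injEq] at hnext
    obtain ⟨rfl, hr⟩ := hnext
    change S.Strand _ _ (L.turn (j, r))
    rw [h2, ← add_zero (-eastTurn _)]
    refine Strand.west hfw hfree hc ?_
    rw [← hr, dir_sub_one] at b1 b2
    push_cast at b1 b2
    have hne : y' ≠ r + dir j / 2 := fun he => he'.2.2 (by simpa [he] using hc)
    have hlt : (dir j : ℝ) * y' < dir j * r + 1 / 2 := lt_of_le_of_ne (by linarith) fun h =>
      hne (mul_left_cancel₀ hd0 (h.trans hh.symm))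
    have hfw' : Forward (j - 1) (r + dir j / 2) y' := forward_iff.2 (by
      rw [dir_sub_one]; push_cast; linarith)
    refine Strand.straight (Or.inr hfw') ((free_iff hfw').2 fun t h3 h4 => ?_)
    rw [dir_sub_one] at h3 h4
    push_cast at h3 h4
    have hs' : (j - 1, r) ∈ L.site := by
      have := (D.siteOf ⟨(j - 1, y'), he'⟩).2
      simp only [siteOf, toSite] at this
      rwa [← hr] at this
    exact D.clear_of_site (abs_lt_of_dir (j := j) (by linarith) (by linarith)) hs'
  · change (j + 1, fwdLevel (j, r)) ∉ L.cut at hc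
    change (j, fwdLevel (j, r)) ∉ L.cut at hc'
    change (j, fwdLevel (j, r)) ≠ L.b at hb
    change L.next (j, r) = (j, fwdRow (j, r)) at h1
    change S.Strand _ _ (L.turn (j, r))
    rw [h1, Prod.mk.injEq] at hnext
    obtain ⟨rfl, hr⟩ := hnext
    have hs' : (j, row j y') ∈ L.site := (D.siteOf ⟨(j, y'), he'⟩).2
    have ha := L.fwd_ne_a hs
    have hlev : (j, fwdLevel (j, r)) ∈ L.site := by
      by_cases hj : Even j
      · rw [← hr, fwdRow, if_pos hj] at hs'
        rw [fwdLevel, if_pos hj]; exact hs'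
      · rw [fwdLevel, if_neg hj]; exact hs
    have hstrip := D.through _ _ hc' hc ha hb hlev
    rw [← D.cut_level_iff, fwdLevel_eq] at hc hc'
    rw [fwdLevel_eq] at hstrip
    rw [fwdRow_eq] at hr
    rw [← hr] at b1 b2 hs'
    push_cast at b1 b2
    have hfw' : Forward j y y' := forward_iff.2 (by nlinarith)
    rw [h2]
    refine Strand.straight (Or.inr hfw') ((free_iff hfw').2 fun t h3 h4 => ?_)
    rcases lt_trichotomy ((dir j : ℝ) * t) (dir j * (r + dir j / 2)) with hlt | heq | hlt
    · exact hclear t h3 (by rw [← hh]; exact hlt)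
    · rw [mul_left_cancel₀ hd0 heq]; exact ⟨hstrip, hc', hc⟩
    · rw [hh] at hlt
      exact D.clear_of_site (abs_lt_of_dir (j := j) (by push_cast; nlinarith)
        (by push_cast; linarith)) hs'

lemma siteOf_toPoint (D : S.Discrete L) (x : L.site) :
    D.siteOf ⟨toPoint x, D.regular_toPoint x⟩ = x := Subtype.ext (toSite_toPoint x)

/-- A nonempty run between the sites of two regular points gives a strand. -/
lemma strand_of_run (D : S.Discrete L) {e e' : ℤ × ℝ} (he : e ∈ S.regular) (he' : e' ∈ S.regular)
    (hl : D.siteOf ⟨e, he⟩ ≠ L.last) {w : ℤ}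
    (h : L.Run (L.perm (D.siteOf ⟨e, he⟩)) (D.siteOf ⟨e', he'⟩) w) :
    S.Strand e e' (L.turn (toSite e) + w) := by
  generalize hx : L.perm (D.siteOf ⟨e, he⟩) = x at h
  generalize hy : D.siteOf ⟨e', he'⟩ = y at h
  induction h generalizing e with
  | refl x => rw [add_zero]; exact D.strand_step he he' hl (hx.trans hy.symm)
  | @step x y w h1 _ ih =>
    have hp := D.siteOf_toPoint x
    have h2 := D.strand_step he (D.regular_toPoint x) hl (hx.trans hp.symm)
    have h3 := ih (D.regular_toPoint x) (by rw [hp]; exact h1) (by rw [hp]) hy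
    rw [toSite_toPoint] at h3
    exact h2.trans (D.regular_toPoint x) h3

lemma strand_last (D : S.Discrete L) {e : ℤ × ℝ} (he : e ∈ S.regular)
    (hl : D.siteOf ⟨e, he⟩ = L.last) : S.Strand e S.b 0 := by
  obtain ⟨j, y⟩ := e
  have hs : toSite (j, y) = L.bSite := congrArg Subtype.val hl
  have hj : j = L.b.1 := (Prod.ext_iff.1 hs).1
  have hr : row j y = L.bSite.2 := (Prod.ext_iff.1 hs).2
  subst hj
  obtain ⟨a1, a2⟩ := row_spec L.b.1 y
  have hs : (L.b.1, row L.b.1 y) ∈ L.site := (D.siteOf ⟨_, he⟩).2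
  have hh : (dir L.b.1 : ℝ) * (L.b.2 + 1 / 2) = dir L.b.1 * (row L.b.1 y : ℝ) + 1 / 2 := by
    rw [hr]
    rcases dir_cases L.b.1 with ⟨hj, hd⟩ | ⟨hj, hd⟩
    · rw [hd, Layers.bSite, if_pos hj]; push_cast; ring
    · rw [hd, Layers.bSite, if_neg hj]; push_cast; ring
  rw [D.b_eq]
  have hfw : Forward L.b.1 y (L.b.2 + 1 / 2) := forward_iff.2 (by rw [hh]; exact a2)
  exact Strand.straight (Or.inr hfw) ((free_iff hfw).2 fun t h1 h2 =>
    D.clear_of_site (abs_lt_of_dir (j := L.b.1) (by linarith) (by rw [← hh]; exact h2)) hs)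

/-- A run up to the last site gives a strand up to the end of the interface. -/
lemma strand_b_of_run (D : S.Discrete L) {e : ℤ × ℝ} (he : e ∈ S.regular) {w : ℤ}
    (h : L.Run (D.siteOf ⟨e, he⟩) L.last w) : S.Strand e S.b w := by
  generalize hx : D.siteOf ⟨e, he⟩ = x at h
  generalize hy : L.last = y at h
  induction h generalizing e with
  | refl x => exact D.strand_last he (hx.trans hy.symm)
  | @step x y w h1 _ ih =>
    have hp := D.siteOf_toPoint (L.perm x)
    have h2 := D.strand_step he (D.regular_toPoint _) (by rw [hx]; exact h1)
      (by rw [hp, hx])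
    have h3 := ih (D.regular_toPoint _) hp hy
    have ht : L.turn (toSite e) = L.turn x := by rw [← hx]; rfl
    rw [ht] at h2
    exact h2.trans (D.regular_toPoint _) h3

lemma a_dir (L : Layers) : (dir L.a.1 : ℝ) * (L.a.2 + 1 / 2) = dir L.a.1 * (L.aSite.2 : ℝ) - 1 / 2 := by
  rcases dir_cases L.a.1 with ⟨hj, hd⟩ | ⟨hj, hd⟩
  · rw [hd, Layers.aSite, if_pos hj]; push_cast; ring
  · rw [hd, Layers.aSite, if_neg hj]; push_cast; ring

lemma strand_first (D : S.Discrete L) {e : ℤ × ℝ} (he : e ∈ S.regular)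
    (hl : D.siteOf ⟨e, he⟩ = L.first) : S.Strand S.a e 0 := by
  obtain ⟨j, y⟩ := e
  have hs : toSite (j, y) = L.aSite := congrArg Subtype.val hl
  have hj : j = L.a.1 := (Prod.ext_iff.1 hs).1
  have hr : row j y = L.aSite.2 := (Prod.ext_iff.1 hs).2
  subst hj
  obtain ⟨a1, a2⟩ := row_spec L.a.1 y
  have hs : (L.a.1, row L.a.1 y) ∈ L.site := (D.siteOf ⟨_, he⟩).2
  have hh := a_dir L
  rw [← hr] at hh
  have hne : y ≠ L.a.2 + 1 / 2 := fun h => D.a_not_mem (by rw [D.a_eq, ← h]; exact he.1)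
  have hd0 : (dir L.a.1 : ℝ) ≠ 0 := by
    rcases dir_cases L.a.1 with ⟨-, hd⟩ | ⟨-, hd⟩ <;> rw [hd] <;> norm_num
  have hlt : (dir L.a.1 : ℝ) * (L.a.2 + 1 / 2) < dir L.a.1 * y := lt_of_le_of_ne (by linarith)
    fun h => hne (mul_left_cancel₀ hd0 h.symm)
  rw [D.a_eq]
  have hfw : Forward L.a.1 (L.a.2 + 1 / 2) y := forward_iff.2 hlt
  exact Strand.straight (Or.inr hfw) ((free_iff hfw).2 fun t h1 h2 =>
    D.clear_of_site (abs_lt_of_dir (j := L.a.1) (by linarith) (by linarith)) hs)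

/-- A regular point is reached from the start of the interface when its site is. -/
lemma reach_of_run (D : S.Discrete L) {e : ℤ × ℝ} (he : e ∈ S.regular) {w : ℤ}
    (h : L.Run L.first (D.siteOf ⟨e, he⟩) w) : S.Reach S.a e := by
  generalize hx : L.first = x at h
  generalize hy : D.siteOf ⟨e, he⟩ = y at h
  cases h with
  | refl => exact ⟨0, D.strand_first he (hy.trans hx.symm)⟩
  | @step _ _ w h1 h2 =>
    have hp := D.siteOf_toPoint x
    have h3 := D.strand_first (D.regular_toPoint x) (hp.trans hx.symm)
    have h4 := D.strand_of_run (D.regular_toPoint x) he (by rw [hp]; exact h1)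
      (w := w) (by rw [hp, hy]; exact h2)
    exact ⟨_, h3.trans (D.regular_toPoint x) h4⟩

/-- The spin at a point of the interface. -/
lemma spin_of_run (D : S.Discrete L) {e : ℤ × ℝ} (he : e ∈ S.regular) {w : ℤ}
    (h : L.Run (D.siteOf ⟨e, he⟩) L.last w) : S.spin e = Complex.I ^ w := by
  have h1 := D.strand_b_of_run he h
  obtain ⟨_, h2⟩ := Layers.exists_run_first h.sameCycle
  have hint : e ∈ S.interface := ⟨Or.inl he.1, D.reach_of_run he h2, ⟨w, h1⟩⟩
  rw [spin, dif_pos hint]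
  have hne : e ≠ S.b := fun hb => D.b_not_mem (hb ▸ he.1)
  obtain ⟨_, h3⟩ := D.run_last_of_strand hint.2.2.choose_spec hne
  rw [h3.unique h]

/-- The spin vanishes away from the interface. -/
lemma spin_of_not (D : S.Discrete L) {e : ℤ × ℝ} (he : e ∈ S.regular)
    (h : ¬L.perm.SameCycle (D.siteOf ⟨e, he⟩) L.last) : S.spin e = 0 := by
  rw [spin, dif_neg]
  rintro ⟨-, -, w, hw⟩
  have hne : e ≠ S.b := fun hb => D.b_not_mem (hb ▸ he.1)
  obtain ⟨_, h3⟩ := D.run_last_of_strand hw hne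
  exact h h3.sameCycle

lemma spin_eq_of_site_eq (D : S.Discrete L) {e e' : ℤ × ℝ} (he : e ∈ S.regular)
    (he' : e' ∈ S.regular) (h : toSite e = toSite e') : S.spin e = S.spin e' := by
  have h : D.siteOf ⟨e, he⟩ = D.siteOf ⟨e', he'⟩ := Subtype.ext h
  by_cases hc : L.perm.SameCycle (D.siteOf ⟨e, he⟩) L.last
  · obtain ⟨w, hw⟩ := Layers.exists_run_last hc
    rw [D.spin_of_run he hw, D.spin_of_run he' (h ▸ hw)]
  · rw [D.spin_of_not he hc, D.spin_of_not he' (h ▸ hc)]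

/-- The spin is transported along the strands. -/
theorem transported (D : S.Discrete L) :
    Transported L.perm (fun x => Complex.I ^ L.turn x) L.last fun x => S.spin (toPoint x) where
  base := by
    have := D.spin_of_run (D.regular_toPoint L.last) (w := 0) (by
      rw [D.siteOf_toPoint]; exact Layers.Run.refl _)
    simpa using this
  step x hx := by
    by_cases hc : L.perm.SameCycle x L.last
    · obtain ⟨w, hw⟩ := Layers.exists_run_last (Equiv.Perm.sameCycle_apply_left.2 hc)
      rw [D.spin_of_run (D.regular_toPoint (L.perm x)) (by rw [D.siteOf_toPoint]; exact hw),
        D.spin_of_run (D.regular_toPoint x) (by rw [D.siteOf_toPoint]; exact Layers.Run.step hx hw),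
        zpow_add₀ Complex.I_ne_zero]
    · rw [D.spin_of_not (D.regular_toPoint x) (by rwa [D.siteOf_toPoint]),
        D.spin_of_not (D.regular_toPoint (L.perm x)) (by
          rw [D.siteOf_toPoint, Equiv.Perm.sameCycle_apply_left]; exact hc), mul_zero]

lemma sameCycle_of_reach (D : S.Discrete L) {e e' : ℤ × ℝ} (he : e ∈ S.regular)
    (he' : e' ∈ S.regular) (h : S.Reach e e') :
    L.perm.SameCycle (D.siteOf ⟨e, he⟩) (D.siteOf ⟨e', he'⟩) := by
  obtain ⟨w, hw⟩ := h
  obtain ⟨hs, ⟨w', -, -, h⟩ | ⟨-, h, -⟩⟩ := D.run_of_strand hw he'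
  · exact Equiv.Perm.sameCycle_apply_left.1 h.sameCycle
  · have : D.siteOf ⟨e, he⟩ = D.siteOf ⟨e', he'⟩ := Subtype.ext h
    rw [this]

lemma reach_of_sameCycle (D : S.Discrete L) {e e' : ℤ × ℝ} (he : e ∈ S.regular)
    (he' : e' ∈ S.regular)
    (h : L.perm.SameCycle (D.siteOf ⟨e, he⟩) (D.siteOf ⟨e', he'⟩))
    (hl : ¬L.perm.SameCycle (D.siteOf ⟨e, he⟩) L.last) : S.Reach e e' := by
  obtain ⟨w, hw⟩ := Layers.exists_run_of_not (Equiv.Perm.sameCycle_apply_left.2 h)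
    (fun h' => hl (Equiv.Perm.sameCycle_apply_left.1 h'))
  exact ⟨_, D.strand_of_run he he' (fun h' => hl (by rw [h'])) hw⟩

/-- Two distinct points that reach each other give a nonempty closed run. Runs do not use the
junction after the last site, so the cycle they close does not contain that site. -/
lemma not_sameCycle_last (D : S.Discrete L) {e e' : ℤ × ℝ} (he : e ∈ S.regular)
    (he' : e' ∈ S.regular) (hne : e ≠ e') (h : S.Reach e e') (h' : S.Reach e' e) :
    ¬L.perm.SameCycle (D.siteOf ⟨e, he⟩) L.last := by
  have closed : ∀ {x : L.site} {w : ℤ}, x ≠ L.last → L.Run (L.perm x) x w →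
      ¬L.perm.SameCycle x L.last := by
    intro x w hx hr hc
    have key : ∀ {y z : L.site} {v : ℤ}, L.Run y z v → ∃ n : ℕ, L.perm^[n] y = z ∧
        ∀ i < n, L.perm^[i] y ≠ L.last := by
      intro y z v hv
      induction hv with
      | refl => exact ⟨0, rfl, by simp⟩
      | step h1 _ ih =>
        obtain ⟨n, hn, hn'⟩ := ih
        refine ⟨n + 1, hn, fun i hi => ?_⟩
        rcases i with _ | i
        · exact h1
        · exact hn' i (by omega)
    obtain ⟨n, hn, hn'⟩ := key (Layers.Run.step hx hr)
    obtain ⟨m, hm⟩ := SameCycle.exists_iterate hc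
    rcases n with _ | n
    · obtain ⟨n, hn, hn'⟩ := key hr
      have hper : Function.IsPeriodicPt L.perm (n + 1) x := hn
      have h1 := hper.iterate_mod_apply m
      rw [hm] at h1
      rcases Nat.eq_zero_or_pos (m % (n + 1)) with h0 | h0
      · rw [h0] at h1; exact hx h1
      · obtain ⟨k, hk⟩ := Nat.exists_eq_succ_of_ne_zero h0.ne'
        have hlt : m % (n + 1) < n + 1 := Nat.mod_lt _ (by omega)
        rw [hk] at h1
        exact hn' k (by omega) h1
    · have hper : Function.IsPeriodicPt L.perm (n + 1) x := hn
      have h1 := hper.iterate_mod_apply m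
      rw [hm] at h1
      exact hn' _ (Nat.mod_lt _ (by omega)) h1
  obtain ⟨w, hw⟩ := h
  obtain ⟨w', hw'⟩ := h'
  obtain ⟨hs, h1⟩ := D.run_of_strand hw he'
  obtain ⟨hs', h2⟩ := D.run_of_strand hw' he
  rcases h1 with ⟨u, h1, -, h3⟩ | ⟨-, h1, h3⟩ <;> rcases h2 with ⟨u', h2, -, h4⟩ | ⟨-, h2, h4⟩
  · exact closed h1 (h3.trans (Layers.Run.step h2 h4))
  · have hee : D.siteOf ⟨e', he'⟩ = D.siteOf ⟨e, he⟩ := Subtype.ext h2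
    rw [hee] at h3
    exact closed h1 h3
  · have hee : D.siteOf ⟨e, he⟩ = D.siteOf ⟨e', he'⟩ := Subtype.ext h1
    rw [hee] at h4 ⊢
    exact closed h2 h4
  -- If both strands were vertical segments without event, each point would be strictly ahead of the
  -- other in the same column.
  · rcases h3 with h3 | h3
    · exact (hne h3.symm).elim
    rcases h4 with h4 | h4
    · exact (hne h4).elim
    rw [forward_iff] at h3 h4
    have hcol : e.1 = e'.1 := (Prod.ext_iff.1 h1).1
    rw [hcol] at h3
    exact (lt_asymm h3 h4).elim

/-- The loops are the cycles of the diagram, that of the interface excepted. -/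
theorem numCycles_eq (D : S.Discrete L) : numCycles L.perm = S.numLoops + 1 := by
  classical
  let a : Quotient (Equiv.Perm.SameCycle.setoid L.perm) := Quotient.mk _ L.last
  -- A cycle other than that of the interface is sent to the set of regular points whose sites it
  -- contains; the range of this injection is exactly the set of loops.
  let g : {q : Quotient (Equiv.Perm.SameCycle.setoid L.perm) // q ≠ a} → Set (ℤ × ℝ) :=
    fun q => {e | ∃ he : e ∈ S.regular, Quotient.mk _ (D.siteOf ⟨e, he⟩) = q.1}
  have hmk : ∀ x : L.site, (Quotient.mk (Equiv.Perm.SameCycle.setoid L.perm)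
      (D.siteOf ⟨toPoint x, D.regular_toPoint x⟩)) = Quotient.mk _ x := fun x => by
    rw [D.siteOf_toPoint]
  have hg : Function.Injective g := by
    rintro ⟨⟨x⟩, hx⟩ ⟨q, hq⟩ h
    have h1 : toPoint x ∈ g ⟨Quotient.mk _ x, hx⟩ := ⟨D.regular_toPoint x, hmk x⟩
    have h2 : toPoint x ∈ g ⟨q, hq⟩ := h ▸ h1
    obtain ⟨h3, h4⟩ := h2
    exact Subtype.ext ((hmk x).symm.trans h4)
  have hset : ∀ (e : ℤ × ℝ) (he : e ∈ S.regular)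
      (hl : ¬L.perm.SameCycle (D.siteOf ⟨e, he⟩) L.last),
      {x ∈ S.regular | S.Reach e x ∧ S.Reach x e} =
      g ⟨Quotient.mk _ (D.siteOf ⟨e, he⟩), fun h => hl (Quotient.exact h)⟩ := by
    intro e he hl
    ext x
    constructor
    · rintro ⟨hx, h1, -⟩
      exact ⟨hx, Quotient.sound (D.sameCycle_of_reach he hx h1).symm⟩
    · rintro ⟨hx, h1⟩
      have h1 : L.perm.SameCycle (D.siteOf ⟨x, hx⟩) (D.siteOf ⟨e, he⟩) := Quotient.exact h1
      exact ⟨hx, D.reach_of_sameCycle he hx h1.symm hl,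
        D.reach_of_sameCycle hx he h1 fun h => hl (h1.symm.trans h)⟩
  have hloops : S.loops = Set.range g := by
    ext A
    constructor
    · rintro ⟨e, he, e', he', hne, h1, h2, rfl⟩
      exact ⟨_, (hset e he (D.not_sameCycle_last he he' hne h1 h2)).symm⟩
    · rintro ⟨⟨⟨x⟩, hx⟩, rfl⟩
      have hx' : ¬L.perm.SameCycle x L.last := fun h => hx (Quotient.sound h)
      have hl : x ≠ L.last := fun h => hx' (by rw [h])
      have hp := D.siteOf_toPoint x
      have hp' := D.siteOf_toPoint (L.perm x)
      -- The definition of a loop asks for two distinct points; the site and its successor provide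
      -- them.
      have hne : L.perm x ≠ x := by
        intro h
        have h := congrArg Subtype.val h
        rw [Layers.coe_perm] at h
        rcases L.next_cases (ne_bSite_of_ne_last hl) with ⟨-, h1, -⟩ | ⟨-, h1, -⟩ | ⟨-, -, -, h1, -⟩
        · rw [h1, Prod.ext_iff] at h; simp at h
        · rw [h1, Prod.ext_iff] at h; simp at h
        · rw [h1, Prod.ext_iff] at h
          have h2 := h.2
          have h3 := fwdRow_eq x.1.1 x.1.2
          rw [Prod.mk.eta] at h3
          simp only at h2
          rw [h2] at h3
          rcases dir_cases x.1.1 with ⟨-, hd⟩ | ⟨-, hd⟩ <;> rw [hd] at h3 <;> omega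
      have hsc : L.perm.SameCycle x (L.perm x) := Equiv.Perm.sameCycle_apply_right.2 (Equiv.Perm.SameCycle.refl _ _)
      refine ⟨toPoint x, D.regular_toPoint x, toPoint (L.perm x), D.regular_toPoint _, ?_, ?_, ?_, ?_⟩
      · intro h
        have := congrArg toSite h
        rw [toSite_toPoint, toSite_toPoint] at this
        exact hne (Subtype.ext this.symm)
      · exact D.reach_of_sameCycle _ _ (by rw [hp, hp']; exact hsc) (by rwa [hp])
      · exact D.reach_of_sameCycle _ _ (by rw [hp, hp']; exact hsc.symm)
          (by rw [hp']; exact fun h => hx' (hsc.trans h))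
      · rw [hset _ (D.regular_toPoint x) (by rwa [hp])]
        congr 1
        exact Subtype.ext (hmk x).symm
  rw [numLoops, hloops, ← Nat.card_coe_set_eq, Nat.card_range_of_injective hg, numCycles,
    ← Nat.card_congr (Equiv.optionSubtypeNe a), Finite.card_option]

end Discrete

end System

end Discretization

end QuantumIsing
end

noncomputable section
namespace QuantumIsing

/-! ### Geometry of Dobrushin domains -/

section Geometry

lemma mem_segment_horizontal {a b y : ℝ} {z : ℂ} :
    z ∈ segment ℝ (⟨a, y⟩ : ℂ) ⟨b, y⟩ ↔ z.re ∈ Set.uIcc a b ∧ z.im = y := by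
  rw [← segment_eq_uIcc, segment_eq_image', segment_eq_image']
  constructor
  · rintro ⟨θ, hθ, rfl⟩
    exact ⟨⟨θ, hθ, by simp⟩, by simp⟩
  · rintro ⟨⟨θ, hθ, h⟩, h'⟩
    exact ⟨θ, hθ, Complex.ext (by simp [← h]) (by simp [h'])⟩

lemma mem_segment_vertical {a b x : ℝ} {z : ℂ} :
    z ∈ segment ℝ (⟨x, a⟩ : ℂ) ⟨x, b⟩ ↔ z.im ∈ Set.uIcc a b ∧ z.re = x := by
  rw [← segment_eq_uIcc, segment_eq_image', segment_eq_image']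
  constructor
  · rintro ⟨θ, hθ, rfl⟩
    exact ⟨⟨θ, hθ, by simp⟩, by simp⟩
  · rintro ⟨⟨θ, hθ, h⟩, h'⟩
    exact ⟨θ, hθ, Complex.ext (by simp [h']) (by simp [← h])⟩

lemma mem_openSegment_of_segment {x y z : ℂ} (h : z ∈ segment ℝ x y) (hx : z ≠ x) (hy : z ≠ y) :
    z ∈ openSegment ℝ x y :=
  mem_openSegment_of_ne_left_right hx.symm hy.symm h

section Abscissae

variable {δ : ℝ}


lemma medial_le_medial (hδ : 0 < δ) {k c : ℤ} : (k : ℝ) * (δ / 2) ≤ c * (δ / 2) ↔ k ≤ c := by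
  rw [mul_le_mul_iff_left₀ (by positivity)]; norm_cast

lemma medial_le_midEdge (hδ : 0 < δ) {k j : ℤ} : (k : ℝ) * (δ / 2) ≤ (2 * j + 1) * (δ / 4) ↔ k ≤ j := by
  rw [show (k : ℝ) * (δ / 2) = (2 * k) * (δ / 4) by ring, mul_le_mul_iff_left₀ (by positivity)]
  norm_cast; omega

lemma midEdge_le_medial (hδ : 0 < δ) {k j : ℤ} : (2 * j + 1) * (δ / 4) ≤ (k : ℝ) * (δ / 2) ↔ j + 1 ≤ k := by
  rw [show (k : ℝ) * (δ / 2) = (2 * k) * (δ / 4) by ring, mul_le_mul_iff_left₀ (by positivity)]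
  norm_cast; omega

lemma medial_mem_uIcc (hδ : 0 < δ) {k k' c : ℤ} :
    (c : ℝ) * (δ / 2) ∈ Set.uIcc ((k : ℝ) * (δ / 2)) (k' * (δ / 2)) ↔
      min k k' ≤ c ∧ c ≤ max k k' := by
  rw [Set.mem_uIcc, medial_le_medial hδ, medial_le_medial hδ, medial_le_medial hδ,
    medial_le_medial hδ]
  omega

lemma midEdge_mem_uIcc (hδ : 0 < δ) {k k' j : ℤ} :
    (2 * (j : ℝ) + 1) * (δ / 4) ∈ Set.uIcc ((k : ℝ) * (δ / 2)) (k' * (δ / 2)) ↔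
      min k k' ≤ j ∧ j + 1 ≤ max k k' := by
  rw [Set.mem_uIcc, medial_le_midEdge hδ, medial_le_midEdge hδ, midEdge_le_medial hδ,
    midEdge_le_medial hδ]
  omega

lemma midEdge_ne_medial (hδ : 0 < δ) {j k : ℤ} : (2 * (j : ℝ) + 1) * (δ / 4) ≠ k * (δ / 2) := fun h => by
  have h1 := (midEdge_le_medial hδ).1 h.le
  have h2 := (medial_le_midEdge hδ).1 h.ge
  omega

end Abscissae

namespace DobrushinDomain

variable {δ : ℝ} (D : DobrushinDomain δ)

/-- The mid-edge `(j, t)` lies on the `i`-th boundary segment, which is horizontal. -/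
def Covers (i : ℕ) (j : ℤ) (t : ℝ) : Prop :=
  (D.vertex i).2 = t ∧ (D.vertex (i + 1)).2 = t ∧
    min (D.vertex i).1 (D.vertex (i + 1)).1 ≤ j ∧ j + 1 ≤ max (D.vertex i).1 (D.vertex (i + 1)).1

/-- The heights of the vertices of the boundary. -/
def heights : Finset ℝ := (Finset.range (D.r + D.s + 3)).image fun i => (D.vertex i).2

lemma vertex_mem_heights {i : ℕ} (hi : i ≤ D.r + D.s + 2) : (D.vertex i).2 ∈ D.heights :=
  Finset.mem_image_of_mem _ (Finset.mem_range.2 (by omega))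

variable {D}

lemma mem_boundarySegment {i : ℕ} (hi : i < D.r + D.s + 2) {z : ℂ} :
    z ∈ D.boundarySegment i ↔
      ((D.vertex i).1 = (D.vertex (i + 1)).1 ∧ z.re = (D.vertex i).1 * (δ / 2) ∧
        z.im ∈ Set.uIcc (D.vertex i).2 (D.vertex (i + 1)).2) ∨
      ((D.vertex i).1 ≠ (D.vertex (i + 1)).1 ∧ (D.vertex i).2 = (D.vertex (i + 1)).2 ∧
        z.im = (D.vertex i).2 ∧
        z.re ∈ Set.uIcc ((D.vertex i).1 * (δ / 2)) ((D.vertex (i + 1)).1 * (δ / 2))) := by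
  rw [boundarySegment, medialPos, medialPos]
  rcases D.axis i hi with ⟨h1, h2⟩ | ⟨h1, h2⟩
  · rw [← h1, mem_segment_vertical]
    simp [and_comm]
  · rw [← h2, mem_segment_horizontal]
    simp [h1, and_comm]

lemma midEdge_mem_boundarySegment (hδ : 0 < δ) {i : ℕ} (hi : i < D.r + D.s + 2) {j : ℤ} {t : ℝ} :
    midEdgePos δ (j, t) ∈ D.boundarySegment i ↔ D.Covers i j t := by
  rw [mem_boundarySegment hi, Covers]
  simp only [midEdgePos, midEdge_ne_medial hδ, midEdge_mem_uIcc hδ, false_and, and_false, false_or]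
  constructor
  · rintro ⟨-, h2, h3, h4⟩
    exact ⟨h3.symm, h2.symm.trans h3.symm, h4⟩
  · rintro ⟨h1, h2, h3, h4⟩
    exact ⟨fun h => by omega, h1.trans h2.symm, h1.symm, h3, h4⟩

lemma mem_frontier_iff {z : ℂ} :
    z ∈ frontier D.carrier ↔ ∃ i < D.r + D.s + 2, z ∈ D.boundarySegment i := by
  rw [D.frontier_eq]; simp [boundarySegment]

lemma midEdge_mem_frontier (hδ : 0 < δ) {j : ℤ} {t : ℝ} :
    midEdgePos δ (j, t) ∈ frontier D.carrier ↔ ∃ i < D.r + D.s + 2, D.Covers i j t := by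
  rw [mem_frontier_iff]
  exact exists_congr fun i => and_congr_right fun hi => midEdge_mem_boundarySegment hδ hi

lemma height_of_frontier (hδ : 0 < δ) {j : ℤ} {t : ℝ}
    (h : midEdgePos δ (j, t) ∈ frontier D.carrier) : t ∈ D.heights := by
  obtain ⟨i, hi, h, -⟩ := (midEdge_mem_frontier hδ).1 h
  exact h ▸ D.vertex_mem_heights hi.le

lemma not_mem_frontier_of_mem {z : ℂ} (hz : z ∈ D.carrier) : z ∉ frontier D.carrier := by
  rw [D.isOpen.frontier_eq]; exact fun h => h.2 hz

/-- Off the frontier, a segment is covered by two disjoint open sets, the domain and the complement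
of its closure, and it is connected. -/
lemma mem_iff_of_segment {z w : ℂ} (h : ∀ x ∈ segment ℝ z w, x ∉ frontier D.carrier) :
    z ∈ D.carrier ↔ w ∈ D.carrier := by
  have hc : IsPreconnected (segment ℝ z w) := (convex_segment z w).isPreconnected
  have key : ∀ u ∈ segment ℝ z w, ∀ v ∈ segment ℝ z w, u ∈ D.carrier → v ∈ D.carrier := by
    intro u hu v hv hu'
    by_contra hv'
    have hout : ∀ x ∈ segment ℝ z w, x ∉ D.carrier → x ∉ closure D.carrier := fun x hx hx' hc' =>
      h x hx (by rw [D.isOpen.frontier_eq]; exact ⟨hc', hx'⟩)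
    obtain ⟨x, -, h1, h2⟩ := hc _ _ D.isOpen isClosed_closure.isOpen_compl
      (fun x hx => or_iff_not_imp_left.2 (hout x hx)) ⟨u, hu, hu'⟩ ⟨v, hv, hout v hv hv'⟩
    exact h2 (subset_closure h1)
  exact ⟨key _ (left_mem_segment ..) _ (right_mem_segment ..),
    key _ (right_mem_segment ..) _ (left_mem_segment ..)⟩

/-- A vertical segment in a mid-edge column that does not meet the boundary. -/
lemma mem_iff_of_uIcc {j : ℤ} {t t' : ℝ}
    (h : ∀ u ∈ Set.uIcc t t', midEdgePos δ (j, u) ∉ frontier D.carrier) :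
    midEdgePos δ (j, t) ∈ D.carrier ↔ midEdgePos δ (j, t') ∈ D.carrier := by
  refine mem_iff_of_segment fun x hx => ?_
  obtain ⟨h1, h2⟩ := mem_segment_vertical.1 hx
  have : x = midEdgePos δ (j, x.im) := Complex.ext h2 rfl
  rw [this]
  exact h _ h1

/-- The mid-edges on the two sides of a medial point of the domain are in the domain. -/
lemma midEdge_mem_of_medial (hδ : 0 < δ) {c : ℤ} {t : ℝ} (h : medialPos δ (c, t) ∈ D.carrier) :
    midEdgePos δ (c - 1, t) ∈ D.carrier ∧ midEdgePos δ (c, t) ∈ D.carrier := by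
  -- Vertical boundary lines are at multiples of δ/2, so one within δ/4 of the medial point has its
  -- abscissa. The ends of a horizontal boundary segment are at such multiples too, so if it comes
  -- within δ/4 of the medial point at that height, it contains it.
  have key : ∀ x : ℝ, |x - c * (δ / 2)| ≤ δ / 4 → (⟨x, t⟩ : ℂ) ∉ frontier D.carrier := by
    intro x hx hf
    obtain ⟨i, hi, hm⟩ := mem_frontier_iff.1 hf
    rcases (mem_boundarySegment hi).1 hm with ⟨h1, h2, h3⟩ | ⟨h1, h2, h3, h4⟩
    · simp only at h2 h3
      have hk : (D.vertex i).1 = c := by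
        rw [abs_le] at hx
        have h4 : (c : ℝ) < (D.vertex i).1 + 1 := by nlinarith
        have h5 : ((D.vertex i).1 : ℝ) < c + 1 := by nlinarith
        have h4 : c < (D.vertex i).1 + 1 := by exact_mod_cast h4
        have h5 : (D.vertex i).1 < c + 1 := by exact_mod_cast h5
        omega
      rw [hk] at h2
      rw [h2] at hf
      exact not_mem_frontier_of_mem h hf
    · simp only [Set.mem_uIcc] at h3 h4
      have hk : (c : ℝ) * (δ / 2) ∈ Set.uIcc ((D.vertex i).1 * (δ / 2) : ℝ)
          ((D.vertex (i + 1)).1 * (δ / 2)) := by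
        rw [abs_le] at hx
        have hle : ∀ k k' : ℤ, (k : ℝ) * (δ / 2) ≤ k' * (δ / 2) + δ / 4 → k ≤ k' := by
          intro k k' hkk
          have h5 : (k : ℝ) < k' + 1 := by nlinarith
          have h5 : k < k' + 1 := by exact_mod_cast h5
          omega
        rw [medial_mem_uIcc hδ]
        rcases h4 with h4 | h4
        · have h5 := hle (D.vertex i).1 c (by linarith)
          have h6 := hle c (D.vertex (i + 1)).1 (by linarith)
          omega
        · have h5 := hle (D.vertex (i + 1)).1 c (by linarith)
          have h6 := hle c (D.vertex i).1 (by linarith)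
          omega
      exact not_mem_frontier_of_mem h (mem_frontier_iff.2
        ⟨i, hi, (mem_boundarySegment hi).2 (Or.inr ⟨h1, h2, h3, hk⟩)⟩)
  have key' : ∀ x : ℝ, |x - c * (δ / 2)| ≤ δ / 4 → (⟨x, t⟩ : ℂ) ∈ D.carrier := by
    intro x hx
    refine (mem_iff_of_segment fun z hz => ?_).1 h
    obtain ⟨h1, h2⟩ := mem_segment_horizontal.1 hz
    have : z = ⟨z.re, t⟩ := Complex.ext rfl h2
    rw [this]
    refine key _ (le_trans ?_ hx)
    exact Set.abs_sub_left_of_mem_uIcc h1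
  constructor
  · refine key' _ ?_
    push_cast
    rw [show (2 * ((c : ℝ) - 1) + 1) * (δ / 4) - c * (δ / 2) = -(δ / 4) by ring, abs_neg,
      abs_of_pos (by positivity)]
  · refine key' _ ?_
    rw [show (2 * (c : ℝ) + 1) * (δ / 4) - c * (δ / 2) = δ / 4 by ring, abs_of_pos (by positivity)]

/-- A mid-edge lies on at most one boundary segment. -/
lemma Covers.unique (hδ : 0 < δ) {i i' : ℕ} (hi : i < D.r + D.s + 2) (hi' : i' < D.r + D.s + 2)
    {j : ℤ} {t : ℝ} (h : D.Covers i j t) (h' : D.Covers i' j t) : i = i' := by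
  by_contra hne
  have hm : ∀ p, midEdgePos δ (j, t) ∉ ({medialPos δ p} : Set ℂ) := fun p h =>
    midEdge_ne_medial hδ (congrArg Complex.re h)
  exact Set.disjoint_left.1 (D.simple i hi i' hi' hne)
    ⟨(midEdge_mem_boundarySegment hδ hi).2 h, hm _⟩
    ⟨(midEdge_mem_boundarySegment hδ hi').2 h', hm _⟩

/-- The sides of a horizontal boundary segment. -/
lemma Covers.sides (hδ : 0 < δ) {i : ℕ} (hi : i < D.r + D.s + 2) {j : ℤ} {t : ℝ}
    (h : D.Covers i j t) :
    ((D.vertex i).1 < (D.vertex (i + 1)).1 → ∀ᶠ u in nhdsWithin 0 (Set.Ioi 0),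
      midEdgePos δ (j, t + u) ∈ D.carrier ∧ midEdgePos δ (j, t - u) ∉ D.carrier) ∧
    ((D.vertex (i + 1)).1 < (D.vertex i).1 → ∀ᶠ u in nhdsWithin 0 (Set.Ioi 0),
      midEdgePos δ (j, t - u) ∈ D.carrier ∧ midEdgePos δ (j, t + u) ∉ D.carrier) := by
  have hm : ∀ p, midEdgePos δ (j, t) ≠ medialPos δ p := fun p h =>
    midEdge_ne_medial hδ (congrArg Complex.re h)
  have hl := D.left i hi _ (mem_openSegment_of_segment
    ((midEdge_mem_boundarySegment hδ hi).2 h) (hm _) (hm _))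
  have him : (D.vertex i).2 = (D.vertex (i + 1)).2 := h.1.trans h.2.1.symm
  have hd : Complex.I * (medialPos δ (D.vertex (i + 1)) - medialPos δ (D.vertex i)) =
      ⟨0, ((D.vertex (i + 1)).1 - (D.vertex i).1) * (δ / 2)⟩ := by
    apply Complex.ext
    · simp [medialPos, him]
    · simp [medialPos]; ring
  rw [hd] at hl
  generalize hδ' : (((D.vertex (i + 1)).1 : ℝ) - (D.vertex i).1) * (δ / 2) = d at hl
  have hp : ∀ u : ℝ, midEdgePos δ (j, t) + u * (⟨0, d⟩ : ℂ) = midEdgePos δ (j, t + u * d) := fun u => by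
    apply Complex.ext <;> simp [midEdgePos]
  have hp' : ∀ u : ℝ, midEdgePos δ (j, t) - u * (⟨0, d⟩ : ℂ) = midEdgePos δ (j, t - u * d) := fun u => by
    apply Complex.ext <;> simp [midEdgePos]
  simp only [hp, hp'] at hl
  -- The condition `left` uses multiples of the rotated tangent vector, here vertical of signed
  -- length `d`; dividing the parameter by |d| gives plain vertical displacements.
  have htend : ∀ c : ℝ, 0 < c → Filter.Tendsto (fun u : ℝ => u / c) (nhdsWithin 0 (Set.Ioi 0))
      (nhdsWithin 0 (Set.Ioi 0)) := fun c hc => by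
    refine tendsto_nhdsWithin_iff.2 ⟨?_, ?_⟩
    · have : Filter.Tendsto (fun u : ℝ => u / c) (nhds 0) (nhds (0 / c)) := by
        exact (continuous_id.div_const c).tendsto 0
      rw [zero_div] at this
      exact this.mono_left nhdsWithin_le_nhds
    · filter_upwards [self_mem_nhdsWithin] with u hu
      exact div_pos hu hc
  constructor
  · intro hlt
    have hlt : ((D.vertex i).1 : ℝ) < (D.vertex (i + 1)).1 := by exact_mod_cast hlt
    have hd0 : 0 < d := by rw [← hδ']; exact mul_pos (by linarith) (by positivity)
    filter_upwards [(htend d hd0).eventually hl] with u hu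
    rwa [div_mul_cancel₀ _ hd0.ne'] at hu
  · intro hlt
    have hlt : ((D.vertex (i + 1)).1 : ℝ) < (D.vertex i).1 := by exact_mod_cast hlt
    have hd0 : 0 < -d := by rw [← hδ', ← neg_mul]; exact mul_pos (by linarith) (by positivity)
    filter_upwards [(htend (-d) hd0).eventually hl] with u hu
    rw [div_neg, neg_mul, div_mul_cancel₀ _ (neg_pos.1 hd0).ne] at hu
    rwa [sub_neg_eq_add, ← sub_eq_add_neg] at hu

end DobrushinDomain

end Geometry

end QuantumIsing
end

/-! ### The diagram of a generic configuration of a Dobrushin domain. -/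

noncomputable section
namespace QuantumIsing

section DomainLayers

namespace DobrushinDomain

variable {δ : ℝ} {D : DobrushinDomain δ}

/-- The line of the cut has the parity opposite to that of the vertices of the arc, so the cut is
interior to a horizontal segment, which then contains the mid-edges on both of its sides. -/
lemma exists_covers_of_boundaryCut (hδ : 0 < δ) {c : ℤ} {t : ℝ} (h : (c, t) ∈ D.boundaryCuts) :
    ∃ i < D.r + D.s + 2, D.Covers i (c - 1) t ∧ D.Covers i c t ∧
      ((Odd c ∧ i < D.r) ∨ (Even c ∧ D.r < i ∧ i < D.r + D.s + 1)) := by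
  have key : ∀ i < D.r + D.s + 2, medialPos δ (c, t) ∈ D.boundarySegment i →
      c ≠ (D.vertex i).1 → c ≠ (D.vertex (i + 1)).1 → D.Covers i (c - 1) t ∧ D.Covers i c t := by
    intro i hi hm h1 h2
    rcases (mem_boundarySegment hi).1 hm with ⟨-, h3, -⟩ | ⟨-, h4, h5, h6⟩
    · have h7 := (medial_le_medial hδ).1 h3.le
      have h8 := (medial_le_medial hδ).1 h3.ge
      omega
    · rw [medialPos, medial_mem_uIcc hδ] at h6
      have h5 : t = (D.vertex i).2 := h5
      refine ⟨⟨h5.symm, (h5.trans h4).symm, ?_, ?_⟩, ⟨h5.symm, (h5.trans h4).symm, ?_, ?_⟩⟩ <;>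
        simp only at h6 <;> omega
  have hpar : ∀ {a b : ℤ}, Odd a → Even b → a ≠ b := fun ha hb h =>
    (Int.not_even_iff_odd.2 ha) (h ▸ hb)
  rcases h with ⟨hc, hm⟩ | ⟨hc, hm⟩
  · simp only [primalArc, Set.mem_iUnion, Set.mem_Iio, exists_prop] at hm
    obtain ⟨i, hi, hm⟩ := hm
    obtain ⟨h1, h2⟩ := key i (by omega) hm (hpar hc (D.primal i hi.le)) (hpar hc (D.primal _ hi))
    exact ⟨i, by omega, h1, h2, Or.inl ⟨hc, hi⟩⟩
  · simp only [dualArc, Set.mem_iUnion, Set.mem_Ioo, exists_prop] at hm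
    obtain ⟨i, hi, hm⟩ := hm
    obtain ⟨h1, h2⟩ := key i (by omega) hm (hpar (D.dual i hi.1 (by omega)) hc).symm
      (hpar (D.dual _ (by omega) (by omega)) hc).symm
    exact ⟨i, by omega, h1, h2, Or.inr ⟨hc, hi⟩⟩

lemma height_of_boundaryCut (hδ : 0 < δ) {p : ℤ × ℝ} (h : p ∈ D.boundaryCuts) :
    p.2 ∈ D.heights := by
  obtain ⟨i, hi, h, -⟩ := exists_covers_of_boundaryCut hδ (c := p.1) (t := p.2) h
  exact h.1 ▸ D.vertex_mem_heights hi.le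

lemma covers_bMid : D.Covers D.r D.bMid.1 D.bMid.2 := by
  have h := D.b_edge
  have h2 : (D.vertex D.r).2 = (D.vertex (D.r + 1)).2 := by
    rcases D.axis D.r (by omega) with ⟨h1, -⟩ | ⟨-, h1⟩
    · rw [h1, sub_self] at h; simp at h
    · exact h1
  refine ⟨rfl, h2.symm, le_rfl, ?_⟩
  simp only [bMid, bBlack, bWhite]
  rcases abs_eq (zero_le_one' ℤ) |>.1 h with h | h <;> omega

lemma covers_aMid : D.Covers (D.r + D.s + 1) D.aMid.1 D.aMid.2 := by
  have h := D.a_edge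
  have h2 := D.axis (D.r + D.s + 1) (by omega)
  rw [show D.r + D.s + 1 + 1 = D.r + D.s + 2 from rfl, D.closed] at h2
  have h2 : (D.vertex (D.r + D.s + 1)).2 = (D.vertex 0).2 := by
    rcases h2 with ⟨h1, -⟩ | ⟨-, h1⟩
    · rw [h1, sub_self] at h; simp at h
    · exact h1
  refine ⟨h2, by rw [show D.r + D.s + 1 + 1 = D.r + D.s + 2 from rfl, D.closed]; rfl, ?_, ?_⟩ <;>
    rw [show D.r + D.s + 1 + 1 = D.r + D.s + 2 from rfl, D.closed] <;> simp only [aMid]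
  · omega
  · rcases abs_eq (zero_le_one' ℤ) |>.1 h with h | h <;> omega

/-- The mid-edges on the boundary curve. -/
lemma frontier_cases (hδ : 0 < δ) {j : ℤ} {t : ℝ} (h : midEdgePos δ (j, t) ∈ frontier D.carrier) :
    (j, t) = D.aMid ∨ (j, t) = D.bMid ∨ (j, t) ∈ D.boundaryCuts ∨ (j + 1, t) ∈ D.boundaryCuts := by
  obtain ⟨i, hi, hc⟩ := (midEdge_mem_frontier hδ).1 h
  have hmem : ∀ c : ℤ, min (D.vertex i).1 (D.vertex (i + 1)).1 ≤ c →
      c ≤ max (D.vertex i).1 (D.vertex (i + 1)).1 → medialPos δ (c, t) ∈ D.boundarySegment i := by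
    intro c h1 h2
    refine (mem_boundarySegment hi).2 (Or.inr ⟨?_, hc.1.trans hc.2.1.symm, hc.1.symm, ?_⟩)
    · have := hc.2.2; omega
    · rw [medialPos, medial_mem_uIcc hδ]; exact ⟨h1, h2⟩
  have hm1 := hmem j hc.2.2.1 (by have := hc.2.2; omega)
  have hm2 := hmem (j + 1) (by have := hc.2.2; omega) hc.2.2.2
  have hpar : Even j ∧ Odd (j + 1) ∨ Odd j ∧ Even (j + 1) := by
    rcases Int.even_or_odd j with hj | hj
    · exact Or.inl ⟨hj, hj.add_one⟩
    · exact Or.inr ⟨hj, hj.add_one⟩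
  rcases lt_trichotomy i D.r with hir | rfl | hir
  · have hP : ∀ z ∈ D.boundarySegment i, z ∈ D.primalArc := fun z hz => by
      simp only [primalArc, Set.mem_iUnion, Set.mem_Iio, exists_prop]; exact ⟨i, hir, hz⟩
    rcases hpar with ⟨-, hj⟩ | ⟨hj, -⟩
    · exact Or.inr (Or.inr (Or.inr (Or.inl ⟨hj, hP _ hm2⟩)))
    · exact Or.inr (Or.inr (Or.inl (Or.inl ⟨hj, hP _ hm1⟩)))
  · refine Or.inr (Or.inl (Prod.ext ?_ hc.1.symm))
    have h1 := (covers_bMid (D := D)).2.2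
    have h2 := hc.2.2
    have h3 := D.b_edge
    simp only [bMid, bBlack, bWhite] at h1 ⊢
    rcases abs_eq (zero_le_one' ℤ) |>.1 h3 with h | h <;> omega
  · rcases (Nat.lt_succ_iff.1 hi).eq_or_lt with hi' | hi'
    · have hv : D.vertex (i + 1) = D.vertex 0 := by
        rw [hi', show D.r + D.s + 1 + 1 = D.r + D.s + 2 from rfl, D.closed]
      refine Or.inl (Prod.ext ?_ ?_)
      · have h2 := hc.2.2
        have h3 := D.a_edge
        rw [hv, hi'] at h2
        simp only [aMid]
        rcases abs_eq (zero_le_one' ℤ) |>.1 h3 with h | h <;> omega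
      · rw [← hc.2.1, hv]; rfl
    · have hP : ∀ z ∈ D.boundarySegment i, z ∈ D.dualArc := fun z hz => by
        simp only [dualArc, Set.mem_iUnion, Set.mem_Ioo, exists_prop]; exact ⟨i, ⟨hir, hi'⟩, hz⟩
      rcases hpar with ⟨hj, -⟩ | ⟨-, hj⟩
      · exact Or.inr (Or.inr (Or.inl (Or.inr ⟨hj, hP _ hm1⟩)))
      · exact Or.inr (Or.inr (Or.inr (Or.inr ⟨hj, hP _ hm2⟩)))

/-- The mid-edges next to a boundary cut are on the boundary curve. -/
lemma frontier_of_boundaryCut (hδ : 0 < δ) {j c : ℤ} {t : ℝ} (h : (c, t) ∈ D.boundaryCuts)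
    (hc : c = j ∨ c = j + 1) : midEdgePos δ (j, t) ∈ frontier D.carrier := by
  obtain ⟨i, hi, h1, h2, -⟩ := exists_covers_of_boundaryCut hδ h
  rw [midEdge_mem_frontier hδ]
  rcases hc with rfl | rfl
  · exact ⟨i, hi, h2⟩
  · exact ⟨i, hi, by simpa using h1⟩

/-! #### Generic configurations -/

variable (D) in
/-- A finite configuration in the domain without coincidences of heights. -/
structure IsGeneric (C : Set (ℤ × ℝ)) : Prop where
  finite : C.Finite
  inj : Set.InjOn Prod.snd C
  off : ∀ p ∈ C, p.2 ∉ D.heights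
  mem : ∀ p ∈ C, medialPos δ p ∈ D.carrier

lemma IsGeneric.mono {C C' : Set (ℤ × ℝ)} (h : D.IsGeneric C) (hC : C' ⊆ C) : D.IsGeneric C' :=
  ⟨h.finite.subset hC, h.inj.mono hC, fun p hp => h.off p (hC hp), fun p hp => h.mem p (hC hp)⟩

variable (D) in
/-- A change of heights that sends all the events to half-integers following an even integer. -/
structure IsAdapted (C : Set (ℤ × ℝ)) (ψ : ℝ ≃o ℝ) : Prop where
  heights : ∀ h ∈ D.heights, ∃ r : ℤ, Even r ∧ ψ h = r + 1 / 2
  points : ∀ p ∈ C, ∃ r : ℤ, Even r ∧ ψ p.2 = r + 1 / 2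

lemma IsAdapted.mono {C C' : Set (ℤ × ℝ)} {ψ : ℝ ≃o ℝ} (h : D.IsAdapted C ψ) (hC : C' ⊆ C) :
    D.IsAdapted C' ψ := ⟨h.heights, fun p hp => h.points p (hC hp)⟩

lemma IsGeneric.exists_adapted {C : Set (ℤ × ℝ)} (h : D.IsGeneric C) : ∃ ψ, D.IsAdapted C ψ := by
  classical
  obtain ⟨ψ, hψ⟩ := exists_orderIso_normalize (D.heights ∪ h.finite.toFinset.image Prod.snd)
  refine ⟨ψ, fun e he => hψ e (Finset.mem_union_left _ he), fun p hp => hψ _ ?_⟩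
  exact Finset.mem_union_right _ (Finset.mem_image_of_mem _ (h.finite.mem_toFinset.2 hp))

section Rows

variable {C : Set (ℤ × ℝ)} {ψ : ℝ ≃o ℝ}

lemma IsAdapted.cut (hδ : 0 < δ) (hψ : D.IsAdapted C ψ) {p : ℤ × ℝ} (hp : p ∈ D.cuts C) :
    ∃ r : ℤ, Even r ∧ ψ p.2 = r + 1 / 2 :=
  hp.elim (hψ.points p) fun h => hψ.heights _ (height_of_boundaryCut hδ h)

/-- In a mid-edge column the boundary can only be met at heights of vertices, and `ψ` sends these to
half-integers: only the levels between `t` and `t'` have to be examined. -/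
lemma IsAdapted.column_iff (hδ : 0 < δ) (hψ : D.IsAdapted C ψ) {j : ℤ} {t t' : ℝ}
    (h : ∀ r : ℤ, (r : ℝ) + 1 / 2 ∈ Set.uIcc t t' →
      midEdgePos δ (j, ψ.symm (r + 1 / 2)) ∉ frontier D.carrier) :
    midEdgePos δ (j, ψ.symm t) ∈ D.carrier ↔ midEdgePos δ (j, ψ.symm t') ∈ D.carrier := by
  refine mem_iff_of_uIcc fun u hu hf => ?_
  obtain ⟨r, -, hr⟩ := hψ.heights u (height_of_frontier hδ hf)
  refine h r ?_ (by rw [← hr, ψ.symm_apply_apply]; exact hf)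
  rw [← hr]
  rw [Set.mem_uIcc] at hu ⊢
  simpa [OrderIso.symm_apply_le, OrderIso.le_symm_apply] using hu

lemma IsAdapted.row_iff (hδ : 0 < δ) (hψ : D.IsAdapted C ψ) {j r : ℤ} {t : ℝ}
    (ht : |t - r| < 1 / 2) :
    midEdgePos δ (j, ψ.symm t) ∈ D.carrier ↔ midEdgePos δ (j, ψ.symm r) ∈ D.carrier := by
  refine hψ.column_iff hδ fun r' hr' => absurd hr' fun hr' => ?_
  rw [Set.mem_uIcc] at hr'
  rw [abs_lt] at ht
  have h1 : (r : ℝ) < r' + 1 := by rcases hr' with h | h <;> linarith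
  have h2 : (r' : ℝ) < r := by rcases hr' with h | h <;> linarith
  have h1 : r < r' + 1 := by exact_mod_cast h1
  have h2 : r' < r := by exact_mod_cast h2
  omega

lemma IsAdapted.level_iff (hδ : 0 < δ) (hψ : D.IsAdapted C ψ) {j r : ℤ}
    (h : midEdgePos δ (j, ψ.symm (r + 1 / 2)) ∉ frontier D.carrier) {t : ℝ}
    (ht : |t - (r + 1 / 2)| < 1) :
    midEdgePos δ (j, ψ.symm (r + 1 / 2)) ∈ D.carrier ↔ midEdgePos δ (j, ψ.symm t) ∈ D.carrier := by
  refine hψ.column_iff hδ fun r' hr' => ?_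
  rw [Set.mem_uIcc] at hr'
  rw [abs_lt] at ht
  have h1 : (r : ℝ) < r' + 1 := by rcases hr' with h | h <;> linarith
  have h2 : (r' : ℝ) < r + 1 := by rcases hr' with h | h <;> linarith
  have h1 : r < r' + 1 := by exact_mod_cast h1
  have h2 : r' < r + 1 := by exact_mod_cast h2
  rw [show r' = r by omega]
  exact h

/-- `Covers.sides` describes the immediate vicinity of the boundary segment. No boundary is met
inside a row, so the description extends to the integer heights just below and just above. -/
lemma IsAdapted.sides (hδ : 0 < δ) (hψ : D.IsAdapted C ψ) {i : ℕ} (hi : i < D.r + D.s + 2)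
    {j r : ℤ} (h : D.Covers i j (ψ.symm (r + 1 / 2))) :
    ((D.vertex i).1 < (D.vertex (i + 1)).1 → midEdgePos δ (j, ψ.symm (r + 1 : ℤ)) ∈ D.carrier ∧
      midEdgePos δ (j, ψ.symm r) ∉ D.carrier) ∧
    ((D.vertex (i + 1)).1 < (D.vertex i).1 → midEdgePos δ (j, ψ.symm r) ∈ D.carrier ∧
      midEdgePos δ (j, ψ.symm (r + 1 : ℤ)) ∉ D.carrier) := by
  set E := ψ.symm (r + 1 / 2) with hE
  have hcont : Filter.Tendsto (fun u => ψ (E + u)) (nhdsWithin 0 (Set.Ioi 0)) (nhds (r + 1 / 2)) := by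
    have : Filter.Tendsto (fun u => ψ (E + u)) (nhds 0) (nhds (ψ (E + 0))) :=
      (ψ.continuous.comp (continuous_const.add continuous_id)).tendsto 0
    rw [add_zero, hE, ψ.apply_symm_apply] at this
    exact this.mono_left nhdsWithin_le_nhds
  have hcont' : Filter.Tendsto (fun u => ψ (E - u)) (nhdsWithin 0 (Set.Ioi 0)) (nhds (r + 1 / 2)) := by
    have : Filter.Tendsto (fun u => ψ (E - u)) (nhds 0) (nhds (ψ (E - 0))) :=
      (ψ.continuous.comp (continuous_const.sub continuous_id)).tendsto 0
    rw [sub_zero, hE, ψ.apply_symm_apply] at this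
    exact this.mono_left nhdsWithin_le_nhds
  have habove : ∀ᶠ u in nhdsWithin 0 (Set.Ioi 0), (midEdgePos δ (j, E + u) ∈ D.carrier ↔
      midEdgePos δ (j, ψ.symm (r + 1 : ℤ)) ∈ D.carrier) := by
    filter_upwards [hcont.eventually (gt_mem_nhds (show (r : ℝ) + 1 / 2 < r + 1 by linarith)),
      self_mem_nhdsWithin] with u hu hu0
    have h1 : (r : ℝ) + 1 / 2 < ψ (E + u) := by
      have : ψ E < ψ (E + u) := ψ.lt_iff_lt.2 (by linarith [Set.mem_Ioi.1 hu0])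
      rwa [hE, ψ.apply_symm_apply] at this
    have := hψ.row_iff hδ (j := j) (r := r + 1) (t := ψ (E + u)) (by
      push_cast; rw [abs_lt]; constructor <;> linarith)
    rwa [ψ.symm_apply_apply] at this
  have hbelow : ∀ᶠ u in nhdsWithin 0 (Set.Ioi 0), (midEdgePos δ (j, E - u) ∈ D.carrier ↔
      midEdgePos δ (j, ψ.symm r) ∈ D.carrier) := by
    filter_upwards [hcont'.eventually (lt_mem_nhds (show (r : ℝ) < r + 1 / 2 by linarith)),
      self_mem_nhdsWithin] with u hu hu0
    have h1 : ψ (E - u) < (r : ℝ) + 1 / 2 := by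
      have : ψ (E - u) < ψ E := ψ.lt_iff_lt.2 (by linarith [Set.mem_Ioi.1 hu0])
      rwa [hE, ψ.apply_symm_apply] at this
    have := hψ.row_iff hδ (j := j) (r := r) (t := ψ (E - u)) (by
      rw [abs_lt]; constructor <;> linarith)
    rwa [ψ.symm_apply_apply] at this
  obtain ⟨h1, h2⟩ := h.sides hδ hi
  constructor
  · intro hlt
    obtain ⟨u, h3, h4, h5⟩ := ((h1 hlt).and (habove.and hbelow)).exists
    exact ⟨h4.1 h3.1, fun h => h3.2 (h5.2 h)⟩
  · intro hlt
    obtain ⟨u, h3, h4, h5⟩ := ((h2 hlt).and (habove.and hbelow)).exists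
    exact ⟨h5.1 h3.1, fun h => h3.2 (h4.2 h)⟩

lemma cut_cases (hδ : 0 < δ) (hC : D.IsGeneric C)
    {c : ℤ} {t : ℝ} (h : (c, t) ∈ D.cuts C) :
    (t ∉ D.heights ∧ (c, t) ∈ C ∧ midEdgePos δ (c - 1, t) ∈ D.carrier ∧
      midEdgePos δ (c, t) ∈ D.carrier) ∨ (t ∈ D.heights ∧ (c, t) ∈ D.boundaryCuts) := by
  rcases h with h | h
  · have h1 := hC.off _ h
    have h2 := midEdge_mem_of_medial hδ (hC.mem _ h)
    exact Or.inl ⟨h1, h, h2⟩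
  · exact Or.inr ⟨height_of_boundaryCut hδ h, h⟩

/-- No cut lies on either side of a marked mid-edge. -/
lemma not_cut_of_mark (hδ : 0 < δ) (hC : D.IsGeneric C) {i : ℕ} (hi : i = D.r ∨ i = D.r + D.s + 1)
    {j : ℤ} {t : ℝ} (h : D.Covers i j t) : (j, t) ∉ D.cuts C ∧ (j + 1, t) ∉ D.cuts C := by
  have ht : t ∈ D.heights := h.1 ▸ D.vertex_mem_heights (by omega)
  have key : ∀ c, c = j ∨ c = j + 1 → (c, t) ∉ D.cuts C := by
    intro c hc hcut
    rcases cut_cases hδ hC hcut with ⟨h1, -⟩ | ⟨-, h1⟩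
    · exact h1 ht
    · obtain ⟨i', hi', h3, h4, h5⟩ := exists_covers_of_boundaryCut hδ h1
      have h2 : D.Covers i' j t := by
        rcases hc with rfl | rfl
        · exact h4
        · simpa using h3
      have := h.unique hδ (by omega) hi' h2
      omega
  exact ⟨key _ (Or.inl rfl), key _ (Or.inr rfl)⟩

/-- Points of a generic configuration share no height, with each other or with the vertices. Two
adjacent boundary cuts would be on one segment, as they share a mid-edge, but their parities put
them on different arcs. -/
lemma cut_nonadj (hδ : 0 < δ) (hC : D.IsGeneric C) {c : ℤ} {t : ℝ} (h : (c, t) ∈ D.cuts C) :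
    (c + 1, t) ∉ D.cuts C := by
  intro h'
  rcases cut_cases hδ hC h with ⟨h1, h2, -⟩ | ⟨h1, h2⟩ <;>
    rcases cut_cases hδ hC h' with ⟨h3, h4, -⟩ | ⟨h3, h4⟩
  · have := congrArg Prod.fst (hC.inj h2 h4 rfl)
    simp at this
  · exact h1 h3
  · exact h3 h1
  · obtain ⟨i, hi, -, h5, h6⟩ := exists_covers_of_boundaryCut hδ h2
    obtain ⟨i', hi', h7, -, h8⟩ := exists_covers_of_boundaryCut hδ h4
    rw [add_sub_cancel_right] at h7
    have := h5.unique hδ hi hi' h7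
    rw [← Int.not_even_iff_odd] at h6 h8
    rw [Int.even_add_one] at h8
    rcases h6 with ⟨h6, h9⟩ | ⟨h6, h9⟩ <;> rcases h8 with ⟨h8, h10⟩ | ⟨h8, h10⟩
    · exact h8 h6
    · omega
    · omega
    · exact h8 h6

/-- Around a point of the configuration all four sites are inside. At a boundary cut, the two
columns are bordered by the same horizontal segment, with the domain on the same side of it. -/
lemma cut_sides (hδ : 0 < δ) (hC : D.IsGeneric C) (hψ : D.IsAdapted C ψ) {c r : ℤ}
    (h : (c, ψ.symm (r + 1 / 2)) ∈ D.cuts C) :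
    (midEdgePos δ (c - 1, ψ.symm r) ∈ D.carrier ↔ midEdgePos δ (c, ψ.symm r) ∈ D.carrier) ∧
    (midEdgePos δ (c - 1, ψ.symm (r + 1 : ℤ)) ∈ D.carrier ↔
      midEdgePos δ (c, ψ.symm (r + 1 : ℤ)) ∈ D.carrier) := by
  rcases cut_cases hδ hC h with ⟨-, -, h1, h2⟩ | ⟨-, h1⟩
  · have hr : ∀ j, midEdgePos δ (j, ψ.symm (r + 1 / 2)) ∈ D.carrier →
        midEdgePos δ (j, ψ.symm r) ∈ D.carrier ∧ midEdgePos δ (j, ψ.symm (r + 1 : ℤ)) ∈ D.carrier :=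
      fun j hj => ⟨(hψ.level_iff hδ (not_mem_frontier_of_mem hj) (by rw [abs_lt]; constructor <;>
        linarith)).1 hj, (hψ.level_iff hδ (not_mem_frontier_of_mem hj) (by
        push_cast; rw [abs_lt]; constructor <;> linarith)).1 hj⟩
    simp only [hr _ h1, hr _ h2, iff_self, and_self]
  · obtain ⟨i, hi, h2, h3, -⟩ := exists_covers_of_boundaryCut hδ h1
    obtain ⟨h4, h5⟩ := hψ.sides hδ hi h2
    obtain ⟨h6, h7⟩ := hψ.sides hδ hi h3
    rcases lt_trichotomy (D.vertex i).1 (D.vertex (i + 1)).1 with hl | hl | hl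
    · have h4 := h4 hl
      have h6 := h6 hl
      tauto
    · have := h2.2.2; omega
    · have h5 := h5 hl
      have h7 := h7 hl
      tauto

lemma aMid_mem_heights : D.aMid.2 ∈ D.heights := D.vertex_mem_heights (by omega)

lemma bMid_mem_heights : D.bMid.2 ∈ D.heights := D.vertex_mem_heights (by omega)

lemma IsAdapted.floor (hψ : D.IsAdapted C ψ) {t : ℝ} (ht : t ∈ D.heights) :
    (⌊ψ t⌋ : ℝ) + 1 / 2 = ψ t := by
  obtain ⟨r, -, hr⟩ := hψ.heights t ht
  have : ⌊ψ t⌋ = r := Int.floor_eq_iff.2 ⟨by linarith, by linarith⟩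
  rw [this, hr]

lemma IsAdapted.symm_floor (hψ : D.IsAdapted C ψ) {t : ℝ} (ht : t ∈ D.heights) :
    ψ.symm ((⌊ψ t⌋ : ℝ) + 1 / 2) = t := by
  rw [hψ.floor ht, ψ.symm_apply_apply]

lemma eq_mark {j r : ℤ} {p : ℤ × ℝ} (h : (j, ψ.symm (r + 1 / 2)) = p) :
    (j, r) = (p.1, ⌊ψ p.2⌋) := by
  subst h
  simp only [ψ.apply_symm_apply, Prod.mk.injEq, true_and]
  exact (Int.floor_eq_iff.2 ⟨by linarith, by linarith⟩).symm

lemma finite_sites (hδ : 0 < δ) (ψ : ℝ ≃o ℝ) :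
    {x : ℤ × ℤ | midEdgePos δ (x.1, ψ.symm x.2) ∈ D.carrier}.Finite := by
  obtain ⟨R, hR⟩ := D.isBounded.subset_closedBall 0
  refine ((Set.finite_Icc (-⌈4 * R / δ⌉ - 1) ⌈4 * R / δ⌉).prod
    (Set.finite_Icc ⌊ψ (-R)⌋ ⌈ψ R⌉)).subset ?_
  rintro ⟨j, r⟩ h
  have h1 := hR h
  rw [mem_closedBall_zero_iff] at h1
  have h2 := abs_le.1 ((Complex.abs_re_le_norm _).trans h1)
  have h3 := abs_le.1 ((Complex.abs_im_le_norm _).trans h1)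
  simp only [midEdgePos] at h2 h3
  have hc := Int.le_ceil (4 * R / δ)
  have h4 : 2 * (j : ℝ) + 1 ≤ 4 * R / δ := by rw [le_div_iff₀ hδ]; linarith
  have h5 : -(4 * R / δ) ≤ 2 * (j : ℝ) + 1 := by
    rw [← neg_div, div_le_iff₀ hδ]; linarith
  have h6 : 2 * j + 1 ≤ ⌈4 * R / δ⌉ := by exact_mod_cast h4.trans hc
  have h7 : -⌈4 * R / δ⌉ ≤ 2 * j + 1 := by exact_mod_cast (neg_le_neg hc).trans h5
  have h8 : ψ (-R) ≤ r := by rw [← ψ.le_symm_apply]; exact h3.1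
  have h9 : (r : ℝ) ≤ ψ R := by rw [← ψ.symm_apply_le]; exact h3.2
  refine ⟨⟨?_, ?_⟩, ?_, ?_⟩
  · simp only; omega
  · simp only; omega
  · exact_mod_cast (Int.floor_le _).trans h8
  · exact_mod_cast h9.trans (Int.le_ceil _)

lemma not_frontier_of_pass (hδ : 0 < δ) {j r : ℤ}
    (h1 : (j, ψ.symm (r + 1 / 2)) ∉ D.cuts C) (h2 : (j + 1, ψ.symm (r + 1 / 2)) ∉ D.cuts C)
    (ha : (j, r) ≠ (D.aMid.1, ⌊ψ D.aMid.2⌋)) (hb : (j, r) ≠ (D.bMid.1, ⌊ψ D.bMid.2⌋)) :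
    midEdgePos δ (j, ψ.symm (r + 1 / 2)) ∉ frontier D.carrier := by
  intro hf
  rcases frontier_cases hδ hf with h | h | h | h
  · exact ha (eq_mark h)
  · exact hb (eq_mark h)
  · exact h1 (Or.inr h)
  · exact h2 (Or.inr h)

/-- The boundary goes from the primal to the dual end of this mid-edge, with the domain on its left.
In an even column the primal end is to the west and the domain is above, in an odd column it is
below: in both cases the direction of travel leads out of the domain. -/
lemma bMid_sides (hδ : 0 < δ) (hψ : D.IsAdapted C ψ) :
    (Even D.bMid.1 → midEdgePos δ (D.bMid.1, ψ.symm (⌊ψ D.bMid.2⌋ + 1 : ℤ)) ∈ D.carrier ∧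
      midEdgePos δ (D.bMid.1, ψ.symm ⌊ψ D.bMid.2⌋) ∉ D.carrier) ∧
    (Odd D.bMid.1 → midEdgePos δ (D.bMid.1, ψ.symm ⌊ψ D.bMid.2⌋) ∈ D.carrier ∧
      midEdgePos δ (D.bMid.1, ψ.symm (⌊ψ D.bMid.2⌋ + 1 : ℤ)) ∉ D.carrier) := by
  have hs := hψ.sides hδ (i := D.r) (by omega) (j := D.bMid.1) (r := ⌊ψ D.bMid.2⌋) (by
    rw [hψ.symm_floor bMid_mem_heights]; exact covers_bMid)
  have h1 := D.primal D.r le_rfl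
  have h2 := D.dual (D.r + 1) (by omega) (by omega)
  have h3 : D.bMid.1 = min (D.vertex D.r).1 (D.vertex (D.r + 1)).1 := rfl
  rw [← Int.not_even_iff_odd] at h2
  constructor
  · intro h
    refine hs.1 ?_
    by_contra hlt
    rw [h3, min_eq_right (by omega)] at h
    exact h2 h
  · intro h
    refine hs.2 ?_
    by_contra hlt
    rw [h3, min_eq_left (by omega), ← Int.not_even_iff_odd] at h
    exact h h1

lemma aMid_sides (hδ : 0 < δ) (hψ : D.IsAdapted C ψ) :
    (Even D.aMid.1 → midEdgePos δ (D.aMid.1, ψ.symm ⌊ψ D.aMid.2⌋) ∈ D.carrier ∧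
      midEdgePos δ (D.aMid.1, ψ.symm (⌊ψ D.aMid.2⌋ + 1 : ℤ)) ∉ D.carrier) ∧
    (Odd D.aMid.1 → midEdgePos δ (D.aMid.1, ψ.symm (⌊ψ D.aMid.2⌋ + 1 : ℤ)) ∈ D.carrier ∧
      midEdgePos δ (D.aMid.1, ψ.symm ⌊ψ D.aMid.2⌋) ∉ D.carrier) := by
  have hs := hψ.sides hδ (i := D.r + D.s + 1) (by omega) (j := D.aMid.1) (r := ⌊ψ D.aMid.2⌋) (by
    rw [hψ.symm_floor aMid_mem_heights]; exact covers_aMid)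
  rw [show D.r + D.s + 1 + 1 = D.r + D.s + 2 from rfl, D.closed] at hs
  have h1 := D.primal 0 (by omega)
  have h2 := D.dual (D.r + D.s + 1) (by omega) (by omega)
  have h3 : D.aMid.1 = min (D.vertex 0).1 (D.vertex (D.r + D.s + 1)).1 := rfl
  have h4 : (D.vertex 0).1 ≠ (D.vertex (D.r + D.s + 1)).1 := fun h => by
    rw [← Int.not_even_iff_odd, ← h] at h2; exact h2 h1
  rw [← Int.not_even_iff_odd] at h2
  constructor
  · intro h
    refine hs.2 ?_
    by_contra hlt
    rw [h3, min_eq_right (by omega)] at h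
    exact h2 h
  · intro h
    refine hs.1 ?_
    by_contra hlt
    rw [h3, min_eq_left (by omega), ← Int.not_even_iff_odd] at h
    exact h h1

/-- The discrete diagram of a generic configuration. -/
def layers (hδ : 0 < δ) (hC : D.IsGeneric C) (hψ : D.IsAdapted C ψ) : Layers where
  site := {x | midEdgePos δ (x.1, ψ.symm x.2) ∈ D.carrier}
  cut := {x | (x.1, ψ.symm (x.2 + 1 / 2)) ∈ D.cuts C}
  a := (D.aMid.1, ⌊ψ D.aMid.2⌋)
  b := (D.bMid.1, ⌊ψ D.bMid.2⌋)
  finite := finite_sites hδ ψ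
  -- Adapted maps put every event on a level of even index, so two consecutive levels cannot both
  -- carry cuts.
  isolated c c' r h h' := by
    obtain ⟨r₁, h1, h2⟩ := hψ.cut hδ h
    obtain ⟨r₂, h3, h4⟩ := hψ.cut hδ h'
    rw [ψ.apply_symm_apply] at h2 h4
    have h2 : r = r₁ := by exact_mod_cast add_right_cancel h2
    have h4 : r + 1 = r₂ := by exact_mod_cast add_right_cancel h4
    rw [← h4, Int.even_add_one, h2] at h3
    exact h3 h1
  nonadj c r h := cut_nonadj hδ hC h
  below c r h := (cut_sides hδ hC hψ h).1
  above c r h := (cut_sides hδ hC hψ h).2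
  pass j r h1 h2 ha hb := by
    have hf := not_frontier_of_pass hδ h1 h2 ha hb
    exact (hψ.level_iff hδ hf (by rw [abs_lt]; constructor <;> linarith)).symm.trans
      (hψ.level_iff hδ hf (by push_cast; rw [abs_lt]; constructor <;> linarith))
  a_cut := not_cut_of_mark hδ hC (Or.inr rfl) (by
    rw [hψ.symm_floor aMid_mem_heights]; exact covers_aMid)
  b_cut := not_cut_of_mark hδ hC (Or.inl rfl) (by
    rw [hψ.symm_floor bMid_mem_heights]; exact covers_bMid)
  a_even := (aMid_sides hδ hψ).1
  a_odd := (aMid_sides hδ hψ).2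
  b_even := (bMid_sides hδ hψ).1
  b_odd := (bMid_sides hδ hψ).2

variable (D) in
/-- The strand system of a configuration. -/
def system (C : Set (ℤ × ℝ)) : System :=
  ⟨{e | midEdgePos δ e ∈ D.carrier}, D.cuts C, D.aMid, D.bMid⟩

lemma mem_map_strip {j : ℤ} {t : ℝ} :
    (j, t) ∈ ((D.system C).map ψ).strip ↔ midEdgePos δ (j, ψ.symm t) ∈ D.carrier := by
  have := System.lift_mem_image ψ (A := (D.system C).strip) (p := (j, ψ.symm t))
  rw [lift, ψ.apply_symm_apply] at this
  exact this

lemma mem_map_cuts {c : ℤ} {t : ℝ} :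
    (c, t) ∈ ((D.system C).map ψ).cuts ↔ (c, ψ.symm t) ∈ D.cuts C := by
  have := System.lift_mem_image ψ (A := (D.system C).cuts) (p := (c, ψ.symm t))
  rw [lift, ψ.apply_symm_apply] at this
  exact this

lemma midEdge_not_mem_of_covers (hδ : 0 < δ) {i : ℕ} (hi : i < D.r + D.s + 2) {e : ℤ × ℝ}
    (h : D.Covers i e.1 e.2) : midEdgePos δ e ∉ D.carrier := fun hm =>
  not_mem_frontier_of_mem hm ((midEdge_mem_frontier hδ).2 ⟨i, hi, h⟩)

lemma aMid_not_mem (hδ : 0 < δ) : midEdgePos δ D.aMid ∉ D.carrier :=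
  midEdge_not_mem_of_covers hδ (by omega) covers_aMid

lemma bMid_not_mem (hδ : 0 < δ) : midEdgePos δ D.bMid ∉ D.carrier :=
  midEdge_not_mem_of_covers hδ (by omega) covers_bMid

theorem discrete (hδ : 0 < δ) (hC : D.IsGeneric C) (hψ : D.IsAdapted C ψ) :
    ((D.system C).map ψ).Discrete (layers hδ hC hψ) where
  strip_iff j r t ht := mem_map_strip.trans (hψ.row_iff hδ ht)
  cut_iff c t := by
    rw [mem_map_cuts]
    constructor
    · intro h
      obtain ⟨r, -, hr⟩ := hψ.cut hδ h
      rw [ψ.apply_symm_apply] at hr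
      exact ⟨r, hr, by rw [hr] at h; exact h⟩
    · rintro ⟨r, rfl, h⟩
      exact h
  through j r h1 h2 ha hb hs := by
    have hf := not_frontier_of_pass hδ h1 h2 ha hb
    exact mem_map_strip.2 ((hψ.level_iff hδ hf (by rw [abs_lt]; constructor <;> linarith)).2 hs)
  near j r h := by
    have h := mem_map_strip.1 h
    have hf := not_mem_frontier_of_mem h
    exact ⟨(hψ.level_iff hδ hf (by rw [abs_lt]; constructor <;> linarith)).1 h,
      (hψ.level_iff hδ hf (by push_cast; rw [abs_lt]; constructor <;> linarith)).1 h⟩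
  a_eq := Prod.ext rfl (hψ.floor aMid_mem_heights).symm
  b_eq := Prod.ext rfl (hψ.floor bMid_mem_heights).symm
  a_not_mem h := aMid_not_mem hδ ((System.lift_mem_image ψ).1 h)
  b_not_mem h := bMid_not_mem hδ ((System.lift_mem_image ψ).1 h)

/-! #### Comparison of the two descriptions of strands -/

lemma path_iff {e e' : ℤ × ℝ} {w : ℤ} : D.Path C e e' w ↔ (D.system C).Strand e e' w := by
  constructor
  · intro h
    induction h with
    | straight h1 h2 => exact System.Strand.straight h1 h2
    | east h1 h2 h3 _ ih => exact System.Strand.east h1 h2 h3 ih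
    | west h1 h2 h3 _ ih => exact System.Strand.west h1 h2 h3 ih
  · intro h
    induction h with
    | straight h1 h2 => exact Path.straight h1 h2
    | east h1 h2 h3 _ ih => exact Path.east h1 h2 h3 ih
    | west h1 h2 h3 _ ih => exact Path.west h1 h2 h3 ih

lemma path_eq : D.Path C = (D.system C).Strand :=
  funext fun _ => funext fun _ => funext fun _ => propext path_iff

lemma reach_eq : D.Reach C = (D.system C).Reach := by
  funext e e'
  rw [Reach, System.Reach, path_eq]

lemma numLoops_eq : D.numLoops C = (D.system C).numLoops := by
  rw [numLoops, System.numLoops, loops, System.loops, reach_eq]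
  rfl

/-- A rotation by π contributes exp(iπ/2) = i, and both sides choose a winding from the same
predicate. -/
lemma spin_eq (e : ℤ × ℝ) : D.spin C e = (D.system C).spin e := by
  have hint : D.interface C = (D.system C).interface := by
    rw [interface, System.interface, reach_eq]; rfl
  by_cases h : e ∈ (D.system C).interface
  · have hw : ∃ w, D.Path C e D.bMid w := by rw [path_eq]; exact h.2.2
    rw [spin, if_pos (hint ▸ h), System.spin, dif_pos h, winding, dif_pos hw]
    have hch : hw.choose = (h.2.2).choose := by
      congr 1
      rw [path_eq]
      rfl
    have hI : ∀ n : ℤ, Complex.I ^ n = Complex.exp (n * (Real.pi / 2 * Complex.I)) := fun n => by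
      rw [Complex.exp_int_mul, ← Complex.log_I, Complex.exp_log Complex.I_ne_zero]
    rw [hch, hI]
    push_cast
    congr 1
    ring
  · rw [spin, if_neg (hint ▸ h), System.spin, dif_neg h]

end Rows

end DobrushinDomain

end DomainLayers

end QuantumIsing
end

/-! ### Effect of one additional cut on loops and spins. -/

noncomputable section
namespace QuantumIsing

section Jump

/-- The diagram `L'` is obtained from `L` by adding a cut on an empty level. -/
structure Layers.AddCut (L L' : Layers) (c r : ℤ) : Prop where
  b_eq : L'.b = L.b
  cut_iff : ∀ q, q ∈ L'.cut ↔ q ∈ L.cut ∨ q = (c, r)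
  level : ∀ c', (c', r) ∉ L.cut
  b_level : L.b.2 ≠ r

/-- The site of a column from which a given level is crossed. -/
def entry (j r : ℤ) : ℤ × ℤ := (j, if Even j then r + 1 else r)

/-- The site of a column reached by crossing a given level. -/
def exit (j r : ℤ) : ℤ × ℤ := (j, if Even j then r else r + 1)

lemma fwdLevel_entry (j r : ℤ) : fwdLevel (entry j r) = r := by
  unfold fwdLevel entry; split_ifs <;> simp

lemma fwdRow_entry (j r : ℤ) : (j, fwdRow (entry j r)) = exit j r := by
  unfold fwdRow entry exit; split_ifs <;> simp

lemma eq_entry {x : ℤ × ℤ} {r : ℤ} (h : fwdLevel x = r) : x = entry x.1 r := by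
  unfold fwdLevel at h
  refine Prod.ext rfl ?_
  simp only [entry]
  split_ifs at h ⊢ <;> omega

lemma entry_sub_one (c r : ℤ) : (c - 1, (entry c r).2) = exit (c - 1) r := by
  simp only [entry, exit, Int.even_sub_one]
  split_ifs <;> simp_all

lemma entry_add_one (c r : ℤ) : (c, (entry (c - 1) r).2) = exit c r := by
  simp only [entry, exit, Int.even_sub_one]
  split_ifs <;> simp_all

namespace Layers.AddCut

variable {L L' : Layers} {c r : ℤ}

lemma next_entry (h : L.AddCut L' c r) (j : ℤ) :
    L.next (entry j r) = exit j r ∧ L.turn (entry j r) = 0 := by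
  have hb : (j, r) ≠ L.b := fun hb => h.b_level (congrArg Prod.snd hb).symm
  have h1 : (entry j r).1 = j := rfl
  constructor
  · rw [next, fwdLevel_entry, if_neg (h.level _), if_neg (h.level _), h1, if_neg hb, fwdRow_entry]
  · rw [turn, fwdLevel_entry, if_neg (h.level _), if_neg (h.level _)]

/-- With `next_left` and `next_entry`: the new cut exchanges the successors of its two entries, and
both strands rotate by the same amount because they travel in opposite directions and turn towards
each other. -/
lemma next_right (h : L.AddCut L' c r) :
    L'.next (entry c r) = exit (c - 1) r ∧ L'.turn (entry c r) = dir c := by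
  have h1 : (entry c r).1 = c := rfl
  have hc : (c, r) ∈ L'.cut := (h.cut_iff _).2 (Or.inr rfl)
  have hc' : (c + 1, r) ∉ L'.cut := L'.nonadj _ _ hc
  constructor
  · rw [next, fwdLevel_entry, h1, if_neg hc', if_pos hc, entry_sub_one]
  · rw [turn, fwdLevel_entry, h1, if_neg hc', if_pos hc, eastTurn, dir]; split_ifs <;> rfl

lemma next_left (h : L.AddCut L' c r) :
    L'.next (entry (c - 1) r) = exit c r ∧ L'.turn (entry (c - 1) r) = dir c := by
  have h1 : (entry (c - 1) r).1 = c - 1 := rfl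
  have hc : (c, r) ∈ L'.cut := (h.cut_iff _).2 (Or.inr rfl)
  constructor
  · rw [next, fwdLevel_entry, h1, sub_add_cancel, if_pos hc, entry_add_one]
  · rw [turn, fwdLevel_entry, h1, sub_add_cancel, if_pos hc, eastTurn, dir]
    simp only [Int.even_sub_one]; split_ifs <;> simp_all

lemma next_other (h : L.AddCut L' c r) (ha : L'.aSite = L.aSite) {x : ℤ × ℤ} (h1 : x ≠ entry c r)
    (h2 : x ≠ entry (c - 1) r) : L'.next x = L.next x ∧ L'.turn x = L.turn x := by
  have e1 : (x.1 + 1, fwdLevel x) ∈ L'.cut ↔ (x.1 + 1, fwdLevel x) ∈ L.cut := by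
    rw [h.cut_iff, or_iff_left]
    intro he
    obtain ⟨h3, h4⟩ := Prod.ext_iff.1 he
    exact h2 ((eq_entry h4).trans (by simp only at h3; rw [show x.1 = c - 1 by omega]))
  have e2 : (x.1, fwdLevel x) ∈ L'.cut ↔ (x.1, fwdLevel x) ∈ L.cut := by
    rw [h.cut_iff, or_iff_left]
    intro he
    obtain ⟨h3, h4⟩ := Prod.ext_iff.1 he
    exact h1 ((eq_entry h4).trans (by simp only at h3; rw [h3]))
  by_cases a1 : (x.1 + 1, fwdLevel x) ∈ L.cut
  · simp [next, turn, a1, e1.2 a1]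
  by_cases a2 : (x.1, fwdLevel x) ∈ L.cut
  · simp [next, turn, a1, a2, e1.not.2 a1, e2.2 a2]
  simp [next, turn, a1, a2, e1.not.2 a1, e2.not.2 a2, h.b_eq, ha]

end Layers.AddCut

lemma entry_ne (c r : ℤ) : entry c r ≠ entry (c - 1) r := fun h => by
  have := congrArg Prod.fst h
  simp only [entry] at this
  omega

/-- Rounding in the direction of travel assigns the midpoint to the site that follows the level. -/
lemma toSite_level (j r : ℤ) : toSite (j, (r : ℝ) + 1 / 2) = exit j r := by
  refine Prod.ext rfl (row_iff.2 ?_)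
  simp only [exit]
  rcases dir_cases j with ⟨hj, hd⟩ | ⟨hj, hd⟩
  · rw [hd, if_pos hj]; push_cast; constructor <;> linarith
  · rw [hd, if_neg hj]; push_cast; constructor <;> linarith

/-- The effect of a new cut on the number of loops and on the spin. -/
theorem System.Discrete.jump {S S' : System} {L L' : Layers} (D : S.Discrete L)
    (D' : S'.Discrete L') {c r : ℤ} (h : L.AddCut L' c r) (hs : L'.site = L.site)
    (ha : L'.a = L.a)
    (h1 : entry c r ∈ L.site) (h2 : entry (c - 1) r ∈ L.site) :
    S'.numLoops ≤ S.numLoops + 1 ∧ (∀ j j' : ℤ, j = c ∧ j' = c - 1 ∨ j = c - 1 ∧ j' = c →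
      ((√2 : ℝ) : ℂ) ^ S'.numLoops * (S'.spin (toPoint (entry j r)) - S'.spin (toPoint (exit j r))) =
      √2 * (dir c * Complex.I) * ((√2 : ℝ) : ℂ) ^ S.numLoops * S.spin (toPoint (exit j' r))) := by
  have hasite : L'.aSite = L.aSite := by rw [Layers.aSite, Layers.aSite, ha]
  have hbsite : L'.bSite = L.bSite := by rw [Layers.bSite, Layers.bSite, h.b_eq]
  -- The two diagrams have the same sites only propositionally; the permutation of `L'` is
  -- transported to the site type of `L` so that both permutations can be compared.
  have transfer : ∀ s, L'.site = s → ∀ b : s, (b : ℤ × ℤ) = L'.bSite →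
      ∃ σ : Equiv.Perm s, (∀ x, ((σ x : s) : ℤ × ℤ) = L'.next x) ∧
        Transported σ (fun x => Complex.I ^ L'.turn x) b (fun x => S'.spin (toPoint x)) ∧
        NegativeCycles σ (fun x => Complex.I ^ L'.turn x) b ∧ numCycles σ = S'.numLoops + 1 := by
    rintro _ rfl b hb
    obtain rfl : b = L'.last := Subtype.ext hb
    exact ⟨L'.perm, fun _ => rfl, D'.transported, L'.negativeCycles, D'.numCycles_eq⟩
  obtain ⟨σ', hσ', hT', hN', hn'⟩ := transfer _ hs L.last hbsite.symm
  have hlast : ∀ (j : ℤ) (hj : entry j r ∈ L.site), (⟨entry j r, hj⟩ : L.site) ≠ L.last := by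
    intro j hj he
    have he : entry j r = L.bSite := congrArg Subtype.val he
    have h3 := congrArg fwdLevel he
    rw [fwdLevel_entry] at h3
    refine h.b_level (h3.trans ?_).symm
    unfold fwdLevel Layers.bSite
    split_ifs <;> simp
  let x : L.site := ⟨entry c r, h1⟩
  let y : L.site := ⟨entry (c - 1) r, h2⟩
  have hx : (L.perm x : ℤ × ℤ) = exit c r := (h.next_entry c).1
  have hy : (L.perm y : ℤ × ℤ) = exit (c - 1) r := (h.next_entry (c - 1)).1
  have hsw : SwapAt L.perm σ' x y :=
    ⟨fun he => entry_ne c r (congrArg Subtype.val he),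
      Subtype.ext ((hσ' x).trans (h.next_right.1.trans hy.symm)),
      Subtype.ext ((hσ' y).trans (h.next_left.1.trans hx.symm)),
      fun z hzx hzy => Subtype.ext ((hσ' z).trans (h.next_other hasite
        (fun he => hzx (Subtype.ext he)) (fun he => hzy (Subtype.ext he))).1)⟩
  have hsw' : SwapAt L.perm σ' y x := ⟨hsw.ne.symm, hsw.right, hsw.left,
    fun z h1 h2 => hsw.other z h2 h1⟩
  have hι : (Complex.I ^ dir c) ^ 2 = -1 := by
    rcases dir_cases c with ⟨-, hd⟩ | ⟨-, hd⟩ <;> rw [hd] <;> simp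
  have hι' : Complex.I ^ dir c = dir c * Complex.I := by
    rcases dir_cases c with ⟨-, hd⟩ | ⟨-, hd⟩ <;> rw [hd] <;> simp
  have hθ : ∀ z : L.site, z ≠ x → z ≠ y → Complex.I ^ L'.turn z = Complex.I ^ L.turn z :=
    fun z hzx hzy => by
      rw [(h.next_other hasite (fun he => hzx (Subtype.ext he))
        (fun he => hzy (Subtype.ext he))).2]
  have hx1 : Complex.I ^ L.turn x = 1 := by rw [(h.next_entry c).2, zpow_zero]
  have hy1 : Complex.I ^ L.turn y = 1 := by rw [(h.next_entry (c - 1)).2, zpow_zero]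
  have hx2 : Complex.I ^ L'.turn x = Complex.I ^ dir c := by rw [h.next_right.2]
  have hy2 : Complex.I ^ L'.turn y = Complex.I ^ dir c := by rw [h.next_left.2]
  have hT := D.transported
  have e1 := hsw.jump hι (hlast _ h1) (hlast _ h2) hT hT' hθ hx1 hy1 hx2 hy2 L.negativeCycles hN'
  have e2 := hsw'.jump hι (hlast _ h2) (hlast _ h1) hT hT' (fun z a b => hθ z b a) hy1 hx1 hy2 hx2
    L.negativeCycles hN'
  -- Without the new cut the level is crossed without turning, so the old spin is the same at the
  -- entry and at the exit of a column.
  have hfx := hT.step x (hlast _ h1)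
  have hfy := hT.step y (hlast _ h2)
  simp only [hx1, hy1, one_mul, hx, hy] at hfx hfy
  rw [hn', D.numCycles_eq, hι'] at e1 e2
  simp only [hx, hy, hfx, hfy] at e1 e2
  -- There is one more cycle than loops in both diagrams; the common factor √2 cancels.
  have h0 : ((√2 : ℝ) : ℂ) ≠ 0 := by exact_mod_cast (Real.sqrt_pos.2 zero_lt_two).ne'
  refine ⟨?_, ?_⟩
  · by_cases hc : L.perm.SameCycle x y
    · have := hsw.numCycles_of_sameCycle hc
      rw [hn', D.numCycles_eq] at this
      omega
    · have := hsw.numCycles_of_not hc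
      rw [hn', D.numCycles_eq] at this
      omega
  rintro j j' (⟨rfl, rfl⟩ | ⟨rfl, rfl⟩)
  · exact mul_left_cancel₀ h0 (by linear_combination e1)
  · exact mul_left_cancel₀ h0 (by linear_combination e2)

lemma System.Discrete.spin_eq_of_clear {S : System} {L : Layers} (D : S.Discrete L) {j : ℤ}
    {y y' : ℝ} (h : ∀ t ∈ Set.uIcc y y', S.Clear j t) : S.spin (j, y) = S.spin (j, y') := by
  have key : ∀ y y' : ℝ, (∀ t ∈ Set.uIcc y y', S.Clear j t) → Forward j y y' →
      S.spin (j, y) = S.spin (j, y') := by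
    intro y y' h hf
    have he : (j, y) ∈ S.regular := h y Set.left_mem_uIcc
    have he' : (j, y') ∈ S.regular := h y' Set.right_mem_uIcc
    have hst : S.Strand (j, y) (j, y') 0 := System.Strand.straight (Or.inr hf) fun t ht =>
      h t ⟨ht.1.le, ht.2.le⟩
    obtain ⟨_, ⟨w, h1, h2, h3⟩ | ⟨-, h1, -⟩⟩ := D.run_of_strand hst he'
    · have hstep := Layers.Run.step h1 h3
      rw [← h2] at hstep
      by_cases hc : L.perm.SameCycle (D.siteOf ⟨_, he'⟩) L.last
      · obtain ⟨u, hu⟩ := Layers.exists_run_last hc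
        have hu' := hstep.trans hu
        rw [zero_add] at hu'
        rw [D.spin_of_run he hu', D.spin_of_run he' hu]
      · rw [D.spin_of_not he' hc, D.spin_of_not he fun hc' => hc (hstep.sameCycle.symm.trans hc')]
    · exact D.spin_eq_of_site_eq he he' h1
  rcases lt_trichotomy ((dir j : ℝ) * y) (dir j * y') with hl | hl | hl
  · exact key y y' h (forward_iff.2 hl)
  · rcases dir_cases j with ⟨-, hd⟩ | ⟨-, hd⟩
    · rw [hd] at hl; push_cast at hl; rw [show y = y' by linarith]
    · rw [hd] at hl; push_cast at hl; rw [show y = y' by linarith]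
  · exact (key y' y (by rwa [Set.uIcc_comm]) (forward_iff.2 hl)).symm

namespace DobrushinDomain

variable {δ : ℝ} {D : DobrushinDomain δ} {C : Set (ℤ × ℝ)}

/-- A boundary cut beside the point would place its mid-edge on the boundary curve, so only points
of the configuration can obstruct. -/
lemma clear_of_mem (hδ : 0 < δ) {j : ℤ} {t : ℝ} (h : midEdgePos δ (j, t) ∈ D.carrier)
    (hC : ∀ q ∈ C, q.1 = j ∨ q.1 = j + 1 → q.2 ≠ t) : (D.system C).Clear j t := by
  have key : ∀ c, c = j ∨ c = j + 1 → (c, t) ∉ D.cuts C := by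
    rintro c hc (h' | h')
    · exact hC _ h' hc rfl
    · exact not_mem_frontier_of_mem h (frontier_of_boundaryCut hδ h' hc)
  exact ⟨h, key _ (Or.inl rfl), key _ (Or.inr rfl)⟩

lemma clear_map_iff {ψ : ℝ ≃o ℝ} {j : ℤ} {t : ℝ} :
    ((D.system C).map ψ).Clear j t ↔ (D.system C).Clear j (ψ.symm t) := by
  rw [System.Clear, System.Clear, mem_map_strip, mem_map_cuts, mem_map_cuts]
  rfl

lemma spin_map_eq (ψ : ℝ ≃o ℝ) (j : ℤ) (t : ℝ) :
    D.spin C (j, t) = ((D.system C).map ψ).spin (j, ψ t) := by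
  rw [spin_eq, ← System.spin_map ψ]
  rfl

/-- The spin is constant along the vertical segments of the domain without event. -/
lemma spin_eq_of_clear (hδ : 0 < δ) (hC : D.IsGeneric C) {j : ℤ} {y y' : ℝ}
    (h : ∀ t ∈ Set.uIcc y y', (D.system C).Clear j t) : D.spin C (j, y) = D.spin C (j, y') := by
  obtain ⟨ψ, hψ⟩ := hC.exists_adapted
  rw [spin_map_eq ψ, spin_map_eq ψ]
  refine (discrete hδ hC hψ).spin_eq_of_clear fun t ht => clear_map_iff.2 (h _ ?_)
  rw [Set.mem_uIcc] at ht ⊢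
  simpa [OrderIso.symm_apply_le, OrderIso.le_symm_apply] using ht

/-- The effect of an additional point on the loops and on the spin. -/
theorem jump (hδ : 0 < δ) {p : ℤ × ℝ} (hp : p ∉ C) (hC : D.IsGeneric (insert p C)) :
    D.numLoops (insert p C) ≤ D.numLoops C + 1 ∧
    ∀ (j : ℤ) (y y' : ℝ), y < p.2 → p.2 < y' →
      (∀ t ∈ Set.Icc y y', midEdgePos δ (j, t) ∈ D.carrier) →
      (∀ q ∈ C, q.1 = j ∨ q.1 = j + 1 → q.2 ∉ Set.Icc y y') →
      (p.1 = j → ((√2 : ℝ) : ℂ) ^ D.numLoops (insert p C) *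
          (D.spin (insert p C) (j, y') - D.spin (insert p C) (j, y)) =
        -(Complex.I * √2 * (((√2 : ℝ) : ℂ) ^ D.numLoops C * D.spin C (j - 1, p.2)))) ∧
      (p.1 = j + 1 → ((√2 : ℝ) : ℂ) ^ D.numLoops (insert p C) *
          (D.spin (insert p C) (j, y') - D.spin (insert p C) (j, y)) =
        Complex.I * √2 * (((√2 : ℝ) : ℂ) ^ D.numLoops C * D.spin C (j + 1, p.2))) := by
  obtain ⟨c, h⟩ := p
  obtain ⟨ψ, hψ'⟩ := hC.exists_adapted
  have hC0 : D.IsGeneric C := hC.mono (Set.subset_insert _ _)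
  have hψ : D.IsAdapted C ψ := hψ'.mono (Set.subset_insert _ _)
  obtain ⟨r, hr, hψr⟩ := hψ'.points _ (Set.mem_insert _ _)
  have hsymm : ψ.symm (r + 1 / 2) = h := by rw [← hψr, ψ.symm_apply_apply]
  have hh : h ∉ D.heights := hC.off _ (Set.mem_insert _ _)
  -- By genericity the height of the new point carries no other cut: its level is empty in the old
  -- diagram.
  have hlev : ∀ c', (c', h) ∉ D.cuts C := by
    rintro c' (h1 | h1)
    · have := hC.inj (Set.mem_insert_of_mem _ h1) (Set.mem_insert (c, h) C) rfl
      exact hp (this ▸ h1)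
    · exact hh (height_of_boundaryCut hδ h1)
  have D0 := discrete hδ hC0 hψ
  have D1 := discrete hδ hC hψ'
  have hadd : (layers hδ hC0 hψ).AddCut (layers hδ hC hψ') c r := by
    refine ⟨rfl, fun ⟨c', r'⟩ => ?_, fun c' => ?_, fun he => ?_⟩
    · change (c', ψ.symm (r' + 1 / 2)) ∈ (insert (c, h) C) ∪ D.boundaryCuts ↔
        (c', ψ.symm (r' + 1 / 2)) ∈ C ∪ D.boundaryCuts ∨ (c', r') = (c, r)
      have : (c', ψ.symm (r' + 1 / 2)) = (c, h) ↔ (c', r') = (c, r) := by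
        rw [Prod.mk.injEq, Prod.mk.injEq, ← hsymm, ψ.symm.injective.eq_iff]
        simp
      rw [Set.insert_union, Set.mem_insert_iff, this, or_comm]
    · change (c', ψ.symm (r + 1 / 2)) ∉ D.cuts C
      rw [hsymm]; exact hlev c'
    · change ⌊ψ D.bMid.2⌋ = r at he
      have := hψ.symm_floor (D.bMid_mem_heights)
      rw [he, hsymm] at this
      exact hh (this ▸ D.bMid_mem_heights)
  have hm := midEdge_mem_of_medial hδ (hC.mem _ (Set.mem_insert _ _))
  have hrows : ∀ j, midEdgePos δ (j, h) ∈ D.carrier →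
      midEdgePos δ (j, ψ.symm r) ∈ D.carrier ∧ midEdgePos δ (j, ψ.symm (r + 1 : ℤ)) ∈ D.carrier := by
    intro j hj
    rw [← hsymm] at hj
    exact ⟨(hψ.level_iff hδ (not_mem_frontier_of_mem hj) (by rw [abs_lt]; constructor <;>
      linarith)).1 hj, (hψ.level_iff hδ (not_mem_frontier_of_mem hj) (by
      push_cast; rw [abs_lt]; constructor <;> linarith)).1 hj⟩
  have hentry : ∀ j, midEdgePos δ (j, h) ∈ D.carrier → entry j r ∈ (layers hδ hC0 hψ).site := by
    intro j hj
    by_cases hj' : Even j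
    · rw [entry, if_pos hj']; exact (hrows j hj).2
    · rw [entry, if_neg hj']; exact (hrows j hj).1
  obtain ⟨hle, hjump⟩ := D0.jump D1 hadd rfl rfl (hentry c hm.2) (hentry (c - 1) hm.1)
  rw [System.numLoops_map, System.numLoops_map, ← numLoops_eq, ← numLoops_eq] at hle
  refine ⟨hle, fun j y y' hy hy' hmem hno => ?_⟩
  have hclear : ∀ t, y ≤ t → t ≤ y' → t ≠ h → (D.system (insert (c, h) C)).Clear j t := by
    intro t h1 h2 h3
    refine clear_of_mem hδ (hmem t ⟨h1, h2⟩) fun q hq hqj hqt => ?_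
    rcases hq with rfl | hq
    · exact h3 hqt.symm
    · exact hno q hq hqj (hqt ▸ ⟨h1, h2⟩)
  have hjm := hrows j (hmem h ⟨hy.le, hy'.le⟩)
  -- No event separates `y'` from the row just above the new point, so the spin can be evaluated at
  -- a site; `hbelow` does the same for `y`.
  have habove : D.spin (insert (c, h) C) (j, y') =
      ((D.system (insert (c, h) C)).map ψ).spin (toPoint (j, r + 1)) := by
    rw [spin_map_eq ψ]
    have hy'r : (r : ℝ) + 1 / 2 < ψ y' := by rw [← hψr]; exact ψ.lt_iff_lt.2 hy'
    refine D1.spin_eq_of_clear fun t ht => ?_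
    rw [Set.mem_uIcc] at ht
    push_cast at ht
    have ht' : (r : ℝ) + 1 / 2 < t := by rcases ht with ht | ht <;> linarith
    by_cases hty : t ≤ ψ y'
    · rw [clear_map_iff]
      have : h < ψ.symm t := by rw [← hsymm]; exact ψ.symm.lt_iff_lt.2 ht'
      exact hclear _ (by linarith) ((ψ.symm_apply_le).2 hty) this.ne'
    · exact D1.clear_of_site (r := r + 1) (by
        push_cast; rw [abs_lt]; constructor <;> rcases ht with ht | ht <;> linarith) hjm.2
  have hbelow : D.spin (insert (c, h) C) (j, y) =
      ((D.system (insert (c, h) C)).map ψ).spin (toPoint (j, r)) := by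
    rw [spin_map_eq ψ]
    have hyr : ψ y < (r : ℝ) + 1 / 2 := by rw [← hψr]; exact ψ.lt_iff_lt.2 hy
    refine D1.spin_eq_of_clear fun t ht => ?_
    rw [Set.mem_uIcc] at ht
    have ht' : t < (r : ℝ) + 1 / 2 := by
      simp only at ht
      rcases ht with ht | ht <;> linarith
    by_cases hty : ψ y ≤ t
    · rw [clear_map_iff]
      have : ψ.symm t < h := by rw [← hsymm]; exact ψ.symm.lt_iff_lt.2 ht'
      exact hclear _ ((ψ.le_symm_apply).2 hty) (by linarith) this.ne
    · exact D1.clear_of_site (r := r) (by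
        simp only at ht
        rw [abs_lt]; constructor <;> rcases ht with ht | ht <;> linarith) hjm.1
  -- The diagram compares entry and exit, the window compares above and below; the two differ by the
  -- direction of travel.
  have horient : ∀ S : System, S.spin (toPoint (j, r + 1)) - S.spin (toPoint (j, r)) =
      -(dir j * (S.spin (toPoint (entry j r)) - S.spin (toPoint (exit j r)))) := by
    intro S
    rcases dir_cases j with ⟨hj, hd⟩ | ⟨hj, hd⟩
    · rw [hd, entry, exit, if_pos hj, if_pos hj]; push_cast; ring
    · rw [hd, entry, exit, if_neg hj, if_neg hj]; push_cast; ring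
  have hexit : ∀ j', j' = c - 1 ∨ j' = c → midEdgePos δ (j', h) ∈ D.carrier →
      ((D.system C).map ψ).spin (toPoint (exit j' r)) = D.spin C (j', h) := by
    intro j' hj' hmj
    rw [spin_map_eq ψ, hψr]
    have hreg : (j', (r : ℝ) + 1 / 2) ∈ ((D.system C).map ψ).regular := by
      rw [System.regular_iff]
      change ((D.system C).map ψ).Clear j' (r + 1 / 2)
      rw [clear_map_iff, hsymm]
      exact ⟨hmj, hlev _, hlev _⟩
    have hsite : exit j' r ∈ (layers hδ hC0 hψ).site := by
      rw [← toSite_level]; exact D0.toSite_mem_of_regular hreg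
    refine D0.spin_eq_of_site_eq (D0.regular_toPoint ⟨_, hsite⟩) hreg ?_
    rw [toSite_toPoint, toSite_level]
  have hdd : ((dir c : ℤ) : ℂ) * dir c = 1 := by exact_mod_cast dir_mul_dir c
  rw [habove, hbelow, horient]
  rw [numLoops_eq, numLoops_eq, ← System.numLoops_map ψ, ← System.numLoops_map (S := D.system C) ψ]
  constructor
  · rintro hcj
    obtain rfl : c = j := hcj
    have e := hjump c (c - 1) (Or.inl ⟨rfl, rfl⟩)
    rw [hexit _ (Or.inl rfl) hm.1] at e
    linear_combination (-(dir c : ℂ)) * e - Complex.I * √2 * (((√2 : ℝ) : ℂ) ^ ((D.system C).map ψ).numLoops * D.spin C (c - 1, h)) * hdd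
  · rintro hcj
    obtain rfl : j = c - 1 := by simp only at hcj; omega
    have e := hjump (c - 1) c (Or.inr ⟨rfl, rfl⟩)
    rw [hexit _ (Or.inr rfl) hm.2] at e
    rw [sub_add_cancel, dir_sub_one]
    push_cast
    linear_combination (dir c : ℂ) * e + Complex.I * √2 * (((√2 : ℝ) : ℂ) ^ ((D.system C).map ψ).numLoops * D.spin C (c, h)) * hdd

end DobrushinDomain

end Jump

end QuantumIsing
end

/-! ### Variation of the weighted spin along a vertical window. -/

noncomputable section
namespace QuantumIsing

section Windows

namespace DobrushinDomain

variable {δ : ℝ} {D : DobrushinDomain δ} {C : Set (ℤ × ℝ)}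

/-- Horizontal segments between a medial point and one of the adjacent mid-edges. -/
lemma not_mem_frontier_of_near (hδ : 0 < δ) {c : ℤ} {x t : ℝ} (ht : t ∉ D.heights)
    (hx : |x - c * (δ / 2)| ≤ δ / 4) (hx' : x ≠ c * (δ / 2)) :
    (⟨x, t⟩ : ℂ) ∉ frontier D.carrier := by
  intro hf
  obtain ⟨i, hi, hm⟩ := mem_frontier_iff.1 hf
  rcases (mem_boundarySegment hi).1 hm with ⟨h1, h2, h3⟩ | ⟨h1, h2, h3, h4⟩
  · simp only at h2 h3
    rw [abs_le] at hx
    have h4 : (c : ℝ) < (D.vertex i).1 + 1 := by nlinarith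
    have h5 : ((D.vertex i).1 : ℝ) < c + 1 := by nlinarith
    have h4 : c < (D.vertex i).1 + 1 := by exact_mod_cast h4
    have h5 : (D.vertex i).1 < c + 1 := by exact_mod_cast h5
    rw [show (D.vertex i).1 = c by omega] at h2
    exact hx' h2
  · simp only at h3
    exact ht (h3 ▸ D.vertex_mem_heights hi.le)

/-- A medial point between two mid-edges of the domain is in the domain. -/
lemma medial_mem_of_midEdges (hδ : 0 < δ) {c : ℤ} {t : ℝ} (ht : t ∉ D.heights)
    (h1 : midEdgePos δ (c - 1, t) ∈ D.carrier) (h2 : midEdgePos δ (c, t) ∈ D.carrier) :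
    medialPos δ (c, t) ∈ D.carrier := by
  have e1 : midEdgePos δ (c - 1, t) = ⟨c * (δ / 2) - δ / 4, t⟩ := by
    apply Complex.ext
    · simp only [midEdgePos]; push_cast; ring
    · rfl
  have e2 : midEdgePos δ (c, t) = ⟨c * (δ / 2) + δ / 4, t⟩ := by
    apply Complex.ext
    · simp only [midEdgePos]; ring
    · rfl
  have left : ∀ u, 0 < u → u ≤ δ / 4 → (⟨c * (δ / 2) - u, t⟩ : ℂ) ∈ D.carrier := by
    intro u hu hu'
    rw [e1] at h1
    refine (mem_iff_of_segment fun z hz => ?_).1 h1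
    obtain ⟨h3, h4⟩ := mem_segment_horizontal.1 hz
    rw [show z = ⟨z.re, t⟩ from Complex.ext rfl h4]
    rw [Set.uIcc_of_le (by linarith)] at h3
    refine not_mem_frontier_of_near hδ (c := c) ht ?_ (by linarith [h3.2] : z.re < c * (δ / 2)).ne
    rw [abs_le]; constructor <;> linarith [h3.1, h3.2]
  have right : ∀ u, 0 < u → u ≤ δ / 4 → (⟨c * (δ / 2) + u, t⟩ : ℂ) ∈ D.carrier := by
    intro u hu hu'
    rw [e2] at h2
    refine (mem_iff_of_segment fun z hz => ?_).1 h2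
    obtain ⟨h3, h4⟩ := mem_segment_horizontal.1 hz
    rw [show z = ⟨z.re, t⟩ from Complex.ext rfl h4]
    rw [Set.uIcc_of_ge (by linarith)] at h3
    refine not_mem_frontier_of_near hδ (c := c) ht ?_ (by linarith [h3.1] : c * (δ / 2) < z.re).ne'
    rw [abs_le]; constructor <;> linarith [h3.1, h3.2]
  -- At a height without vertices, the medial point could only be interior to a vertical boundary
  -- segment. The condition `left` would then put points outside the domain immediately on one side,
  -- but both sides are inside.
  by_cases hf : medialPos δ (c, t) ∈ frontier D.carrier
  · exfalso
    obtain ⟨i, hi, hm⟩ := mem_frontier_iff.1 hf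
    have hne : ∀ k ≤ D.r + D.s + 2, medialPos δ (c, t) ≠ medialPos δ (D.vertex k) := fun k hk he =>
      ht ((show t = (D.vertex k).2 from congrArg Complex.im he) ▸ D.vertex_mem_heights hk)
    rcases (mem_boundarySegment hi).1 hm with ⟨h3, h4, h5⟩ | ⟨-, -, h5, -⟩
    · have hl := D.left i hi _ (mem_openSegment_of_segment hm (hne _ hi.le) (hne _ hi))
      have hd : Complex.I * (medialPos δ (D.vertex (i + 1)) - medialPos δ (D.vertex i)) =
          ⟨(D.vertex i).2 - (D.vertex (i + 1)).2, 0⟩ := by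
        apply Complex.ext
        · simp [medialPos]
        · simp [medialPos, h3]
      rw [hd] at hl
      have hv : (D.vertex i).2 ≠ (D.vertex (i + 1)).2 := by
        rcases D.axis i hi with h | h
        · exact h.2
        · exact absurd h3 h.1
      generalize hdd : (D.vertex i).2 - (D.vertex (i + 1)).2 = d at hl
      have hd0 : d ≠ 0 := hdd ▸ sub_ne_zero.2 hv
      have hpos : 0 < δ / (4 * |d|) := by positivity
      obtain ⟨u, ⟨-, hu1⟩, hu2, hu3⟩ := (hl.and ((eventually_nhdsWithin_of_eventually_nhds
        (gt_mem_nhds hpos)).and self_mem_nhdsWithin)).exists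
      rw [lt_div_iff₀ (by positivity)] at hu2
      have hu3 : 0 < u := hu3
      apply hu1
      have hp : medialPos δ (c, t) - u * (⟨d, 0⟩ : ℂ) = ⟨c * (δ / 2) - u * d, t⟩ := by
        apply Complex.ext <;> simp [medialPos]
      rw [hp]
      rcases lt_or_gt_of_ne hd0 with hd0 | hd0
      · rw [abs_of_neg hd0] at hu2
        have := right (-(u * d)) (by nlinarith) (by nlinarith)
        rwa [← sub_eq_add_neg] at this
      · rw [abs_of_pos hd0] at hu2
        exact left (u * d) (by positivity) (by nlinarith)
    · exact ht ((show t = (D.vertex i).2 from h5) ▸ D.vertex_mem_heights hi.le)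
  · refine (mem_iff_of_segment (z := midEdgePos δ (c, t)) fun z hz => ?_).1 h2
    rw [e2] at hz
    obtain ⟨h3, h4⟩ := mem_segment_horizontal.1 hz
    rw [Set.uIcc_of_ge (by linarith)] at h3
    rw [show z = ⟨z.re, t⟩ from Complex.ext rfl h4]
    by_cases hz' : z.re = c * (δ / 2)
    · rw [hz']; exact hf
    · refine not_mem_frontier_of_near hδ (c := c) ht ?_ hz'
      rw [abs_le]; constructor <;> linarith [h3.1, h3.2]

/-! #### Invariance under the changes of heights that fix the vertices -/

/-- The boundary is met in a mid-edge column only at heights fixed by `ψ`, and an increasing map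
cannot carry `t` across or onto a fixed height. -/
lemma strip_invariant (hδ : 0 < δ) {ψ : ℝ ≃o ℝ} (hψ : ∀ h ∈ D.heights, ψ h = h) (j : ℤ) (t : ℝ) :
    midEdgePos δ (j, ψ t) ∈ D.carrier ↔ midEdgePos δ (j, t) ∈ D.carrier := by
  by_cases ht : ψ t = t
  · rw [ht]
  refine mem_iff_of_uIcc fun u hu hf => ?_
  have hfix := hψ u (height_of_frontier hδ hf)
  rcases Set.mem_uIcc.1 hu with ⟨h1, h2⟩ | ⟨h1, h2⟩
  · have : u ≤ ψ t := by rw [← hfix]; exact ψ.monotone h2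
    have h3 : ψ u = ψ t := hfix.trans (le_antisymm this h1)
    exact ht (h3 ▸ (hfix.trans (ψ.injective h3)))
  · have : ψ t ≤ u := by rw [← hfix]; exact ψ.monotone h1
    have h3 : ψ u = ψ t := hfix.trans (le_antisymm h2 this)
    exact ht (h3 ▸ (hfix.trans (ψ.injective h3)))

lemma system_image (hδ : 0 < δ) {ψ : ℝ ≃o ℝ} (hψ : ∀ h ∈ D.heights, ψ h = h) :
    D.system (lift ψ '' C) = (D.system C).map ψ := by
  have hb : ∀ p ∈ D.boundaryCuts, lift ψ p = p := fun p hp =>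
    Prod.ext rfl (hψ _ (height_of_boundaryCut hδ hp))
  have h1 : lift ψ '' D.boundaryCuts = D.boundaryCuts := by
    rw [Set.image_congr hb, Set.image_id']
  have h2 : {e | midEdgePos δ e ∈ D.carrier} = lift ψ '' {e | midEdgePos δ e ∈ D.carrier} := by
    ext e
    rw [← System.lift_lift_symm ψ e, System.lift_mem_image]
    exact strip_invariant hδ hψ _ _
  have ha : lift ψ D.aMid = D.aMid := Prod.ext rfl (hψ _ D.aMid_mem_heights)
  have hb' : lift ψ D.bMid = D.bMid := Prod.ext rfl (hψ _ D.bMid_mem_heights)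
  simp only [system, System.map, cuts, Set.image_union, h1, ← h2, ha, hb']

lemma numLoops_image (hδ : 0 < δ) {ψ : ℝ ≃o ℝ} (hψ : ∀ h ∈ D.heights, ψ h = h) :
    D.numLoops (lift ψ '' C) = D.numLoops C := by
  rw [numLoops_eq, system_image hδ hψ, System.numLoops_map, numLoops_eq]

lemma spin_image (hδ : 0 < δ) {ψ : ℝ ≃o ℝ} (hψ : ∀ h ∈ D.heights, ψ h = h) (e : ℤ × ℝ) :
    D.spin (lift ψ '' C) (lift ψ e) = D.spin C e := by
  rw [spin_eq, system_image hδ hψ, System.spin_map, spin_eq]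

end DobrushinDomain

/-! #### Piecewise constant functions -/

/-- The variation of a piecewise constant function is the sum of its jumps. -/
lemma sum_jumps {ι : Type*} (f : ℝ → ℂ) (A : Finset ι) (η : ι → ℝ) (J : ι → ℂ) {y₁ : ℝ} :
    ∀ y₂, y₁ ≤ y₂ → Set.InjOn η A → (∀ a ∈ A, η a ∈ Set.Ioo y₁ y₂) →
      (∀ y y', y₁ ≤ y → y ≤ y' → y' ≤ y₂ → (∀ a ∈ A, η a ∉ Set.Icc y y') → f y = f y') →
      (∀ a ∈ A, ∀ y y', y₁ ≤ y → y < η a → η a < y' → y' ≤ y₂ →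
        (∀ b ∈ A, b ≠ a → η b ∉ Set.Icc y y') → f y' - f y = J a) →
      f y₂ - f y₁ = ∑ a ∈ A, J a := by
  classical
  induction A using Finset.induction_on_max_value η with
  | empty =>
    intro y₂ hy _ _ hc _
    rw [hc y₁ y₂ le_rfl hy le_rfl (by simp), sub_self, Finset.sum_empty]
  | insert a s has hmax ih =>
    intro y₂ hy hinj hA hc hj
    have hlt : ∀ b ∈ s, η b < η a := fun b hb => lt_of_le_of_ne (hmax b hb) fun he =>
      has (hinj (by simp [hb]) (by simp) he ▸ hb)
    have ha := hA a (Finset.mem_insert_self a s)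
    -- A cut height `y` between the last jump and all the others: the induction hypothesis applies
    -- up to `y`, and a single jump remains after it.
    let T := insert y₁ (s.image η)
    have hT : T.Nonempty := ⟨y₁, Finset.mem_insert_self _ _⟩
    have hm : T.max' hT < η a := by
      rw [Finset.max'_lt_iff]
      intro t ht
      rcases Finset.mem_insert.1 ht with rfl | ht
      · exact ha.1
      · obtain ⟨b, hb, rfl⟩ := Finset.mem_image.1 ht
        exact hlt b hb
    obtain ⟨y, hy1, hy2⟩ := exists_between hm
    have hyT : ∀ t ∈ T, t < y := fun t ht => (T.le_max' t ht).trans_lt hy1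
    have h1 : y₁ < y := hyT _ (Finset.mem_insert_self _ _)
    have h2 : ∀ b ∈ s, η b < y := fun b hb =>
      hyT _ (Finset.mem_insert_of_mem (Finset.mem_image_of_mem _ hb))
    have e1 := ih y h1.le (hinj.mono (by simp)) (fun b hb =>
      ⟨(hA b (Finset.mem_insert_of_mem hb)).1, h2 b hb⟩) (fun u u' hu huu hu' hno =>
        hc u u' hu huu (by linarith [ha.2]) fun b hb => by
          rcases Finset.mem_insert.1 hb with rfl | hb
          · exact fun h => by linarith [h.2]
          · exact hno b hb) (fun b hb u u' hu hub hbu hu' hno =>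
        hj b (Finset.mem_insert_of_mem hb) u u' hu hub hbu (by linarith [ha.2]) fun b' hb' hne => by
          rcases Finset.mem_insert.1 hb' with rfl | hb'
          · exact fun h => by linarith [h.2]
          · exact hno b' hb' hne)
    have e2 := hj a (Finset.mem_insert_self a s) y y₂ h1.le hy2 ha.2 le_rfl fun b hb hne => by
      rcases Finset.mem_insert.1 hb with rfl | hb
      · exact absurd rfl hne
      · exact fun h => by linarith [h.1, h2 b hb]
    rw [Finset.sum_insert has, ← e1, ← e2]
    ring

namespace DobrushinDomain

variable {δ : ℝ} (D : DobrushinDomain δ)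

/-- The spin with the weight of the configuration. -/
def weight (C : Set (ℤ × ℝ)) (e : ℤ × ℝ) : ℂ := ((√2 : ℝ) : ℂ) ^ D.numLoops C * D.spin C e

/-- The contribution of a new point `p` to the variation of the weighted spin in the column `j`
between two heights. -/
def windowJump (j : ℤ) (y₁ y₂ : ℝ) (C : Set (ℤ × ℝ)) (p : ℤ × ℝ) : ℂ :=
  (if p.1 = j + 1 then (Set.Ioo y₁ y₂).indicator (fun t => D.weight C (j + 1, t)) p.2 else 0) -
    (if p.1 = j then (Set.Ioo y₁ y₂).indicator (fun t => D.weight C (j - 1, t)) p.2 else 0)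

variable {D}

/-- Between events the spin is constant, and at the event `x i` it jumps by the amount given by
`jump`. Each jump involves the configuration without `x i`, the form required by the Mecke formula.
-/
lemma weight_sub_eq_sum (hδ : 0 < δ) {ι : Type*} [Fintype ι] {x : ι → ℤ × ℝ}
    (hinj : Function.Injective x) (hC : D.IsGeneric (Set.range x)) {j : ℤ} {y₁ y₂ : ℝ}
    (hy : y₁ ≤ y₂) (hm : ∀ t ∈ Set.Icc y₁ y₂, midEdgePos δ (j, t) ∈ D.carrier)
    (hx : ∀ i, (x i).2 ≠ y₁ ∧ (x i).2 ≠ y₂) :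
    D.weight (Set.range x) (j, y₂) - D.weight (Set.range x) (j, y₁) =
      Complex.I * √2 * ∑ i, D.windowJump j y₁ y₂ (x '' {i}ᶜ) (x i) := by
  classical
  let A : Finset ι := {i | ((x i).1 = j ∨ (x i).1 = j + 1) ∧ (x i).2 ∈ Set.Ioo y₁ y₂}
  have hmemA : ∀ i, i ∈ A ↔ ((x i).1 = j ∨ (x i).1 = j + 1) ∧ (x i).2 ∈ Set.Ioo y₁ y₂ := fun i => by
    simp [A]
  have hrange : ∀ i, Set.range x = insert (x i) (x '' {i}ᶜ) := fun i => by
    rw [← Set.image_insert_eq, ← Set.image_univ]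
    congr 1
    ext k; simp [em]
  have hbetween : ∀ i y y', y₁ ≤ y → y' ≤ y₂ → (x i).2 ∈ Set.Icc y y' → (x i).2 ∈ Set.Ioo y₁ y₂ :=
    fun i y y' h1 h2 h3 => ⟨lt_of_le_of_ne (h1.trans h3.1) (hx i).1.symm,
      lt_of_le_of_ne (h3.2.trans h2) (hx i).2⟩
  have hsum := sum_jumps (fun y => D.weight (Set.range x) (j, y)) A (fun i => (x i).2)
    (fun i => Complex.I * √2 * D.windowJump j y₁ y₂ (x '' {i}ᶜ) (x i)) y₂ hy
    (fun i _ k _ h => hinj (hC.inj ⟨i, rfl⟩ ⟨k, rfl⟩ h)) (fun i hi => ((hmemA i).1 hi).2)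
    (fun y y' h1 h2 h3 h4 => by
      rw [weight, weight, spin_eq_of_clear hδ hC]
      rw [Set.uIcc_of_le h2]
      intro t ht
      refine clear_of_mem hδ (hm t ⟨h1.trans ht.1, ht.2.trans h3⟩) ?_
      rintro _ ⟨i, rfl⟩ hi rfl
      exact h4 i ((hmemA i).2 ⟨hi, hbetween i y y' h1 h3 ht⟩) ht)
    (fun i hi y y' h1 h2 h3 h4 h5 => by
      have hi := (hmemA i).1 hi
      have hni : x i ∉ x '' {i}ᶜ := by
        rintro ⟨k, hk, he⟩; exact hk (hinj he)
      have hj := (jump hδ hni (hrange i ▸ hC)).2 j y y' h2 h3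
        (fun t ht => hm t ⟨h1.trans ht.1, ht.2.trans h4⟩) (by
          rintro _ ⟨k, hk, rfl⟩ hkj hky
          exact h5 k ((hmemA k).2 ⟨hkj, hbetween k y y' h1 h4 hky⟩) hk hky)
      rw [← hrange i] at hj
      simp only [weight, windowJump, Set.indicator_of_mem hi.2]
      rcases hi.1 with h6 | h6
      · rw [if_neg (by omega), if_pos h6]
        linear_combination hj.1 h6
      · rw [if_pos h6, if_neg (by omega)]
        linear_combination hj.2 h6)
  rw [hsum, Finset.mul_sum]
  refine Finset.sum_subset (Finset.subset_univ _) fun i _ hi => ?_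
  rw [hmemA] at hi
  rw [windowJump]
  by_cases h1 : (x i).2 ∈ Set.Ioo y₁ y₂
  · rw [if_neg fun h => hi ⟨Or.inr h, h1⟩, if_neg fun h => hi ⟨Or.inl h, h1⟩]; simp
  · rw [Set.indicator_of_notMem h1, Set.indicator_of_notMem h1]; simp

/-- The number of loops grows at most like the number of points. -/
lemma numLoops_le (hδ : 0 < δ) {C : Set (ℤ × ℝ)} (hC : D.IsGeneric C) :
    D.numLoops C ≤ D.numLoops ∅ + C.ncard := by
  induction C, hC.finite using Set.Finite.induction_on with
  | empty => simp
  | @insert p C hp hf ih =>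
    have := ih (hC.mono (Set.subset_insert _ _))
    rw [Set.ncard_insert_of_notMem hp hf]
    have := (jump hδ hp hC).1
    omega

lemma norm_spin_le (C : Set (ℤ × ℝ)) (e : ℤ × ℝ) : ‖D.spin C e‖ ≤ 1 := by
  rw [spin]
  split_ifs
  · rw [show Complex.I / 2 * (D.winding C e : ℂ) = ((D.winding C e / 2 : ℝ) : ℂ) * Complex.I by
      push_cast; ring, Complex.norm_exp_ofReal_mul_I]
  · simp

end DobrushinDomain

end Windows

end QuantumIsing
end

noncomputable section
namespace QuantumIsing

/-! ### Poisson point processes -/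

section Poisson

lemma measurableSet_sigma_iff {ι : Type*} {E : ι → Type*} [∀ i, MeasurableSpace (E i)]
    {s : Set (Sigma E)} : MeasurableSet s ↔ ∀ i, MeasurableSet (Sigma.mk i ⁻¹' s) :=
  MeasurableSpace.measurableSet_iInf

lemma measurableEmbedding_sigma {ι : Type*} {E : ι → Type*} [∀ i, MeasurableSpace (E i)] (i : ι) :
    MeasurableEmbedding (Sigma.mk i : E i → Sigma E) where
  injective := sigma_mk_injective
  measurable := fun _ hs => measurableSet_sigma_iff.1 hs i
  measurableSet_image' := fun {s} hs => by
    refine measurableSet_sigma_iff.2 fun k => ?_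
    by_cases hk : k = i
    · subst hk
      rwa [Set.preimage_image_eq _ sigma_mk_injective]
    · convert MeasurableSet.empty
      ext x
      simp only [Set.mem_preimage, Set.mem_image, Set.mem_empty_iff_false, iff_false]
      rintro ⟨y, -, hy⟩
      exact hk (congrArg Sigma.fst hy).symm

lemma measurable_prod_sigma {ι A Y : Type*} [Countable ι] {E : ι → Type*}
    [∀ i, MeasurableSpace (E i)] [MeasurableSpace A] [MeasurableSpace Y] {F : A × Sigma E → Y}
    (h : ∀ i, Measurable fun q : A × E i => F (q.1, ⟨i, q.2⟩)) : Measurable F := by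
  intro s hs
  have : F ⁻¹' s = ⋃ i, Prod.map id (Sigma.mk i) '' ((fun q : A × E i => F (q.1, ⟨i, q.2⟩)) ⁻¹' s) := by
    ext ⟨a, i, x⟩
    simp only [Set.mem_preimage, Set.mem_iUnion, Set.mem_image, Prod.exists, Prod.map_apply, id]
    constructor
    · intro hx; exact ⟨i, a, x, hx, rfl⟩
    · rintro ⟨i', a', x', hx, he⟩
      obtain ⟨rfl, he⟩ := Prod.mk.inj he
      rwa [← he]
  rw [this]
  exact MeasurableSet.iUnion fun i =>
    (MeasurableEmbedding.id.prodMap (measurableEmbedding_sigma i)).measurableSet_image.2 (h i hs)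

variable {X : Type*} [MeasurableSpace X] {Λ : Measure X}

lemma ae_poissonLaw {p : Points X → Prop}
    (h : ∀ n, ∀ᵐ x ∂Measure.pi (fun _ : Fin n => Λ), p ⟨n, x⟩) : ∀ᵐ ω ∂poissonLaw Λ, p ω :=
  Measure.ae_sum_iff.2 fun n => Measure.ae_smul_measure ((measurableEmbedding_sigma n).ae_map_iff.2 (h n)) _

variable (Λ) in
/-- The weight of the configurations with `n` points. -/
def poissonWeight (n : ℕ) : ℝ := Real.exp (-(Λ Set.univ).toReal) / n.factorial

lemma poissonWeight_pos (n : ℕ) : 0 < poissonWeight Λ n :=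
  div_pos (Real.exp_pos _) (by exact_mod_cast n.factorial_pos)

/-- Marking one of n + 1 points absorbs a factor of the factorial; this is the arithmetic of the
Mecke formula. -/
lemma poissonWeight_succ (n : ℕ) : poissonWeight Λ (n + 1) * (n + 1) = poissonWeight Λ n := by
  have h1 : (n.factorial : ℝ) ≠ 0 := by exact_mod_cast n.factorial_ne_zero
  rw [poissonWeight, poissonWeight, Nat.factorial_succ]
  push_cast
  field_simp

lemma hasSum_integral_poissonLaw {g : Points X → ℂ} (hg : Integrable g (poissonLaw Λ)) :
    HasSum (fun n => (poissonWeight Λ n : ℂ) * ∫ x, g ⟨n, x⟩ ∂Measure.pi fun _ : Fin n => Λ)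
      (∫ ω, g ω ∂poissonLaw Λ) := by
  refine (congrArg (HasSum · _) (funext fun n => ?_)).mpr (hasSum_integral_measure hg)
  rw [integral_smul_measure, (measurableEmbedding_sigma n).integral_map,
    ← poissonWeight, ENNReal.toReal_ofReal (poissonWeight_pos n).le, Complex.real_smul]

variable [IsFiniteMeasure Λ]

lemma pi_univ_toReal (n : ℕ) : (Measure.pi fun _ : Fin n => Λ) Set.univ =
    ENNReal.ofReal ((Λ Set.univ).toReal ^ n) := by
  rw [Measure.pi_univ, Finset.prod_const, Finset.card_univ, Fintype.card_fin,
    ENNReal.ofReal_pow ENNReal.toReal_nonneg, ENNReal.ofReal_toReal (measure_ne_top _ _)]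

instance : IsProbabilityMeasure (poissonLaw Λ) where
  measure_univ := by
    have h := ProbabilityTheory.hasSum_one_poissonMeasure (Λ Set.univ).toNNReal
    rw [poissonLaw, Measure.sum_apply _ MeasurableSet.univ]
    have e : ∀ n : ℕ, (ENNReal.ofReal (Real.exp (-(Λ Set.univ).toReal) / (n.factorial : ℝ)) •
        (Measure.pi fun _ : Fin n => Λ).map (Sigma.mk n)) (Set.univ : Set (Points X)) =
        ENNReal.ofReal (Real.exp (-((Λ Set.univ).toNNReal : ℝ)) *
          ((Λ Set.univ).toNNReal : ℝ) ^ n / n.factorial) := by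
      intro n
      rw [Measure.smul_apply, (measurableEmbedding_sigma n).map_apply, Set.preimage_univ,
        pi_univ_toReal, smul_eq_mul, ← ENNReal.ofReal_mul (by positivity)]
      congr 1
      rw [ENNReal.coe_toNNReal_eq_toReal]
      ring
    simp_rw [e]
    rw [← ENNReal.ofReal_tsum_of_nonneg (fun n => by positivity) h.summable, h.tsum_eq,
      ENNReal.ofReal_one]

/-- Exponential moments of the number of points, by the exponential series. All dominations below
reduce to them. -/
lemma integrable_pow_poissonLaw (K : ℝ) :
    Integrable (fun ω : Points X => K ^ ω.1) (poissonLaw Λ) := by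
  have hi : ∀ n : ℕ, Integrable (fun ω : Points X => K ^ ω.1)
      ((Measure.pi fun _ : Fin n => Λ).map (Sigma.mk n)) := fun n => by
    rw [(measurableEmbedding_sigma n).integrable_map_iff]
    exact integrable_const (K ^ n)
  refine integrable_sum_measure (fun n => (hi n).smul_measure ENNReal.ofReal_ne_top) ?_
  have hs := (Real.summable_pow_div_factorial ((Λ Set.univ).toReal * |K|)).mul_left
    (Real.exp (-(Λ Set.univ).toReal))
  refine hs.congr fun n => ?_
  rw [integral_smul_measure, (measurableEmbedding_sigma n).integral_map]
  simp only [norm_pow, Real.norm_eq_abs, integral_const, smul_eq_mul, measureReal_def,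
    pi_univ_toReal]
  rw [ENNReal.toReal_ofReal (by positivity), ENNReal.toReal_ofReal (by positivity), mul_pow]
  ring

/-- The sum of a function of a point and of the remaining ones. -/
def removeSum (f : X → Points X → ℂ) : Points X → ℂ
  | ⟨0, _⟩ => 0
  | ⟨n + 1, x⟩ => ∑ i : Fin (n + 1), f (x i) ⟨n, fun k => x (i.succAbove k)⟩

/-- The Mecke formula. -/
theorem integral_removeSum {f : X → Points X → ℂ}
    (hf : Integrable (fun q : Points X × X => f q.2 q.1) ((poissonLaw Λ).prod Λ))
    (hs : Integrable (removeSum f) (poissonLaw Λ)) :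
    ∫ ω, removeSum f ω ∂poissonLaw Λ = ∫ p, ∫ ω, f p ω ∂poissonLaw Λ ∂Λ := by
  -- Integrability for the sum of measures gives it for each number of points, since each component
  -- has positive finite weight.
  have hcomp : ∀ n, Integrable (fun q : X × (Fin n → X) => f q.1 ⟨n, q.2⟩)
      (Λ.prod (Measure.pi fun _ : Fin n => Λ)) := by
    intro n
    have h1 := hf
    rw [poissonLaw, Measure.prod_sum_left] at h1
    have h2 := h1.mono_measure (Measure.le_sum _ n)
    rw [Measure.prod_smul_left] at h2
    replace h2 := (integrable_smul_measure
      (ENNReal.ofReal_pos.2 (poissonWeight_pos (Λ := Λ) n)).ne' ENNReal.ofReal_ne_top).1 h2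
    have h3 : ((Measure.pi fun _ : Fin n => Λ).map (Sigma.mk n)).prod Λ =
        ((Measure.pi fun _ : Fin n => Λ).prod Λ).map
          (Prod.map (fun x : Fin n → X => (⟨n, x⟩ : Points X)) id) := by
      have := Measure.map_prod_map (Measure.pi fun _ : Fin n => Λ) Λ
        (measurableEmbedding_sigma (E := fun n => Fin n → X) n).measurable measurable_id
      rwa [Measure.map_id] at this
    rw [h3, ((measurableEmbedding_sigma n).prodMap MeasurableEmbedding.id).integrable_map_iff] at h2
    exact h2.swap
  have h1 := hasSum_integral_poissonLaw hs
  have h2 := hasSum_integral_poissonLaw hf.integral_prod_left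
  have h3 := integral_integral_swap (f := fun ω p => f p ω) hf
  rw [← h3]
  have h0 : ∫ x, removeSum f ⟨0, x⟩ ∂(Measure.pi fun _ : Fin 0 => Λ) = 0 := integral_zero _ _
  -- The empty configuration contributes nothing; the series is shifted so that n + 1 points on the
  -- left face n on the right.
  rw [← hasSum_nat_add_iff' 1, Finset.range_one, Finset.sum_singleton, h0, mul_zero, sub_zero] at h1
  refine h1.unique ((congrArg (HasSum · _) (funext fun n => ?_)).mpr h2)
  change (poissonWeight Λ (n + 1) : ℂ) *
    ∫ x, ∑ i, f (x i) ⟨n, fun k => x (i.succAbove k)⟩ ∂(Measure.pi fun _ : Fin (n + 1) => Λ) = _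
  have hterm : ∀ i : Fin (n + 1), MeasurePreserving
      (fun x : Fin (n + 1) → X => (x i, fun k => x (i.succAbove k)))
      (Measure.pi fun _ => Λ) (Λ.prod (Measure.pi fun _ : Fin n => Λ)) := fun i =>
    measurePreserving_piFinSuccAbove (fun _ : Fin (n + 1) => Λ) i
  -- Splitting off the coordinate `i` preserves the product measure, so the n + 1 terms have the
  -- same integral.
  have hval : ∀ i : Fin (n + 1), ∫ x : Fin (n + 1) → X, f (x i) ⟨n, fun k => x (i.succAbove k)⟩
      ∂(Measure.pi fun _ => Λ) = ∫ x, ∫ p, f p ⟨n, x⟩ ∂Λ ∂(Measure.pi fun _ : Fin n => Λ) := by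
    intro i
    rw [← integral_prod_symm _ (hcomp n)]
    exact (hterm i).integral_comp (MeasurableEquiv.piFinSuccAbove (fun _ => X) i).measurableEmbedding
      (fun q : X × (Fin n → X) => f q.1 ⟨n, q.2⟩)
  have hint : ∀ i : Fin (n + 1), Integrable (fun x : Fin (n + 1) → X =>
      f (x i) ⟨n, fun k => x (i.succAbove k)⟩) (Measure.pi fun _ => Λ) := fun i =>
    ((hterm i).integrable_comp_emb
      (MeasurableEquiv.piFinSuccAbove (fun _ => X) i).measurableEmbedding).2 (hcomp n)
  rw [integral_finsetSum _ fun i _ => hint i, Finset.sum_congr rfl fun i _ => hval i,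
    Finset.sum_const, Finset.card_univ, Fintype.card_fin, nsmul_eq_mul, ← mul_assoc,
    ← poissonWeight_succ n]
  push_cast
  rfl

/-- The Mecke formula in the presence of another source of randomness. -/
theorem integral_removeSum_prod {Y : Type*} [MeasurableSpace Y] {ν : Measure Y} [IsFiniteMeasure ν]
    {f : X → Points X × Y → ℂ}
    (hf : Integrable (fun q : X × Points X × Y => f q.1 q.2) (Λ.prod ((poissonLaw Λ).prod ν)))
    (hs : Integrable (fun q : Points X × Y => removeSum (fun p ω => f p (ω, q.2)) q.1)
      ((poissonLaw Λ).prod ν)) :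
    ∫ q, removeSum (fun p ω => f p (ω, q.2)) q.1 ∂((poissonLaw Λ).prod ν) =
      ∫ p, ∫ q, f p q ∂((poissonLaw Λ).prod ν) ∂Λ := by
  have hassoc := (measurePreserving_prodAssoc Λ (poissonLaw Λ) ν).integrable_comp_emb
    MeasurableEquiv.prodAssoc.measurableEmbedding |>.2 hf
  have hassoc : Integrable (fun q : (X × Points X) × Y => f q.1.1 (q.1.2, q.2))
      ((Λ.prod (poissonLaw Λ)).prod ν) := hassoc
  rw [integral_prod_symm _ hs, ← integral_prod _ hf,
    ← (measurePreserving_prodAssoc Λ (poissonLaw Λ) ν).integral_comp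
      MeasurableEquiv.prodAssoc.measurableEmbedding]
  change _ = ∫ q : (X × Points X) × Y, f q.1.1 (q.1.2, q.2) ∂((Λ.prod (poissonLaw Λ)).prod ν)
  rw [integral_prod_symm _ hassoc]
  refine integral_congr_ae ?_
  -- For almost every value of the second source the sections are integrable, and the formula for a
  -- single process applies.
  filter_upwards [hassoc.prod_left_ae, hs.prod_left_ae] with y h1 h2
  rw [integral_removeSum h1.swap h2, ← integral_prod _ h1]

end Poisson

end QuantumIsing
end

/-! ### Measurability, almost sure genericity, and the intensity measures. -/

noncomputable section
namespace QuantumIsing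

section Configurations

lemma measurable_config {A Y : Type*} [MeasurableSpace A] [MeasurableSpace Y] {F : A × Config → Y}
    (h : ∀ n m, Measurable fun q : A × (Fin n → ℤ × ℝ) × (Fin m → ℤ × ℝ) =>
      F (q.1, (⟨n, q.2.1⟩, ⟨m, q.2.2⟩))) : Measurable F := by
  have h1 : Measurable fun q : (A × Points (ℤ × ℝ)) × Points (ℤ × ℝ) => F (q.1.1, (q.1.2, q.2)) := by
    refine measurable_prod_sigma fun m => ?_
    have h2 : Measurable fun q : (A × (Fin m → ℤ × ℝ)) × Points (ℤ × ℝ) =>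
        F (q.1.1, (q.2, ⟨m, q.1.2⟩)) := by
      refine measurable_prod_sigma fun n => ?_
      exact (h n m).comp (measurable_fst.fst.prodMk (measurable_snd.prodMk measurable_fst.snd))
    exact h2.comp ((measurable_fst.fst.prodMk measurable_snd).prodMk measurable_fst.snd)
  exact h1.comp ((measurable_fst.prodMk measurable_snd.fst).prodMk measurable_snd.snd)

/-- The points of a configuration, as a single family. -/
def Config.family (ω : Config) : Fin ω.1.1 ⊕ Fin ω.2.1 → ℤ × ℝ := Sum.elim ω.1.2 ω.2.2

lemma Config.points_eq (ω : Config) : ω.points = Set.range ω.family := by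
  rw [points, family, Set.Sum.elim_range]

namespace DobrushinDomain

variable {δ : ℝ} {D : DobrushinDomain δ}

/-- Quantities that depend only on the relative order of the heights are measurable. -/
lemma measurable_of_invariant {Y : Type*} [MeasurableSpace Y] (Φ : Set (ℤ × ℝ) → ℤ × ℝ → Y)
    (hΦ : ∀ ψ : ℝ ≃o ℝ, (∀ h ∈ D.heights, ψ h = h) → ∀ C e, Φ (lift ψ '' C) (lift ψ e) = Φ C e) :
    Measurable fun q : (ℤ × ℝ) × Config => Φ q.2.points q.1 := by
  refine measurable_config fun n m => ?_
  have h := measurable_of_lift_invariant (I := Option (Fin n ⊕ Fin m)) D.heights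
    (fun x => Φ (Set.range fun i => x (some i)) (x none)) (fun ψ hψ x => by
      have := hΦ ψ hψ (Set.range fun i => x (some i)) (x none)
      rwa [← Set.range_comp] at this)
  have hg : Measurable fun q : (ℤ × ℝ) × (Fin n → ℤ × ℝ) × (Fin m → ℤ × ℝ) =>
      fun o : Option (Fin n ⊕ Fin m) => o.elim q.1 (Sum.elim q.2.1 q.2.2) := by
    refine measurable_pi_lambda _ ?_
    rintro (_ | i | i)
    · exact measurable_fst
    · exact (measurable_pi_apply i).comp measurable_snd.fst
    · exact (measurable_pi_apply i).comp measurable_snd.snd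
  convert h.comp hg using 2 with q
  rw [Config.points_eq]
  rfl

lemma measurable_weight (hδ : 0 < δ) :
    Measurable fun q : (ℤ × ℝ) × Config => D.weight q.2.points q.1 :=
  measurable_of_invariant (D := D) D.weight fun ψ hψ C e => by
    rw [weight, weight, numLoops_image hδ hψ, spin_image hδ hψ]

lemma measurable_of_invariant_right {Y : Type*} [MeasurableSpace Y]
    (Φ : Set (ℤ × ℝ) → ℤ × ℝ → Y)
    (hΦ : ∀ ψ : ℝ ≃o ℝ, (∀ h ∈ D.heights, ψ h = h) → ∀ C e, Φ (lift ψ '' C) (lift ψ e) = Φ C e)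
    (e : ℤ × ℝ) : Measurable fun ω : Config => Φ ω.points e := by
  have hg : Measurable fun ω : Config => (e, ω) := measurable_const.prodMk measurable_id
  exact (measurable_of_invariant Φ hΦ).comp hg

lemma measurable_spin (hδ : 0 < δ) (e : ℤ × ℝ) :
    Measurable fun ω : Config => D.spin ω.points e := by
  refine measurable_of_invariant_right (D := D) D.spin (fun ψ hψ C e => ?_) e
  rw [spin_image hδ hψ]

lemma measurable_numLoops (hδ : 0 < δ) : Measurable fun ω : Config => D.numLoops ω.points := by
  refine measurable_of_invariant_right (D := D) (fun C _ => D.numLoops C) (fun ψ hψ C e => ?_) (0, 0)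
  rw [numLoops_image hδ hψ]

lemma measurable_windowJump (hδ : 0 < δ) (j : ℤ) (y₁ y₂ : ℝ) :
    Measurable fun q : (ℤ × ℝ) × Config => D.windowJump j y₁ y₂ q.2.points q.1 := by
  have key : ∀ c k : ℤ, Measurable fun q : (ℤ × ℝ) × Config =>
      if q.1.1 = c then (Set.Ioo y₁ y₂).indicator (fun t => D.weight q.2.points (k, t)) q.1.2
        else 0 := by
    intro c k
    refine Measurable.ite ?_ ?_ measurable_const
    · exact measurable_fst.fst (measurableSet_singleton c)
    · simp only [Set.indicator_apply]
      refine Measurable.ite ?_ ?_ measurable_const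
      · exact measurable_fst.snd measurableSet_Ioo
      · exact (measurable_weight hδ).comp
          ((measurable_const.prodMk measurable_fst.snd).prodMk measurable_snd)
  exact (key _ _).sub (key _ _)

lemma measurable_removeSum {f : ℤ × ℝ → Config → ℂ}
    (hf : Measurable fun q : (ℤ × ℝ) × Config => f q.1 q.2) :
    Measurable fun ω : Config => removeSum (fun p x => f p (x, ω.2)) ω.1 := by
  have : Measurable fun q : Unit × Config => removeSum (fun p x => f p (x, q.2.2)) q.2.1 := by
    refine measurable_config fun n m => ?_
    cases n with
    | zero => exact measurable_const
    | succ n =>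
      refine Finset.measurable_fun_sum _ fun i _ => ?_
      have hg : Measurable fun q : Unit × (Fin (n + 1) → ℤ × ℝ) × (Fin m → ℤ × ℝ) =>
          (q.2.1 i, ((⟨n, fun k => q.2.1 (i.succAbove k)⟩, ⟨m, q.2.2⟩) : Config)) := ?_
      · exact hf.comp hg
      refine ((measurable_pi_apply i).comp measurable_snd.fst).prodMk (Measurable.prodMk ?_ ?_)
      · exact (measurableEmbedding_sigma n).measurable.comp (measurable_pi_lambda _ fun k =>
          (measurable_pi_apply _).comp measurable_snd.fst)
      · exact (measurableEmbedding_sigma m).measurable.comp measurable_snd.snd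
  have hg : Measurable fun ω : Config => ((), ω) := measurable_const.prodMk measurable_id
  exact this.comp hg

/-! #### Almost sure properties -/

lemma ae_points {Λ : Measure (ℤ × ℝ)} [IsFiniteMeasure Λ] (h0 : ∀ t : ℝ, ∀ᵐ p ∂Λ, p.2 ≠ t)
    {R : ℤ × ℝ → Prop} (hR : ∀ᵐ p ∂Λ, R p) {T : Set ℝ} (hT : T.Countable) :
    ∀ᵐ ω ∂poissonLaw Λ, (Function.Injective fun i => (ω.2 i).2) ∧
      ∀ i, (ω.2 i).2 ∉ T ∧ R (ω.2 i) := by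
  refine ae_poissonLaw fun n => ?_
  have heval : ∀ (n : ℕ) (i : Fin n) {Q : ℤ × ℝ → Prop}, (∀ᵐ p ∂Λ, Q p) →
      ∀ᵐ x ∂Measure.pi (fun _ : Fin n => Λ), Q (x i) := fun n i Q hQ =>
    (Measure.tendsto_eval_ae_ae (μ := fun _ : Fin n => Λ) (i := i)).eventually hQ
  have hT' : ∀ᵐ p ∂Λ, p.2 ∉ T := by
    have := (ae_ball_iff hT).2 fun t _ => h0 t
    filter_upwards [this] with p hp hpT using hp _ hpT rfl
  have h1 : ∀ᵐ x ∂Measure.pi (fun _ : Fin n => Λ), ∀ i, (x i).2 ∉ T ∧ R (x i) :=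
    ae_all_iff.2 fun i => heval n i (hT'.and hR)
  have h2 : ∀ᵐ x ∂Measure.pi (fun _ : Fin n => Λ), ∀ i k : Fin n, i ≠ k → (x i).2 ≠ (x k).2 := by
    refine ae_all_iff.2 fun i => ae_all_iff.2 fun k => ?_
    by_cases hik : i = k
    · exact Filter.Eventually.of_forall fun _ h => absurd hik h
    cases n with
    | zero => exact i.elim0
    | succ n =>
      -- The coordinate `i` is split off; by Fubini its height can be fixed, and the intensity does
      -- not charge fixed heights.
      obtain ⟨k, rfl⟩ := Fin.exists_succAbove_eq (Ne.symm hik)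
      have hm : MeasurableSet {q : (ℤ × ℝ) × (Fin n → ℤ × ℝ) | q.1.2 ≠ (q.2 k).2} :=
        (measurableSet_eq_fun measurable_fst.snd
          ((measurable_pi_apply k).comp measurable_snd).snd).compl
      have hq : ∀ᵐ q ∂Λ.prod (Measure.pi fun _ : Fin n => Λ), q.1.2 ≠ (q.2 k).2 :=
        (Measure.ae_prod_iff_ae_ae hm).2 (Filter.Eventually.of_forall fun p =>
          (heval n k (h0 p.2)).mono fun x hx => hx.symm)
      filter_upwards [(measurePreserving_piFinSuccAbove
        (fun _ : Fin (n + 1) => Λ) i).quasiMeasurePreserving.ae hq] with x hx _ using hx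
  filter_upwards [h1, h2] with x h1 h2
  exact ⟨fun i k h => by_contra fun hne => h2 i k hne h, h1⟩

lemma measurableSet_disjoint :
    MeasurableSet {ω : Config | ∀ i k, (ω.1.2 i).2 ≠ (ω.2.2 k).2} := by
  have h : Measurable fun q : Unit × Config => ∀ i k, (q.2.1.2 i).2 ≠ (q.2.2.2 k).2 := by
    refine measurable_config fun n m => ?_
    have h1 : ∀ (i : Fin n) (k : Fin m),
        Measurable fun q : Unit × (Fin n → ℤ × ℝ) × (Fin m → ℤ × ℝ) =>
          (q.2.1 i).2 ≠ (q.2.2 k).2 := fun i k =>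
      measurableSet_setOfPred.1 (measurableSet_eq_fun
        ((measurable_pi_apply i).comp measurable_snd.fst).snd
        ((measurable_pi_apply k).comp measurable_snd.snd).snd).compl
    exact Measurable.forall fun i => Measurable.forall fun k => h1 i k
  have hg : Measurable fun ω : Config => ((), ω) := measurable_const.prodMk measurable_id
  exact measurableSet_setOfPred.2 (h.comp hg)

/-- Almost surely, the points of two independent processes are at distinct heights. -/
lemma ae_config {Λ Λ' : Measure (ℤ × ℝ)} [IsFiniteMeasure Λ] [IsFiniteMeasure Λ']
    (h0 : ∀ t : ℝ, ∀ᵐ p ∂Λ, p.2 ≠ t) (h0' : ∀ t : ℝ, ∀ᵐ p ∂Λ', p.2 ≠ t)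
    {R : ℤ × ℝ → Prop} (hR : ∀ᵐ p ∂Λ, R p) (hR' : ∀ᵐ p ∂Λ', R p) {T : Set ℝ} (hT : T.Countable) :
    ∀ᵐ ω ∂(poissonLaw Λ).prod (poissonLaw Λ'), (Function.Injective fun i => (Config.family ω i).2) ∧
      ∀ i, (Config.family ω i).2 ∉ T ∧ R (Config.family ω i) := by
  -- Conditionally on the first process, the second one avoids the finitely many heights of the
  -- first.
  have hcross : ∀ᵐ ω ∂(poissonLaw Λ).prod (poissonLaw Λ'),
      ∀ i k, ((ω : Config).1.2 i).2 ≠ (ω.2.2 k).2 := by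
    refine (Measure.ae_prod_iff_ae_ae measurableSet_disjoint).2
      (Filter.Eventually.of_forall fun ω₁ => ?_)
    filter_upwards [ae_points h0' hR' (Set.countable_range fun i => (ω₁.2 i).2)] with ω₂ h i k hik
    exact (h.2 k).1 ⟨i, hik⟩
  filter_upwards [hcross, Measure.quasiMeasurePreserving_fst.ae (ae_points h0 hR hT),
    Measure.quasiMeasurePreserving_snd.ae (ae_points h0' hR' hT)] with ω h1 h2 h3
  constructor
  · rintro (i | i) (k | k) h
    · exact congrArg Sum.inl (h2.1 h)
    · exact absurd h (h1 i k)
    · exact absurd h.symm (h1 k i)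
    · exact congrArg Sum.inr (h3.1 h)
  · rintro (i | i)
    · exact h2.2 i
    · exact h3.2 i

/-! #### The intensity measures -/

lemma measurable_medialPos : Measurable (medialPos δ) := by
  have : medialPos δ = fun p : ℤ × ℝ => (((p.1 : ℝ) * (δ / 2) : ℝ) : ℂ) + (p.2 : ℂ) * Complex.I := by
    funext p; apply Complex.ext <;> simp [medialPos]
  rw [this]
  have h1 : Measurable fun p : ℤ × ℝ => (p.1 : ℝ) := measurable_from_top.comp measurable_fst
  fun_prop

variable (D) in
/-- The vertical lines of the medial lattice inside the domain. -/
def medialLines : Set (ℤ × ℝ) := {p | medialPos δ p ∈ D.carrier}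

lemma measurableSet_medialLines : MeasurableSet D.medialLines :=
  measurable_medialPos D.isOpen.measurableSet

lemma measurableSet_even : MeasurableSet {p : ℤ × ℝ | Even p.1} :=
  measurable_fst (show MeasurableSet {n : ℤ | Even n} from trivial)

lemma lineMeasure_medialLines_lt_top (hδ : 0 < δ) : lineMeasure D.medialLines < ⊤ := by
  obtain ⟨R, hR⟩ := D.isBounded.subset_closedBall 0
  have hsub : D.medialLines ⊆ Set.Icc (-⌈2 * R / δ⌉) ⌈2 * R / δ⌉ ×ˢ Set.Icc (-R) R := by
    rintro ⟨j, t⟩ h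
    have h1 := hR h
    rw [mem_closedBall_zero_iff] at h1
    have h2 := abs_le.1 ((Complex.abs_re_le_norm _).trans h1)
    have h3 := abs_le.1 ((Complex.abs_im_le_norm _).trans h1)
    simp only [medialPos] at h2 h3
    have hc := Int.le_ceil (2 * R / δ)
    have h4 : (j : ℝ) ≤ 2 * R / δ := by rw [le_div_iff₀ hδ]; linarith
    have h5 : -(2 * R / δ) ≤ (j : ℝ) := by
      rw [← neg_div, div_le_iff₀ hδ]; linarith
    refine ⟨⟨?_, ?_⟩, h3⟩
    · exact_mod_cast (neg_le_neg hc).trans h5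
    · exact_mod_cast h4.trans hc
  refine (measure_mono hsub).trans_lt ?_
  rw [lineMeasure, Measure.prod_prod]
  exact ENNReal.mul_lt_top (Measure.count_apply_lt_top.2 (Set.finite_Icc _ _))
    (by simp)

variable (D) in
/-- The intensity of a Poisson process on a part of the vertical lines of the domain. -/
def intensity (ρ : ℝ) (A : Set (ℤ × ℝ)) : Measure (ℤ × ℝ) :=
  ENNReal.ofReal ρ • lineMeasure.restrict (A ∩ D.medialLines)

lemma isFiniteMeasure_intensity (hδ : 0 < δ) (ρ : ℝ) (A : Set (ℤ × ℝ)) :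
    IsFiniteMeasure (D.intensity ρ A) := by
  have : IsFiniteMeasure (lineMeasure.restrict (A ∩ D.medialLines)) :=
    isFiniteMeasure_restrict.2
      ((measure_mono Set.inter_subset_right).trans_lt (lineMeasure_medialLines_lt_top hδ)).ne
  rw [intensity]
  exact Measure.smul_finite _ ENNReal.ofReal_ne_top

lemma ae_intensity_ne (ρ : ℝ) (A : Set (ℤ × ℝ)) (t : ℝ) : ∀ᵐ p ∂D.intensity ρ A, p.2 ≠ t := by
  refine Measure.ae_smul_measure (ae_restrict_of_ae ?_) _
  rw [ae_iff]
  have : {p : ℤ × ℝ | ¬p.2 ≠ t} = Set.univ ×ˢ {t} := by ext p; simp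
  rw [this, lineMeasure, Measure.prod_prod]
  simp

lemma ae_intensity_mem (ρ : ℝ) {A : Set (ℤ × ℝ)} (hA : MeasurableSet A) :
    ∀ᵐ p ∂D.intensity ρ A, medialPos δ p ∈ D.carrier := by
  refine Measure.ae_smul_measure ?_ _
  filter_upwards [ae_restrict_mem (hA.inter (measurableSet_medialLines (D := D)))] with p hp using hp.2

lemma percolationLaw_eq (ρ : ℝ) : D.percolationLaw ρ ρ =
    (poissonLaw (D.intensity ρ {p | Even p.1})).prod
      (poissonLaw (D.intensity ρ {p | Even p.1}ᶜ)) := by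
  have h : D.dualIntervals = {p : ℤ × ℝ | Even p.1}ᶜ ∩ D.medialLines := by
    ext p
    simp [dualIntervals, medialLines]
  rw [percolationLaw, intensity, intensity, h]
  rfl

end DobrushinDomain

end Configurations

end QuantumIsing
end

/-! ### Domination, and the Mecke formula for the observable. -/

noncomputable section
namespace QuantumIsing

section Mecke

lemma integrable_config {Λ Λ' : Measure (ℤ × ℝ)} [IsFiniteMeasure Λ] [IsFiniteMeasure Λ']
    {f : Config → ℂ} (hf : Measurable f) (A K L : ℝ)
    (h : ∀ᵐ ω ∂(poissonLaw Λ).prod (poissonLaw Λ'), ‖f ω‖ ≤ A * (K ^ ω.1.1 * L ^ ω.2.1)) :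
    Integrable f ((poissonLaw Λ).prod (poissonLaw Λ')) :=
  Integrable.mono' (((integrable_pow_poissonLaw K).mul_prod (integrable_pow_poissonLaw L)).const_mul A)
    hf.aestronglyMeasurable h

lemma Config.ncard_points_le (ω : Config) : ω.points.ncard ≤ ω.1.1 + ω.2.1 := by
  rw [points_eq, ← Set.image_univ]
  refine (Set.ncard_image_le Set.finite_univ).trans ?_
  simp [Set.ncard_univ]

lemma Config.finite_points (ω : Config) : ω.points.Finite := by
  rw [points_eq]; exact Set.finite_range _

namespace DobrushinDomain

variable {δ : ℝ} {D : DobrushinDomain δ}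

variable (D) in
/-- A measure carried by the vertical lines of the domain that does not charge heights. -/
structure IsSpread (Λ : Measure (ℤ × ℝ)) : Prop where
  ne : ∀ t : ℝ, ∀ᵐ p ∂Λ, p.2 ≠ t
  mem : ∀ᵐ p ∂Λ, medialPos δ p ∈ D.carrier

lemma isSpread_intensity (ρ : ℝ) {A : Set (ℤ × ℝ)} (hA : MeasurableSet A) :
    D.IsSpread (D.intensity ρ A) :=
  ⟨ae_intensity_ne ρ A, ae_intensity_mem ρ hA⟩

variable {Λ Λ' : Measure (ℤ × ℝ)} [IsFiniteMeasure Λ] [IsFiniteMeasure Λ']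

lemma ae_isGeneric (h : D.IsSpread Λ) (h' : D.IsSpread Λ') {T : Set ℝ} (hT : T.Countable) :
    ∀ᵐ ω ∂(poissonLaw Λ).prod (poissonLaw Λ'), Function.Injective (Config.family ω) ∧
      D.IsGeneric ω.points ∧ ∀ i, (Config.family ω i).2 ∉ T := by
  filter_upwards [ae_config h.ne h'.ne h.mem h'.mem
    (hT.union (D.heights.finite_toSet.countable))] with ω hω
  have hinj : Function.Injective (Config.family ω) :=
    Function.Injective.of_comp (f := Prod.snd) hω.1
  refine ⟨hinj, ⟨ω.finite_points, ?_, ?_, ?_⟩, fun i hi => (hω.2 i).1 (Or.inl hi)⟩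
  · rw [Config.points_eq]
    rintro _ ⟨i, rfl⟩ _ ⟨k, rfl⟩ hik
    rw [hω.1 hik]
  · rw [Config.points_eq]
    rintro _ ⟨i, rfl⟩ hi
    exact (hω.2 i).1 (Or.inr hi)
  · rw [Config.points_eq]
    rintro _ ⟨i, rfl⟩
    exact (hω.2 i).2

lemma norm_weight_le (hδ : 0 < δ) {C : Set (ℤ × ℝ)} (hC : D.IsGeneric C) {n : ℕ}
    (hn : C.ncard ≤ n) (e : ℤ × ℝ) : ‖D.weight C e‖ ≤ √2 ^ (D.numLoops ∅) * √2 ^ n := by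
  have h1 : (1 : ℝ) ≤ √2 := Real.one_le_sqrt.2 one_le_two
  rw [weight, norm_mul, norm_pow, Complex.norm_real, Real.norm_of_nonneg (Real.sqrt_nonneg 2),
    ← pow_add]
  calc √2 ^ D.numLoops C * ‖D.spin C e‖ ≤ √2 ^ D.numLoops C * 1 := by
        gcongr; exact norm_spin_le C e
    _ ≤ √2 ^ (D.numLoops ∅ + n) := by
        rw [mul_one]
        exact pow_le_pow_right₀ h1 ((numLoops_le hδ hC).trans (by lia))

lemma norm_windowJump_le (hδ : 0 < δ) {C : Set (ℤ × ℝ)} (hC : D.IsGeneric C) {n : ℕ}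
    (hn : C.ncard ≤ n) (j : ℤ) (y₁ y₂ : ℝ) (p : ℤ × ℝ) :
    ‖D.windowJump j y₁ y₂ C p‖ ≤ 2 * (√2 ^ (D.numLoops ∅) * √2 ^ n) := by
  have key : ∀ c k : ℤ, ‖if p.1 = c then
      (Set.Ioo y₁ y₂).indicator (fun t => D.weight C (k, t)) p.2 else 0‖ ≤
      √2 ^ (D.numLoops ∅) * √2 ^ n := by
    intro c k
    split_ifs
    · exact (norm_indicator_le_norm_self _ _).trans (norm_weight_le hδ hC hn _)
    · rw [norm_zero]; positivity
  rw [windowJump, two_mul]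
  exact (norm_sub_le _ _).trans (add_le_add (key _ _) (key _ _))

lemma integrable_weight (hδ : 0 < δ) (h : D.IsSpread Λ) (h' : D.IsSpread Λ') (e : ℤ × ℝ) :
    Integrable (fun ω : Config => D.weight ω.points e) ((poissonLaw Λ).prod (poissonLaw Λ')) := by
  have hm : Measurable fun ω : Config => (e, ω) := measurable_const.prodMk measurable_id
  have hm := (measurable_weight (D := D) hδ).comp hm
  refine integrable_config hm (√2 ^ (D.numLoops ∅)) √2 √2 ?_
  filter_upwards [ae_isGeneric h h' Set.countable_empty] with ω hω
  rw [← pow_add]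
  exact norm_weight_le hδ hω.2.1 ω.ncard_points_le e

lemma integrable_windowJump (hδ : 0 < δ) (h : D.IsSpread Λ) (h' : D.IsSpread Λ') (j : ℤ)
    (y₁ y₂ : ℝ) : Integrable (fun q : (ℤ × ℝ) × Config => D.windowJump j y₁ y₂ q.2.points q.1)
      (Λ.prod ((poissonLaw Λ).prod (poissonLaw Λ'))) := by
  have hb := (((integrable_pow_poissonLaw (Λ := Λ) √2).mul_prod
    (integrable_pow_poissonLaw (Λ := Λ') √2)).const_mul (2 * √2 ^ (D.numLoops ∅))).comp_snd Λ
  refine Integrable.mono' hb (measurable_windowJump hδ j y₁ y₂).aestronglyMeasurable ?_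
  filter_upwards [Measure.quasiMeasurePreserving_snd.ae
    (ae_isGeneric h h' Set.countable_empty)] with q hq
  rw [mul_assoc, ← pow_add]
  exact norm_windowJump_le hδ hq.2.1 q.2.ncard_points_le j y₁ y₂ q.1

/-- The sum has as many terms as there are points in the first family, each bounded by a multiple of
√2^(number of points). Bounding n + 1 by 2^(n + 1) leads to the base 2√2. -/
lemma integrable_removeSum (hδ : 0 < δ) (h : D.IsSpread Λ) (h' : D.IsSpread Λ') (j : ℤ)
    (y₁ y₂ : ℝ) : Integrable (fun ω : Config =>
        removeSum (fun p x => D.windowJump j y₁ y₂ (Config.points (x, ω.2)) p) ω.1)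
      ((poissonLaw Λ).prod (poissonLaw Λ')) := by
  refine integrable_config
    (measurable_removeSum (f := fun p ω => D.windowJump j y₁ y₂ ω.points p)
      (measurable_windowJump hδ j y₁ y₂)) (2 * √2 ^ (D.numLoops ∅)) (2 * √2) √2 ?_
  filter_upwards [ae_isGeneric h h' Set.countable_empty] with ω hω
  obtain ⟨⟨n, x⟩, ω₂⟩ := ω
  cases n with
  | zero =>
    rw [removeSum, norm_zero]; positivity
  | succ n =>
    rw [removeSum]
    have hterm : ∀ i : Fin (n + 1), ‖D.windowJump j y₁ y₂
        (Config.points (⟨n, fun k => x (i.succAbove k)⟩, ω₂)) (x i)‖ ≤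
        2 * (√2 ^ (D.numLoops ∅) * √2 ^ (n + 1 + ω₂.1)) := by
      intro i
      have hsub : Config.points (⟨n, fun k => x (i.succAbove k)⟩, ω₂) ⊆
          Config.points (⟨n + 1, x⟩, ω₂) := by
        refine Set.union_subset_union_left _ ?_
        rintro _ ⟨k, rfl⟩
        exact ⟨_, rfl⟩
      refine norm_windowJump_le hδ (hω.2.1.mono hsub) ?_ j y₁ y₂ (x i)
      exact (Set.ncard_le_ncard hsub (Config.finite_points _)).trans (Config.ncard_points_le _)
    refine (norm_sum_le_of_le _ fun i _ => hterm i).trans ?_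
    rw [Finset.sum_const, Finset.card_univ, Fintype.card_fin, nsmul_eq_mul]
    have h2 : ((n + 1 : ℕ) : ℝ) ≤ 2 ^ (n + 1) := by exact_mod_cast Nat.lt_two_pow_self.le
    calc ((n + 1 : ℕ) : ℝ) * (2 * (√2 ^ (D.numLoops ∅) * √2 ^ (n + 1 + ω₂.1)))
        ≤ 2 ^ (n + 1) * (2 * (√2 ^ (D.numLoops ∅) * √2 ^ (n + 1 + ω₂.1))) := by gcongr
      _ = _ := by rw [mul_pow, pow_add √2 (n + 1)]; ring

lemma integral_removeSum_windowJump (hδ : 0 < δ) (h : D.IsSpread Λ) (h' : D.IsSpread Λ') (j : ℤ)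
    (y₁ y₂ : ℝ) : ∫ ω : Config,
        removeSum (fun p x => D.windowJump j y₁ y₂ (Config.points (x, ω.2)) p) ω.1
        ∂(poissonLaw Λ).prod (poissonLaw Λ') =
      ∫ p, ∫ ω : Config, D.windowJump j y₁ y₂ ω.points p
        ∂(poissonLaw Λ).prod (poissonLaw Λ') ∂Λ :=
  integral_removeSum_prod (f := fun p ω => D.windowJump j y₁ y₂ (Config.points ω) p)
    (integrable_windowJump hδ h h' j y₁ y₂) (integrable_removeSum hδ h h' j y₁ y₂)

lemma _root_.QuantumIsing.Config.points_swap (ω : Config) :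
    Config.points ω.swap = ω.points := Set.union_comm _ _

/-- `weight_sub_eq_sum` split according to the family of the removed point; the swap makes the
second family play the part of the first. -/
lemma weight_sub_eq_removeSum (hδ : 0 < δ) {j : ℤ} {y₁ y₂ : ℝ} (hy : y₁ ≤ y₂)
    (hm : ∀ t ∈ Set.Icc y₁ y₂, midEdgePos δ (j, t) ∈ D.carrier) {ω : Config}
    (hinj : Function.Injective ω.family) (hg : D.IsGeneric ω.points)
    (hne : ∀ i, (Config.family ω i).2 ∉ ({y₁, y₂} : Set ℝ)) :
    D.weight ω.points (j, y₂) - D.weight ω.points (j, y₁) = Complex.I * √2 *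
      (removeSum (fun p x => D.windowJump j y₁ y₂ (Config.points (x, ω.2)) p) ω.1 +
        removeSum (fun p x => D.windowJump j y₁ y₂ (Config.points (x, ω.swap.2)) p) ω.swap.1) := by
  have key : ∀ (n m : ℕ) (x : Fin n → ℤ × ℝ) (x' : Fin m → ℤ × ℝ)
      (hinj : Function.Injective (Sum.elim x x')),
      ∑ i, D.windowJump j y₁ y₂ (Sum.elim x x' '' {Sum.inl i}ᶜ) (x i) =
        removeSum (fun p z => D.windowJump j y₁ y₂ (Config.points (z, ⟨m, x'⟩)) p) ⟨n, x⟩ := by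
    intro n m x x' hinj
    cases n with
    | zero => rw [removeSum, Finset.univ_eq_empty, Finset.sum_empty]
    | succ n =>
      rw [removeSum]
      refine Finset.sum_congr rfl fun i _ => ?_
      congr 1
      ext p
      constructor
      · rintro ⟨k | k, hk, rfl⟩
        · obtain ⟨l, rfl⟩ := Fin.exists_succAbove_eq (x := k) (y := i)
            (fun hki => hk (by rw [hki]; rfl))
          exact Or.inl ⟨l, rfl⟩
        · exact Or.inr ⟨k, rfl⟩
      · rintro (⟨k, rfl⟩ | ⟨k, rfl⟩)
        · exact ⟨Sum.inl (i.succAbove k), by simp, rfl⟩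
        · exact ⟨Sum.inr k, by simp, rfl⟩
  obtain ⟨⟨n, x⟩, ⟨m, x'⟩⟩ := ω
  have hx : Config.points (⟨n, x⟩, ⟨m, x'⟩) = Set.range (Sum.elim x x') := Config.points_eq _
  have hxi : Function.Injective (Sum.elim x x') := hinj
  have hswap : Sum.elim x' x = Sum.elim x x' ∘ Sum.swap := by
    funext i; cases i <;> rfl
  rw [hx] at hg ⊢
  rw [weight_sub_eq_sum hδ hxi hg hy hm fun i => ⟨fun h => hne i (Or.inl h),
    fun h => hne i (Or.inr h)⟩, Fintype.sum_sum_type]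
  congr 2
  · exact key n m x x' hxi
  · refine Eq.trans (Finset.sum_congr rfl fun i _ => ?_) (key m n x' x ?_)
    · rw [hswap, Set.image_comp]
      congr 2
      ext k
      cases k <;> simp
    · rw [hswap]
      exact hxi.comp (Equiv.sumComm _ _).injective

/-- The unnormalised observable. -/
def partition (D : DobrushinDomain δ) (Λ Λ' : Measure (ℤ × ℝ)) (e : ℤ × ℝ) : ℂ :=
  ∫ ω : Config, D.weight ω.points e ∂(poissonLaw Λ).prod (poissonLaw Λ')

/-- Adding a point of the window to the configuration changes the unnormalised observable. -/
def partitionJump (D : DobrushinDomain δ) (Λ Λ' : Measure (ℤ × ℝ)) (j : ℤ) (y₁ y₂ : ℝ)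
    (p : ℤ × ℝ) : ℂ :=
  (if p.1 = j + 1 then
    (Set.Ioo y₁ y₂).indicator (fun t => D.partition Λ Λ' (j + 1, t)) p.2 else 0) -
  (if p.1 = j then
    (Set.Ioo y₁ y₂).indicator (fun t => D.partition Λ Λ' (j - 1, t)) p.2 else 0)

lemma integral_windowJump (hδ : 0 < δ) (h : D.IsSpread Λ) (h' : D.IsSpread Λ') (j : ℤ)
    (y₁ y₂ : ℝ) (p : ℤ × ℝ) : ∫ ω : Config, D.windowJump j y₁ y₂ ω.points p
      ∂(poissonLaw Λ).prod (poissonLaw Λ') = D.partitionJump Λ Λ' j y₁ y₂ p := by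
  have key : ∀ c k : ℤ, Integrable (fun ω : Config => if p.1 = c then
      (Set.Ioo y₁ y₂).indicator (fun t => D.weight ω.points (k, t)) p.2 else 0)
      ((poissonLaw Λ).prod (poissonLaw Λ')) ∧
      ∫ ω : Config, (if p.1 = c then
        (Set.Ioo y₁ y₂).indicator (fun t => D.weight ω.points (k, t)) p.2 else 0)
        ∂(poissonLaw Λ).prod (poissonLaw Λ') =
      if p.1 = c then (Set.Ioo y₁ y₂).indicator (fun t => D.partition Λ Λ' (k, t)) p.2 else 0 := by
    intro c k
    split_ifs
    · by_cases hp : p.2 ∈ Set.Ioo y₁ y₂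
      · simp only [Set.indicator_of_mem hp]
        exact ⟨integrable_weight hδ h h' _, rfl⟩
      · simp only [Set.indicator_of_notMem hp]
        exact ⟨integrable_zero _ _ _, integral_zero _ _⟩
    · exact ⟨integrable_zero _ _ _, integral_zero _ _⟩
  simp only [windowJump]
  rw [integral_sub (key _ _).1 (key _ _).1, (key _ _).2, (key _ _).2, partitionJump]

/-- The Mecke formula is applied to each of the two independent processes. It handles the first
factor of a product, so the factors are exchanged for the second process. -/
theorem partition_sub_eq (hδ : 0 < δ) (h : D.IsSpread Λ) (h' : D.IsSpread Λ') {j : ℤ}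
    {y₁ y₂ : ℝ} (hy : y₁ ≤ y₂) (hm : ∀ t ∈ Set.Icc y₁ y₂, midEdgePos δ (j, t) ∈ D.carrier) :
    D.partition Λ Λ' (j, y₂) - D.partition Λ Λ' (j, y₁) = Complex.I * √2 *
      (∫ p, D.partitionJump Λ Λ' j y₁ y₂ p ∂Λ + ∫ p, D.partitionJump Λ Λ' j y₁ y₂ p ∂Λ') := by
  have hi := integrable_removeSum hδ h h' j y₁ y₂
  have hi' : Integrable (fun ω : Config =>
      removeSum (fun p x => D.windowJump j y₁ y₂ (Config.points (x, ω.swap.2)) p) ω.swap.1)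
      ((poissonLaw Λ).prod (poissonLaw Λ')) := (integrable_removeSum hδ h' h j y₁ y₂).swap
  have hs := integral_prod_swap (μ := poissonLaw Λ') (ν := poissonLaw Λ)
    (fun ω : Config => removeSum (fun p x => D.windowJump j y₁ y₂ (Config.points (x, ω.2)) p) ω.1)
  have e1 : ∫ p, D.partitionJump Λ Λ' j y₁ y₂ p ∂Λ = ∫ ω : Config,
      removeSum (fun p x => D.windowJump j y₁ y₂ (Config.points (x, ω.2)) p) ω.1
      ∂(poissonLaw Λ).prod (poissonLaw Λ') := by
    rw [integral_removeSum_windowJump hδ h h']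
    exact integral_congr_ae (Filter.Eventually.of_forall fun p =>
      (integral_windowJump hδ h h' j y₁ y₂ p).symm)
  have e2 : ∫ p, D.partitionJump Λ Λ' j y₁ y₂ p ∂Λ' = ∫ ω : Config,
      removeSum (fun p x => D.windowJump j y₁ y₂ (Config.points (x, ω.swap.2)) p) ω.swap.1
      ∂(poissonLaw Λ).prod (poissonLaw Λ') := by
    rw [hs, integral_removeSum_windowJump hδ h' h]
    refine integral_congr_ae (Filter.Eventually.of_forall fun p => ?_)
    change _ = ∫ ω : Config, D.windowJump j y₁ y₂ ω.points p ∂(poissonLaw Λ').prod (poissonLaw Λ)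
    rw [← integral_windowJump hδ h h' j y₁ y₂ p,
      ← integral_prod_swap (μ := poissonLaw Λ') (ν := poissonLaw Λ)]
    simp only [Config.points_swap]
  rw [partition, partition, ← integral_sub (integrable_weight hδ h h' _)
    (integrable_weight hδ h h' _), e1, e2, ← integral_add hi hi', ← integral_const_mul]
  refine integral_congr_ae ?_
  filter_upwards [ae_isGeneric h h' (Set.toFinite {y₁, y₂}).countable] with ω hω
  exact weight_sub_eq_removeSum hδ hy hm hω.1 hω.2.1 hω.2.2

end DobrushinDomain

end Mecke

end QuantumIsing
end

/-! ### The integral equation of the unnormalised observable and its derivative. -/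

noncomputable section
namespace QuantumIsing

section Derivative

lemma setIntegral_lineMeasure (c : ℤ) (s : Set ℝ) (f : ℤ × ℝ → ℂ) :
    ∫ p in {c} ×ˢ s, f p ∂lineMeasure = ∫ t in s, f (c, t) := by
  rw [lineMeasure, ← Measure.prod_restrict, Measure.restrict_singleton, Measure.count_singleton,
    one_smul, Measure.dirac_prod, MeasurableEmbedding.integral_map]
  exact measurableEmbedding_prodMk_left c

namespace DobrushinDomain

variable {δ : ℝ} {D : DobrushinDomain δ}

variable (D) in
/-- The unnormalised observable of the model of parameter `ρ`. -/
def mean (ρ : ℝ) (e : ℤ × ℝ) : ℂ := ∫ ω, D.weight ω.points e ∂D.percolationLaw ρ ρ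

lemma mean_eq_partition (ρ : ℝ) : D.mean ρ =
    D.partition (D.intensity ρ {p | Even p.1}) (D.intensity ρ {p | Even p.1}ᶜ) := by
  funext e
  rw [mean, percolationLaw_eq, partition]

lemma isProbabilityMeasure_percolationLaw (hδ : 0 < δ) (ρ : ℝ) :
    IsProbabilityMeasure (D.percolationLaw ρ ρ) := by
  have := isFiniteMeasure_intensity (D := D) hδ ρ {p | Even p.1}
  have := isFiniteMeasure_intensity (D := D) hδ ρ {p | Even p.1}ᶜ
  rw [percolationLaw_eq]
  infer_instance

lemma measurable_mean (hδ : 0 < δ) (ρ : ℝ) : Measurable (D.mean ρ) := by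
  have := isProbabilityMeasure_percolationLaw (D := D) hδ ρ
  exact ((measurable_weight (D := D) hδ).stronglyMeasurable.integral_prod_right'
    (ν := D.percolationLaw ρ ρ)).measurable

/-- A generic configuration has at most one loop more per point than the empty one, so exponential
moments of the numbers of points suffice. -/
lemma integrable_numLoops (hδ : 0 < δ) (ρ : ℝ) :
    Integrable (fun ω : Config => √2 ^ D.numLoops ω.points) (D.percolationLaw ρ ρ) := by
  have := isFiniteMeasure_intensity (D := D) hδ ρ {p | Even p.1}
  have := isFiniteMeasure_intensity (D := D) hδ ρ {p | Even p.1}ᶜ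
  have hA : MeasurableSet {p : ℤ × ℝ | Even p.1} := measurableSet_even
  rw [percolationLaw_eq]
  have hm : Measurable fun ω : Config => √2 ^ D.numLoops ω.points :=
    (measurable_from_top (f := fun n : ℕ => √2 ^ n)).comp (measurable_numLoops hδ)
  refine Integrable.mono' (((integrable_pow_poissonLaw √2).mul_prod
    (integrable_pow_poissonLaw √2)).const_mul (√2 ^ D.numLoops ∅)) hm.aestronglyMeasurable ?_
  filter_upwards [ae_isGeneric (isSpread_intensity (D := D) ρ hA) (isSpread_intensity ρ hA.compl)
    Set.countable_empty] with ω hω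
  rw [Real.norm_of_nonneg (by positivity), ← pow_add, ← pow_add]
  refine pow_le_pow_right₀ (Real.one_le_sqrt.2 one_le_two) ((numLoops_le hδ hω.2.1).trans ?_)
  have := ω.ncard_points_le
  lia

lemma norm_mean_le (hδ : 0 < δ) (ρ : ℝ) (e : ℤ × ℝ) :
    ‖D.mean ρ e‖ ≤ ∫ ω, √2 ^ D.numLoops ω.points ∂D.percolationLaw ρ ρ := by
  refine norm_integral_le_of_norm_le (integrable_numLoops hδ ρ) (Filter.Eventually.of_forall
    fun ω => ?_)
  rw [weight, norm_mul, norm_pow, Complex.norm_real, Real.norm_of_nonneg (Real.sqrt_nonneg 2)]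
  exact mul_le_of_le_one_right (by positivity) (norm_spin_le _ _)

lemma mean_eq_zero (ρ : ℝ) {e : ℤ × ℝ} (he : e ∉ D.midEdges) : D.mean ρ e = 0 := by
  have : ∀ ω : Config, D.weight ω.points e = 0 := fun ω => by
    rw [weight, spin, if_neg fun h => he h.1, mul_zero]
  simp only [mean, this, integral_zero]

/-- The two marked mid-edges are on the boundary but belong to `midEdges`; they are excluded because
their heights are those of vertices. -/
lemma mean_eq_zero_of_not_mem (ρ : ℝ) {k : ℤ} {t : ℝ} (ht : t ∉ D.heights)
    (h : midEdgePos δ (k, t) ∉ D.carrier) : D.mean ρ (k, t) = 0 := by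
  refine mean_eq_zero ρ ?_
  rintro (h1 | h1 | h1)
  · exact h h1
  · have := D.aMid_mem_heights
    rw [← h1] at this
    exact ht this
  · have := D.bMid_mem_heights
    rw [← h1] at this
    exact ht this

lemma integrableOn_mean (hδ : 0 < δ) (ρ : ℝ) (k : ℤ) (a b : ℝ) :
    IntegrableOn (fun t => D.mean ρ (k, t)) (Set.Ioc a b) := by
  refine Integrable.mono' (integrable_const
    (∫ ω, √2 ^ D.numLoops ω.points ∂D.percolationLaw ρ ρ)) ?_ (Filter.Eventually.of_forall
    fun t => norm_mean_le hδ ρ (k, t))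
  exact ((measurable_mean hδ ρ).comp (measurable_const.prodMk measurable_id)).aestronglyMeasurable

lemma integral_intensity_add {ρ : ℝ} (hρ : 0 ≤ ρ) {f : ℤ × ℝ → ℂ}
    (hf : IntegrableOn f D.medialLines lineMeasure) :
    ∫ p, f p ∂D.intensity ρ {p | Even p.1} + ∫ p, f p ∂D.intensity ρ {p | Even p.1}ᶜ =
      ρ * ∫ p in D.medialLines, f p ∂lineMeasure := by
  have h := integral_inter_add_sdiff (measurableSet_even) hf
  rw [intensity, intensity, integral_smul_measure, integral_smul_measure, ← smul_add,
    ENNReal.toReal_ofReal hρ, Set.inter_comm, Set.inter_comm _ᶜ, ← Set.sdiff_eq, h,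
    Complex.real_smul]

/-- The contribution of one of the two lines adjacent to a window. -/
lemma setIntegral_medialLines (hδ : 0 < δ) (ρ : ℝ) {c k : ℤ} {y₁ y₂ : ℝ}
    (h : ∀ t ∈ Set.Ioo y₁ y₂, t ∉ D.heights → midEdgePos δ (k, t) ∈ D.carrier →
      medialPos δ (c, t) ∈ D.carrier) :
    IntegrableOn (fun p : ℤ × ℝ => if p.1 = c then
      (Set.Ioo y₁ y₂).indicator (fun t => D.mean ρ (k, t)) p.2 else 0) D.medialLines lineMeasure ∧
    ∫ p in D.medialLines, (if p.1 = c then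
      (Set.Ioo y₁ y₂).indicator (fun t => D.mean ρ (k, t)) p.2 else 0) ∂lineMeasure =
      ∫ t in Set.Ioo y₁ y₂, D.mean ρ (k, t) := by
  have hS : MeasurableSet (({c} : Set ℤ) ×ˢ Set.Ioo y₁ y₂) :=
    (measurableSet_singleton c).prod measurableSet_Ioo
  have e : (fun p : ℤ × ℝ => if p.1 = c then
      (Set.Ioo y₁ y₂).indicator (fun t => D.mean ρ (k, t)) p.2 else 0) =
      (({c} : Set ℤ) ×ˢ Set.Ioo y₁ y₂).indicator fun p => D.mean ρ (k, p.2) := by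
    funext p
    by_cases hp : p.1 = c <;> by_cases hp' : p.2 ∈ Set.Ioo y₁ y₂ <;>
      simp [Set.indicator, hp, hp']
  have hm : Measurable fun p : ℤ × ℝ => D.mean ρ (k, p.2) :=
    (measurable_mean hδ ρ).comp (measurable_const.prodMk measurable_snd)
  rw [e]
  constructor
  · refine (IntegrableOn.of_bound (lineMeasure_medialLines_lt_top hδ) hm.aestronglyMeasurable
      (∫ ω, √2 ^ D.numLoops ω.points ∂D.percolationLaw ρ ρ)
      (Filter.Eventually.of_forall fun p => norm_mean_le hδ ρ _)).indicator hS
  · rw [setIntegral_indicator hS, ← setIntegral_lineMeasure c (Set.Ioo y₁ y₂)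
      (fun p => D.mean ρ (k, p.2))]
    -- The line `c` may leave the domain inside the window. Off the null set of vertex heights this
    -- forces the column `k` to be outside as well, and the observable vanishes there.
    refine (setIntegral_eq_of_subset_of_ae_sdiff_eq_zero hS.nullMeasurableSet
      Set.inter_subset_right ?_).symm
    have hne : ∀ᵐ p ∂lineMeasure, p.2 ∉ D.heights := by
      rw [ae_iff]
      have : {p : ℤ × ℝ | ¬p.2 ∉ D.heights} = Set.univ ×ˢ (D.heights : Set ℝ) := by ext p; simp
      rw [this, lineMeasure, Measure.prod_prod, (D.heights.finite_toSet).measure_zero, mul_zero]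
    filter_upwards [hne] with p hp hpS
    obtain ⟨⟨hp1, hp2⟩, hp3⟩ := hpS
    by_cases hk : midEdgePos δ (k, p.2) ∈ D.carrier
    · have h1 := h p.2 hp2 hp hk
      rw [← show p.1 = c from hp1] at h1
      exact absurd ⟨h1, hp1, hp2⟩ hp3
    · exact mean_eq_zero_of_not_mem ρ hp hk

/-- The added point is on the line `j + 1` or on the line `j`, and contributes the observable in the
column beyond it. A column outside the domain contributes 0, so that the formula needs no correction
along vertical parts of the boundary. -/
theorem mean_sub_eq (hδ : 0 < δ) {ρ : ℝ} (hρ : 0 ≤ ρ) {j : ℤ} {y₁ y₂ : ℝ} (hy : y₁ ≤ y₂)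
    (hm : ∀ t ∈ Set.Icc y₁ y₂, midEdgePos δ (j, t) ∈ D.carrier) :
    D.mean ρ (j, y₂) - D.mean ρ (j, y₁) = ∫ t in y₁..y₂,
      Complex.I * √2 * ρ * (D.mean ρ (j + 1, t) - D.mean ρ (j - 1, t)) := by
  have := isFiniteMeasure_intensity (D := D) hδ ρ {p | Even p.1}
  have := isFiniteMeasure_intensity (D := D) hδ ρ {p | Even p.1}ᶜ
  have hA : MeasurableSet {p : ℤ × ℝ | Even p.1} := measurableSet_even
  have key := partition_sub_eq hδ (isSpread_intensity (D := D) ρ hA)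
    (isSpread_intensity ρ hA.compl) hy hm
  have hr := setIntegral_medialLines (D := D) hδ ρ (c := j + 1) (k := j + 1) (y₁ := y₁) (y₂ := y₂)
    fun t ht hth h => by
      refine medial_mem_of_midEdges hδ hth ?_ h
      rw [add_sub_cancel_right]
      exact hm t (Set.Ioo_subset_Icc_self ht)
  have hl := setIntegral_medialLines (D := D) hδ ρ (c := j) (k := j - 1) (y₁ := y₁) (y₂ := y₂)
    fun t ht hth h => medial_mem_of_midEdges hδ hth h (hm t (Set.Ioo_subset_Icc_self ht))
  simp only [partitionJump] at key
  rw [← mean_eq_partition] at key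
  have hadd := integral_intensity_add hρ (hr.1.sub hl.1)
  simp only [Pi.sub_apply] at hadd
  rw [key, hadd, integral_sub hr.1 hl.1, hr.2, hl.2, ← integral_Ioc_eq_integral_Ioo,
    ← integral_Ioc_eq_integral_Ioo, intervalIntegral.integral_of_le hy, integral_const_mul,
    integral_sub (integrableOn_mean hδ ρ _ _ _) (integrableOn_mean hδ ρ _ _ _)]
  ring

lemma continuous_midEdgePos (j : ℤ) : Continuous fun t : ℝ => midEdgePos δ (j, t) := by
  have : (fun t : ℝ => midEdgePos δ (j, t)) = fun t : ℝ =>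
      (((2 * (j : ℝ) + 1) * (δ / 4) : ℝ) : ℂ) + (t : ℂ) * Complex.I := by
    funext t; apply Complex.ext <;> simp [midEdgePos]
  rw [this]
  fun_prop

lemma exists_window {j : ℤ} {y : ℝ} (h : midEdgePos δ (j, y) ∈ D.carrier) :
    ∃ ε > 0, ∀ t ∈ Metric.ball y ε, midEdgePos δ (j, t) ∈ D.carrier :=
  Metric.eventually_nhds_iff_ball.1
    ((continuous_midEdgePos j).continuousAt.eventually (D.isOpen.mem_nhds h))

lemma mean_sub_eq' (hδ : 0 < δ) {ρ : ℝ} (hρ : 0 ≤ ρ) {j : ℤ} {y t ε : ℝ}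
    (h : ∀ t ∈ Metric.ball y ε, midEdgePos δ (j, t) ∈ D.carrier) (ht : t ∈ Metric.ball y ε) :
    D.mean ρ (j, t) - D.mean ρ (j, y) = ∫ u in y..t,
      Complex.I * √2 * ρ * (D.mean ρ (j + 1, u) - D.mean ρ (j - 1, u)) := by
  have hy : y ∈ Metric.ball y ε := Metric.mem_ball_self (Metric.pos_of_mem_ball ht)
  rw [Real.ball_eq_Ioo] at *
  rcases le_total y t with hyt | hyt
  · exact mean_sub_eq hδ hρ hyt fun u hu => h u (Set.Icc_subset_Ioo hy.1 ht.2 hu)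
  · rw [intervalIntegral.integral_symm, ← mean_sub_eq hδ hρ hyt fun u hu =>
      h u (Set.Icc_subset_Ioo ht.1 hy.2 hu), neg_sub]

/-- Inside the domain, the integral equation has a bounded integrand, so the observable is locally
Lipschitz; outside the closure it is locally zero. -/
lemma continuousAt_mean (hδ : 0 < δ) {ρ : ℝ} (hρ : 0 ≤ ρ) {j : ℤ} {y : ℝ}
    (h : midEdgePos δ (j, y) ∉ frontier D.carrier) :
    ContinuousAt (fun t => D.mean ρ (j, t)) y := by
  by_cases hy : midEdgePos δ (j, y) ∈ D.carrier
  · obtain ⟨ε, hε, hw⟩ := exists_window hy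
    set B := ∫ ω, √2 ^ D.numLoops ω.points ∂D.percolationLaw ρ ρ
    refine continuousAt_of_locally_lipschitz hε (√2 * ρ * (B + B)) fun t ht => ?_
    rw [dist_eq_norm, mean_sub_eq' hδ hρ hw ht, Real.dist_eq]
    refine intervalIntegral.norm_integral_le_of_norm_le_const fun u _ => ?_
    rw [norm_mul, norm_mul, norm_mul, Complex.norm_I, one_mul, Complex.norm_real,
      Complex.norm_real, Real.norm_of_nonneg (Real.sqrt_nonneg 2), Real.norm_of_nonneg hρ]
    gcongr
    exact (norm_sub_le _ _).trans (add_le_add (norm_mean_le hδ ρ _) (norm_mean_le hδ ρ _))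
  · have hc : midEdgePos δ (j, y) ∈ (closure D.carrier)ᶜ := fun hc =>
      h (D.isOpen.frontier_eq ▸ ⟨hc, hy⟩)
    have hz : (fun _ => (0 : ℂ)) =ᶠ[nhds y] fun t => D.mean ρ (j, t) := by
      filter_upwards [(continuous_midEdgePos j).continuousAt.eventually
        (isClosed_closure.isOpen_compl.mem_nhds hc)] with t ht
      have hf : midEdgePos δ (j, t) ∉ frontier D.carrier := fun hf => ht hf.1
      refine (mean_eq_zero ρ ?_).symm
      rintro (h1 | h1 | h1)
      · exact ht (subset_closure h1)
      · rw [h1] at hf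
        exact hf ((midEdge_mem_frontier hδ).2 ⟨_, by omega, covers_aMid⟩)
      · rw [h1] at hf
        exact hf ((midEdge_mem_frontier hδ).2 ⟨_, by omega, covers_bMid⟩)
    exact continuousAt_const.congr hz

/-- The fundamental theorem of calculus for the integral equation. The integrand is continuous at
`y` as soon as neither neighbouring mid-edge is on the boundary curve. -/
theorem hasDerivAt_mean (hδ : 0 < δ) {ρ : ℝ} (hρ : 0 ≤ ρ) {j : ℤ} {y : ℝ}
    (h : midEdgePos δ (j, y) ∈ D.carrier)
    (hr : midEdgePos δ (j + 1, y) ∉ frontier D.carrier)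
    (hl : midEdgePos δ (j - 1, y) ∉ frontier D.carrier) :
    HasDerivAt (fun t => D.mean ρ (j, t))
      (Complex.I * √2 * ρ * (D.mean ρ (j + 1, y) - D.mean ρ (j - 1, y))) y := by
  obtain ⟨ε, hε, hw⟩ := exists_window h
  have hmeas : ∀ k : ℤ, Measurable fun t : ℝ => D.mean ρ (k, t) := fun k =>
    (measurable_mean hδ ρ).comp (measurable_const.prodMk measurable_id)
  have hd := intervalIntegral.integral_hasDerivAt_right (a := y) (b := y)
    (f := fun u => Complex.I * √2 * ρ * (D.mean ρ (j + 1, u) - D.mean ρ (j - 1, u)))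
    IntervalIntegrable.refl
    ((((hmeas _).sub (hmeas _)).const_mul _).stronglyMeasurable.stronglyMeasurableAtFilter)
    (continuousAt_const.mul ((continuousAt_mean hδ hρ hr).sub (continuousAt_mean hδ hρ hl)))
  refine (hd.const_add (D.mean ρ (j, y))).congr_of_eventuallyEq ?_
  filter_upwards [Metric.ball_mem_nhds y hε] with t ht
  rw [← mean_sub_eq' hδ hρ hw ht, add_sub_cancel]

end DobrushinDomain

end Derivative

end QuantumIsing
end

/-! ### Normalization, directions, and s-holomorphicity. -/

noncomputable section
namespace QuantumIsing

section Observable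

namespace DobrushinDomain

variable {δ : ℝ} {D : DobrushinDomain δ}

/-- The density is at least 1 with respect to a probability measure, and it is integrable. -/
lemma weightedLaw_univ (hδ : 0 < δ) (ρ : ℝ) :
    D.weightedLaw ρ Set.univ ≠ 0 ∧ D.weightedLaw ρ Set.univ ≠ ⊤ := by
  have := isProbabilityMeasure_percolationLaw (D := D) hδ ρ
  rw [weightedLaw, withDensity_apply _ MeasurableSet.univ, Measure.restrict_univ]
  refine ⟨(lt_of_lt_of_le one_pos ?_).ne', (integrable_numLoops hδ ρ).lintegral_lt_top.ne⟩
  calc (1 : ENNReal) = ∫⁻ _, 1 ∂D.percolationLaw ρ ρ := by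
        rw [lintegral_one, measure_univ]
    _ ≤ _ := lintegral_mono fun ω => by
        rw [ENNReal.one_le_ofReal]
        exact one_le_pow₀ (Real.one_le_sqrt.2 one_le_two)

theorem isProbabilityMeasure_quantumIsing (hδ : 0 < δ) (ρ : ℝ) :
    IsProbabilityMeasure (D.quantumIsing ρ) where
  measure_univ := by
    rw [quantumIsing, Measure.smul_apply, smul_eq_mul]
    exact ENNReal.inv_mul_cancel (weightedLaw_univ hδ ρ).1 (weightedLaw_univ hδ ρ).2

theorem integrable_spin (hδ : 0 < δ) (ρ : ℝ) (e : ℤ × ℝ) :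
    Integrable (fun ω => D.spin ω.points e) (D.quantumIsing ρ) := by
  have := isProbabilityMeasure_quantumIsing (D := D) hδ ρ
  exact Integrable.mono' (integrable_const 1) (measurable_spin hδ e).aestronglyMeasurable
    (Filter.Eventually.of_forall fun ω => norm_spin_le _ _)

variable (D) in
/-- The ratio between the observable, up to the constant `ν`, and its unnormalised form. -/
def normalization (ρ : ℝ) : ℝ := (√δ)⁻¹ * (D.weightedLaw ρ Set.univ)⁻¹.toReal

/-- The factor does not depend on `e`, and both sides vanish off the mid-edge domain; linear
relations can be proved on `mean`. -/
lemma observable_eq (hδ : 0 < δ) (ρ : ℝ) (e : ℤ × ℝ) :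
    D.observable ρ e = nu * D.normalization ρ * D.mean ρ e := by
  by_cases he : e ∈ D.midEdges
  · have hm : Measurable fun ω : Config => ENNReal.ofReal (√2 ^ D.numLoops ω.points) :=
      (measurable_from_top (f := fun n : ℕ => ENNReal.ofReal (√2 ^ n))).comp
        (measurable_numLoops hδ)
    rw [observable, if_pos he, quantumIsing, integral_smul_measure, weightedLaw,
      integral_withDensity_eq_integral_toReal_smul hm
        (Filter.Eventually.of_forall fun _ => ENNReal.ofReal_lt_top), ← weightedLaw]
    have hw : ∀ ω : Config, (ENNReal.ofReal (√2 ^ D.numLoops ω.points)).toReal •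
        D.spin ω.points e = D.weight ω.points e := fun ω => by
      rw [ENNReal.toReal_ofReal (by positivity), weight, Complex.real_smul, Complex.ofReal_pow]
    simp only [hw]
    rw [← mean, Complex.real_smul, normalization]
    push_cast
    ring
  · rw [observable, if_neg he, mean_eq_zero ρ he, mul_zero]

/-- A half-turn changes both the column and the rotation, in units of π, by an odd number. -/
lemma Path.even_winding {C : Set (ℤ × ℝ)} {e e' : ℤ × ℝ} {w : ℤ} (h : D.Path C e e' w) :
    Even (w + e.1 - e'.1) := by
  have hturn : ∀ j, Odd (eastTurn j) := fun j => by
    rw [eastTurn]; split_ifs <;> decide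
  induction h with
  | straight => simp
  | @east j _ _ _ _ _ _ _ _ ih =>
    obtain ⟨a, ha⟩ := hturn j
    obtain ⟨b, hb⟩ := ih
    exact ⟨a + b, by simp only at hb ⊢; lia⟩
  | @west j _ _ _ _ _ _ _ _ ih =>
    obtain ⟨a, ha⟩ := hturn j
    obtain ⟨b, hb⟩ := ih
    exact ⟨b - a, by simp only at hb ⊢; lia⟩

/-- The direction `1` or `i`, according to parity. -/
def _root_.QuantumIsing.phase (j : ℤ) : ℂ := if Even j then 1 else Complex.I

lemma exp_winding (w : ℤ) :
    ∃ c : ℝ, Complex.exp (Complex.I / 2 * ((Real.pi * (w : ℝ) : ℝ) : ℂ)) = c * phase w := by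
  rcases Int.even_or_odd' w with ⟨k, rfl | rfl⟩
  · refine ⟨(-1) ^ k, ?_⟩
    rw [phase, if_pos (even_two_mul k), mul_one]
    push_cast
    rw [← Complex.exp_pi_mul_I, ← Complex.exp_int_mul]
    congr 1
    ring
  · refine ⟨(-1) ^ k, ?_⟩
    have : ¬Even (2 * k + 1) := by simp
    rw [phase, if_neg this]
    push_cast
    rw [← Complex.exp_pi_mul_I, ← Complex.exp_int_mul,
      show Complex.I / 2 * (Real.pi * (2 * k + 1)) = k * (Real.pi * Complex.I) +
        Real.pi / 2 * Complex.I by ring, Complex.exp_add, Complex.exp_pi_div_two_mul_I]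

lemma exists_spin_eq (C : Set (ℤ × ℝ)) (e : ℤ × ℝ) :
    ∃ c : ℝ, D.spin C e = c * phase (D.bMid.1 - e.1) := by
  rw [spin]
  split_ifs with h
  · have hw : ∃ w, D.Path C e D.bMid w := h.2.2
    rw [winding, dif_pos hw]
    obtain ⟨c, hc⟩ := exp_winding hw.choose
    refine ⟨c, ?_⟩
    have hp := hw.choose_spec.even_winding
    have hiff : Even hw.choose ↔ Even (D.bMid.1 - e.1) := by
      rw [show hw.choose + e.1 - D.bMid.1 = hw.choose - (D.bMid.1 - e.1) by ring,
        Int.even_sub] at hp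
      exact hp
    rw [hc]
    simp only [phase, hiff]
  · exact ⟨0, by simp⟩

lemma exists_mean_eq (ρ : ℝ) (e : ℤ × ℝ) :
    ∃ c : ℝ, D.mean ρ e = c * phase (D.bMid.1 - e.1) := by
  choose c hc using fun ω : Config => exists_spin_eq (D := D) ω.points e
  refine ⟨∫ ω, √2 ^ D.numLoops ω.points * c ω ∂D.percolationLaw ρ ρ, ?_⟩
  rw [← integral_complex_ofReal, ← integral_mul_const, mean]
  congr 1
  funext ω
  rw [weight, hc]
  push_cast
  ring

/-! #### Directions -/

/-- Here i(w - u) = ±iδ/2 according to the parity of the column, and the principal values are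
i^(-1/2) = ν and (-i)^(-1/2) = iν. -/
lemma _root_.QuantumIsing.tau_eq (hδ : 0 < δ) (e : ℤ × ℝ) :
    ∃ κ : ℝ, κ ≠ 0 ∧ tau δ e = κ * (nu * phase e.1) := by
  have hr : (0 : ℝ) < (δ / 2) ^ (-(1 / 2) : ℝ) := Real.rpow_pos_of_pos (by positivity) _
  have hpow : ∀ z : ℂ, z ≠ 0 → (((δ / 2 : ℝ) : ℂ) * z) ^ (-(1 / 2) : ℂ) =
      (((δ / 2) ^ (-(1 / 2) : ℝ) : ℝ) : ℂ) * z ^ (-(1 / 2) : ℂ) := by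
    intro z hz
    have h0 : (0 : ℝ) < δ / 2 := by positivity
    have h1 : ((δ / 2 : ℝ) : ℂ) ≠ 0 := by exact_mod_cast h0.ne'
    rw [Complex.cpow_def_of_ne_zero (mul_ne_zero h1 hz), Complex.cpow_def_of_ne_zero hz,
      Complex.log_ofReal_mul h0 hz, add_mul, Complex.exp_add, Real.rpow_def_of_pos h0]
    push_cast
    rfl
  refine ⟨_, hr.ne', ?_⟩
  by_cases he : Even e.1
  · have h1 : Complex.I * (dualEnd δ e - primalEnd δ e) = ((δ / 2 : ℝ) : ℂ) * Complex.I := by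
      rw [dualEnd, primalEnd, if_pos he, if_pos he]
      apply Complex.ext <;> simp [medialPos]
      ring
    rw [tau, h1, hpow _ Complex.I_ne_zero, phase, if_pos he, mul_one, nu, Complex.cpow_def_of_ne_zero Complex.I_ne_zero,
      Complex.log_I]
    congr 2
    ring
  · have h1 : Complex.I * (dualEnd δ e - primalEnd δ e) = ((δ / 2 : ℝ) : ℂ) * (-Complex.I) := by
      rw [dualEnd, primalEnd, if_neg he, if_neg he]
      apply Complex.ext <;> simp [medialPos]
      ring
    rw [tau, h1, hpow _ (neg_ne_zero.2 Complex.I_ne_zero), phase, if_neg he, nu, Complex.cpow_def_of_ne_zero (neg_ne_zero.2 Complex.I_ne_zero),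
      Complex.log_neg_I, show -(Real.pi / 2 : ℂ) * Complex.I * -(1 / 2) =
        -(Complex.I * Real.pi / 4) + Real.pi / 2 * Complex.I by ring, Complex.exp_add,
      Complex.exp_pi_div_two_mul_I]

/-- Columns of opposite parities have directions differing by a real multiple of i, hence
orthogonal. -/
lemma _root_.QuantumIsing.proj_tau_eq_zero (hδ : 0 < δ) {e e' : ℤ × ℝ} (h : Odd (e'.1 - e.1))
    (c : ℝ) : proj (c * tau δ e') (tau δ e) = 0 := by
  obtain ⟨κ, hκ, h1⟩ := tau_eq hδ e
  obtain ⟨κ', -, h2⟩ := tau_eq hδ e'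
  have hκ : (κ : ℂ) ≠ 0 := by exact_mod_cast hκ
  have hnu : nu ≠ 0 := Complex.exp_ne_zero _
  have hnu' : starRingEnd ℂ nu ≠ 0 := (map_ne_zero _).2 hnu
  have hI := Complex.I_ne_zero
  rw [h1, h2, proj]
  simp only [map_mul, Complex.conj_ofReal]
  by_cases he : Even e.1
  · have he' : ¬Even e'.1 := fun he' => Int.not_even_iff_odd.2 h (he'.sub he)
    rw [phase, phase, if_pos he, if_neg he', map_one, Complex.conj_I]
    field_simp
    ring
  · have he' : Even e'.1 := by
      by_contra he'
      exact Int.not_even_iff_odd.2 h ((Int.not_even_iff_odd.1 he').sub_odd (Int.not_even_iff_odd.1 he))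
    rw [phase, phase, if_neg he, if_pos he', map_one, Complex.conj_I]
    field_simp
    ring

/-- The choice of ρ enters here: i√2ρ = i/δ, exactly the coefficient required by ∂̄ = 0. -/
lemma hasDerivAt_of_mean (hδ : 0 < δ) {ρ : ℝ} (hρ : ρ = 1 / (√2 * δ)) {F : ℤ × ℝ → ℂ} {K : ℂ}
    (hF : ∀ e, F e = K * D.mean ρ e) {j : ℤ} {y : ℝ} (h : midEdgePos δ (j, y) ∈ D.carrier)
    (hr : midEdgePos δ (j + 1, y) ∉ frontier D.carrier)
    (hl : midEdgePos δ (j - 1, y) ∉ frontier D.carrier) :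
    HasDerivAt (fun t => F (j, t)) (Complex.I / δ * (F (j + 1, y) - F (j - 1, y))) y := by
  have hρ0 : 0 ≤ ρ := by rw [hρ]; positivity
  have hd := (hasDerivAt_mean hδ hρ0 h hr hl).const_mul K
  simp only [hF]
  refine hd.congr_deriv ?_
  have h2 : ((√2 : ℝ) : ℂ) ≠ 0 := by exact_mod_cast (Real.sqrt_pos.2 two_pos).ne'
  have h3 : (δ : ℂ) ≠ 0 := by exact_mod_cast hδ.ne'
  rw [hρ]
  push_cast
  field_simp

/-- The values of F◇ at the ends of `e` are F(e⁻) + F(e) and F(e) + F(e⁺), and the terms at e±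
project to 0. The relation ∂̄F◇ = 0 at p is the sum of those for F at the two mid-edges of p, which
are inside the domain and neighbours of each other; only the outer neighbours need an assumption. -/
theorem sHolomorphic_of_mean (hδ : 0 < δ) {ρ : ℝ} (hρ : ρ = 1 / (√2 * δ)) {F : ℤ × ℝ → ℂ} {K : ℂ}
    (hF : ∀ e, F e = K * D.mean ρ e) (hτ : ∀ e, ∃ c : ℝ, F e = c * tau δ e) :
    D.IsSHolomorphic F ∧ D.IsMedialSHolomorphic fun p => F (p.1 - 1, p.2) + F (p.1, p.2) := by
  have h3 : (δ : ℂ) ≠ 0 := by exact_mod_cast hδ.ne'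
  have hI := Complex.I_ne_zero
  refine ⟨⟨fun e _ => hτ e, ?_⟩, ?_, ?_⟩
  · rintro ⟨j, y⟩ h hr hl
    have hd := hasDerivAt_of_mean hδ hρ hF h hr hl
    refine ⟨hd.differentiableAt, ?_⟩
    rw [dbar, hd.deriv]
    field_simp
    ring
  · rintro ⟨j, y⟩ -
    obtain ⟨c, hc⟩ := hτ (j - 1, y)
    obtain ⟨c', hc'⟩ := hτ (j + 1, y)
    have h1 := proj_tau_eq_zero hδ (e := (j, y)) (e' := (j - 1, y)) (by simp) c
    have h2 := proj_tau_eq_zero hδ (e := (j, y)) (e' := (j + 1, y)) (by simp) c'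
    have hadd : ∀ X Y t, proj (X + Y) t = proj X t + proj Y t := fun X Y t => by
      simp only [proj, map_add]; ring
    simp only [hadd, add_sub_cancel_right, hc, hc', h1, h2]
    ring
  · rintro ⟨c, y⟩ h hr hl
    obtain ⟨hm1, hm2⟩ := midEdge_mem_of_medial hδ h
    have hd1 := hasDerivAt_of_mean hδ hρ hF hm1
      (by rw [sub_add_cancel]; exact not_mem_frontier_of_mem hm2)
      (by rw [sub_sub]; exact hl)
    have hd2 := hasDerivAt_of_mean hδ hρ hF hm2 hr (not_mem_frontier_of_mem hm1)
    have hd := hd1.add hd2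
    refine ⟨hd.differentiableAt, ?_⟩
    rw [dbar]
    change 1 / 2 * (_ - deriv ((fun t => F (c - 1, t)) + fun t => F (c, t)) y / Complex.I) = 0
    rw [hd.deriv]
    simp only [add_sub_cancel_right, sub_add_cancel, sub_sub]
    field_simp
    ring

end DobrushinDomain

end Observable

end QuantumIsing
end

theorem proposition3p3 (δ : ℝ) (hδ : 0 < δ) (D : QuantumIsing.DobrushinDomain δ)
    (ρ : ℝ) (hρ : ρ = 1 / (√2 * δ)) :
    IsProbabilityMeasure (D.quantumIsing ρ) ∧
    (∀ e ∈ D.midEdges, Integrable (fun ω => D.spin ω.points e) (D.quantumIsing ρ)) ∧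
    (D.bWhite.1 = D.bBlack.1 + 1 →
      D.IsSHolomorphic (D.observable ρ) ∧
      D.IsMedialSHolomorphic (D.medialObservable ρ)) ∧
    (D.bWhite.1 = D.bBlack.1 - 1 →
      D.IsSHolomorphic (fun e => Complex.I * D.observable ρ e) ∧
      D.IsMedialSHolomorphic (fun p => Complex.I * D.medialObservable ρ p)) := by
  open QuantumIsing DobrushinDomain in
  have hb : Even D.bBlack.1 := D.primal D.r le_rfl
  refine ⟨isProbabilityMeasure_quantumIsing hδ ρ, fun e _ => integrable_spin hδ ρ e,
    fun h => ?_, fun h => ?_⟩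
  -- The interface ends in an even column, so the phase of the spin depends on the parity of `e`
  -- alone and agrees with that of `tau δ e`.
  · have hbm : Even D.bMid.1 := by
      rw [bMid, h, min_eq_left (by lia)]; exact hb
    refine sHolomorphic_of_mean hδ hρ (observable_eq hδ ρ) fun e => ?_
    obtain ⟨c, hc⟩ := exists_mean_eq (D := D) ρ e
    obtain ⟨κ, hκ, ht⟩ := tau_eq hδ e
    have hκ : (κ : ℂ) ≠ 0 := by exact_mod_cast hκ
    refine ⟨D.normalization ρ * c / κ, ?_⟩
    rw [observable_eq hδ, hc, ht]
    have : phase (D.bMid.1 - e.1) = phase e.1 := by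
      simp only [phase, Int.even_sub, hbm, true_iff]
    rw [this]
    push_cast
    field_simp
  -- The interface ends in an odd column: the phases 1 and i are exchanged relative to `tau δ e`,
  -- and the extra factor i restores the direction, up to the sign i² = -1 in even columns.
  · have hbm : ¬Even D.bMid.1 := by
      rw [bMid, h, min_eq_right (by lia), Int.even_sub_one, not_not]; exact hb
    have key := sHolomorphic_of_mean (D := D) hδ hρ (F := fun e => Complex.I * D.observable ρ e)
      (K := Complex.I * (nu * D.normalization ρ))
      (fun e => by simp only [observable_eq hδ ρ, mul_assoc]) fun e => ?_
    · simpa only [medialObservable, mul_add] using key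
    obtain ⟨c, hc⟩ := exists_mean_eq (D := D) ρ e
    obtain ⟨κ, hκ, ht⟩ := tau_eq hδ e
    have hκ : (κ : ℂ) ≠ 0 := by exact_mod_cast hκ
    rw [observable_eq hδ, hc, ht]
    by_cases he : Even e.1
    · refine ⟨-(D.normalization ρ * c / κ), ?_⟩
      have : ¬Even (D.bMid.1 - e.1) := by simp [Int.even_sub, hbm, he]
      rw [phase, phase, if_neg this, if_pos he]
      push_cast
      field_simp
      rw [Complex.I_sq]
      ring
    · refine ⟨D.normalization ρ * c / κ, ?_⟩
      have : Even (D.bMid.1 - e.1) := by simp [Int.even_sub, hbm, he]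
      rw [phase, phase, if_pos this, if_neg he]
      push_cast
      field_simp
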